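/- Let $d\ge 1$, $\alpha\in(0,1)$ and $\vartheta_X,\vartheta_Y\in(0,1)$. For vectors $u,v\in\mathbb R^d$ let $\mathsf{Ang}(u,v)=\arccos\{u^\top v/(\|u\|\|v\|)\}$, and let $$h(x_1,x_2;y_1,y_2)=\tfrac13-\tfrac1{2\pi}\mathsf{Ang}(x_1-y_1,x_2-y_1)-\tfrac1{2\pi}\mathsf{Ang}(y_1-x_1,y_2-x_1).$$ For a pooled sample $z=(x_1,\dots,x_m,y_1,\dots,y_n)$ of size $N=m+n$, $m,n\ge2$, let $$T_{m,n}(z)=N\,U_{\mathrm{CvM}}=\frac{N}{m(m-1)n(n-1)}\sum_{i_1\ne i_2}\ \sum_{j_1\ne j_2}h(x_{i_1},x_{i_2};y_{j_1},y_{j_2}).$$ Given independent i.i.d. samples $X_1,\dots,X_m\sim P_X$ and $Y_1,\dots,Y_n\sim P_Y$ in $\mathbb R^d$ with pooled sample $Z=(X_1,\dots,X_m,Y_1,\dots,Y_n)$, the permutation critical value is $$c_{\alpha}=\inf\Big\{t\in\mathbb R:\ 1-\alpha\le\frac1{N!}\sum_{\varpi\in\mathcal S_N}\mathbf 1\big(T_{m,n}(Z_{\varpi(1)},\dots,Z_{\varpi(N)})\le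 t\big)\Big\},$$ and the oracle critical value is $$c^\ast_{\alpha}=\inf\big\{t\in\mathbb R:\ 1-\alpha\le\mathbb P\big(T_{m,n}(\widetilde Z_1,\dots,\widetilde Z_N)\le t\big)\big\},$$ where $\widetilde Z_1,\dots,\widetilde Z_N$ are i.i.d. from the mixture $\vartheta_XP_X+\vartheta_YP_Y$. Theorem (Asymptotic behavior of the critical values). Let $N=m+n\to\infty$ with $m/N\to\vartheta_X$ and $n/N\to\vartheta_Y$ (along any sequence of pairs $(m,n)$ with $m,n\ge 2$). Then $c^\ast_{\alpha}-c_{\alpha}\to0$ in probability in each of the following situations. (i) (Null hypothesis and fixed alternatives.) $P_X$ and $P_Y$ are fixed probability measures on $\mathbb R^d$, equal or different, such that, for almost every direction $\beta$ with respect to the uniform distribution on the unit sphere $\mathbb S^{d-1}$, $\beta^\top X$ and $\beta^\top Y$ have continuous distribution functions, where $X\sim P_X$ and $Y\sim P_Y$. (ii) (Contiguous alternatives.) $P_X=P_{\theta_0}$ and $P_Y=P_{\theta_0+bN^{-1/2}}$, where $b\in\mathbb R^k$, $\Omega\subseteq\mathbb R^k$ is open, $\theta_0\in\Omega$, and $\{P_\theta:\theta\in\Omega\}$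 is a family of probability measures on $\mathbb R^d$ with Lebesgue densities $p_\theta$ that is quadratic mean differentiable at $\theta_0$, that is, for some measurable $\eta:\mathbb R^d\to\mathbb R^k$, $$\int_{\mathbb R^d}\Big[\sqrt{p_{\theta_0+h}(t)}-\sqrt{p_{\theta_0}(t)}-\langle\eta(t),h\rangle\Big]^2dt=o(\|h\|^2)\quad\text{as }\|h\|\to0.$$ -/

import Mathlib

open MeasureTheory ProbabilityTheory Filter Topology

noncomputable section

namespace CvM

/-- The uniform probability measure on the unit sphere of `ℝ^d`
(normalized surface measure). -/
def uniformSphere (d : ℕ) : Measure (Metric.sphere (0 : EuclideanSpace ℝ (Fin d)) 1) :=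
  let S : Measure (Metric.sphere (0 : EuclideanSpace ℝ (Fin d)) 1) :=
    (volume : Measure (EuclideanSpace ℝ (Fin d))).toSphere
  (S Set.univ)⁻¹ • S

/-- For almost every direction `β` of the unit sphere, the distribution function of the
projection `⟨β, X⟩`, where `X` has law `P`, is continuous. -/
def HasContinuousProjections {d : ℕ} (P : Measure (EuclideanSpace ℝ (Fin d))) : Prop :=
  ∀ᵐ β : Metric.sphere (0 : EuclideanSpace ℝ (Fin d)) 1 ∂(uniformSphere d),
    Continuous (cdf (P.map fun x => inner ℝ β.1 x))

/-- The kernel of the multivariate Cramér-von Mises statistic. Here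
`InnerProductGeometry.angle u v` is `arccos (⟨u, v⟩ / (‖u‖ ‖v‖))`. -/
def kernel {d : ℕ} (x₁ x₂ y₁ y₂ : EuclideanSpace ℝ (Fin d)) : ℝ :=
  1 / 3 - 1 / (2 * Real.pi) * InnerProductGeometry.angle (x₁ - y₁) (x₂ - y₁)
    - 1 / (2 * Real.pi) * InnerProductGeometry.angle (y₁ - x₁) (y₂ - x₁)

/-- The Cramér-von Mises U-statistic of two samples of sizes `m` and `n`: the sums run over
all ordered pairs of distinct indices, and `m.descFactorial 2` is `m * (m - 1)`. -/
def uStat {d m n : ℕ} (x : Fin m → EuclideanSpace ℝ (Fin d))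
    (y : Fin n → EuclideanSpace ℝ (Fin d)) : ℝ :=
  1 / ((m.descFactorial 2 : ℝ) * (n.descFactorial 2 : ℝ)) *
    ∑ i ∈ (Finset.univ : Finset (Fin m)).offDiag,
      ∑ j ∈ (Finset.univ : Finset (Fin n)).offDiag,
        kernel (x i.1) (x i.2) (y j.1) (y j.2)

/-- The scaled statistic `N * U` of a pooled sample of size `N = m + n`, whose first `m`
entries form the first sample and whose last `n` entries form the second sample. -/
def scaledStat {d : ℕ} (m n : ℕ) (z : Fin (m + n) → EuclideanSpace ℝ (Fin d)) : ℝ :=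
  ((m + n : ℕ) : ℝ) * uStat (fun i => z (Fin.castAdd n i)) (fun j => z (Fin.natAdd m j))

/-- The critical value of the oracle test at level `α` for the statistic `T`: the
`1 - α` quantile of `T` on `N` new i.i.d. observations from `H`. -/
def oracleCriticalValue {E : Type*} [MeasurableSpace E] {N : ℕ} (α : ℝ)
    (T : (Fin N → E) → ℝ) (H : Measure E) : ℝ :=
  sInf {t : ℝ | 1 - α ≤ (Measure.pi fun _ : Fin N => H).real {z | T z ≤ t}}

open Classical in
/-- The critical value of the permutation test at level `α` for the statistic `T` at the
pooled sample `z`: the `1 - α` quantile of `T` over all permutations of `z`. -/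
def permutationCriticalValue {E : Type*} {N : ℕ} (α : ℝ)
    (T : (Fin N → E) → ℝ) (z : Fin N → E) : ℝ :=
  sInf {t : ℝ | 1 - α ≤ 1 / (N.factorial : ℝ) *
    ∑ σ : Equiv.Perm (Fin N), if T (fun i => z (σ i)) ≤ t then (1 : ℝ) else 0}

/-- The mixture `p * P + q * Q` of two measures. -/
def mixture {E : Type*} [MeasurableSpace E] (p q : ℝ) (P Q : Measure E) : Measure E :=
  ENNReal.ofReal p • P + ENNReal.ofReal q • Q

/-- `X` is an i.i.d. sample from `P`, `Y` is an i.i.d. sample from `Q`, and the two samples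
are independent. -/
structure IsTwoSample {Ω E : Type*} [MeasurableSpace Ω] [MeasurableSpace E] {m n : ℕ}
    (μ : Measure Ω) (X : Fin m → Ω → E) (Y : Fin n → Ω → E) (P Q : Measure E) : Prop where
  law_left : ∀ i, HasLaw (X i) P μ
  law_right : ∀ j, HasLaw (Y j) Q μ
  indep : iIndepFun (Fin.append X Y) μ

/-- The pooled sample `(X₁, …, Xₘ, Y₁, …, Yₙ)` at the outcome `ω`. -/
def pooled {Ω E : Type*} {m n : ℕ} (X : Fin m → Ω → E) (Y : Fin n → Ω → E) (ω : Ω) :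
    Fin (m + n) → E :=
  Fin.append (fun i => X i ω) (fun j => Y j ω)

/-- Convergence to zero in probability of real random variables, the `ν`-th of which lives
on the probability space `(Ω ν, μ ν)`. -/
def TendstoZeroInProbability {Ω : ℕ → Type*} [∀ ν, MeasurableSpace (Ω ν)]
    (μ : ∀ ν, Measure (Ω ν)) (W : ∀ ν, Ω ν → ℝ) : Prop :=
  ∀ ε : ℝ, 0 < ε → Tendsto (fun ν => μ ν {ω | ε ≤ |W ν ω|}) atTop (𝓝 0)

/-- The Lebesgue density of a measure on `ℝ^d`. -/
def density {d : ℕ} (P : Measure (EuclideanSpace ℝ (Fin d)))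
    (t : EuclideanSpace ℝ (Fin d)) : ℝ :=
  (P.rnDeriv volume t).toReal

/-- Quadratic mean differentiability at `θ₀` of a family of laws with Lebesgue densities. -/
def IsQMDAt {d k : ℕ}
    (P : EuclideanSpace ℝ (Fin k) → Measure (EuclideanSpace ℝ (Fin d)))
    (θ₀ : EuclideanSpace ℝ (Fin k)) : Prop :=
  ∃ η : EuclideanSpace ℝ (Fin d) → EuclideanSpace ℝ (Fin k), Measurable η ∧
    (∀ᶠ h in 𝓝 (0 : EuclideanSpace ℝ (Fin k)), Integrable
      (fun t => (√(density (P (θ₀ + h)) t) - √(density (P θ₀) t) - inner ℝ (η t) h) ^ 2)) ∧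
    (fun h : EuclideanSpace ℝ (Fin k) =>
      ∫ t, (√(density (P (θ₀ + h)) t) - √(density (P θ₀) t) - inner ℝ (η t) h) ^ 2)
      =o[𝓝 0] (fun h : EuclideanSpace ℝ (Fin k) => ‖h‖ ^ 2)

end CvM

end

/-! No limit law is computed. All estimates are nonasymptotic, with constants independent of the
dimension, the sample sizes and the two laws as long as both sample proportions stay away from zero.
Fixed and moving alternatives are therefore one case (`tendstoZero_criticalValue`). The laws enter
only through the absence of atoms, which makes the pooled observations almost surely distinct.

For distinct observations the angles of every triangle sum to π. This turns the statistic into a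
constant plus 1/N times a quadratic and a linear form in the centred group weights
(`scaledStat_eq_polyStat`), and permuting the sample becomes permuting the weights. Since the
weights sum to zero, exchanging an index with a uniformly chosen one bounds all permutation moments
needed (`abs_expect_mul_weight_le`). Replacing one observation moves the statistic by order N^(-1/2)
in fourth permutation mean. The permutation average of a smooth function of the statistic moves only
by order 1/N, for every data set, because the leading part of the change is multiplied by a single
centred weight and nearly averages out (`RowPerturbation.abs_expect_comp_sub_le`).

Consequently such a permutation average has variance O(1/N) by Efron-Stein. Its mean under the
two-sample design differs from its mean under the i.i.d. mixture by O(1/N) times E|Bin(N, ϑX) - m|,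
which is o(1) (`abs_integral_mixture_sub_le`). The latter mean is that of the oracle statistic, by
exchangeability. So the smoothed permutation and oracle distribution functions are close.

Closeness of quantiles also needs the oracle distribution function not to be flat near its quantile,
uniformly in N. This is obtained without a limit law: Efron-Stein for the truncated statistic shows
that an interval separating two substantial parts of the mass must itself carry mass
(`gap_mass_inequality`). -/

namespace CvM

open scoped BigOperators
open Finset (univ)

/-! ### Moments of linear and quadratic forms in randomly permuted centred weights. -/

section PermutationMoments

variable {ι : Type*} [Fintype ι] [DecidableEq ι]

/-- The linear permutation statistic `∑ k, b (σ k) * d k`. -/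
def permLinear (b d : ι → ℝ) (σ : Equiv.Perm ι) : ℝ := ∑ k, b (σ k) * d k

/-- The quadratic permutation statistic `∑ j, ∑ k, b (σ j) * b (σ k) * e j k`. -/
def permQuadratic (b : ι → ℝ) (e : ι → ι → ℝ) (σ : Equiv.Perm ι) : ℝ :=
  ∑ j, b (σ j) * permLinear b (e j) σ

lemma expect_mono {κ : Type*} [Fintype κ] {f g : κ → ℝ} (h : ∀ i, f i ≤ g i) :
    𝔼 i, f i ≤ 𝔼 i, g i :=
  Finset.expect_le_expect fun i _ => h i

lemma expect_le_of_le {κ : Type*} [Fintype κ] [Nonempty κ] {f : κ → ℝ} {c : ℝ}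
    (h : ∀ i, f i ≤ c) : 𝔼 i, f i ≤ c :=
  (expect_mono h).trans_eq (Fintype.expect_const c)

/-- Exchanging `k` with a uniformly chosen index shows that a centred weight is nearly
uncorrelated with any function that is stable under transpositions. -/
lemma abs_expect_mul_weight_le {b : ι → ℝ} (hb : ∑ i, b i = 0) (hb1 : ∀ i, |b i| ≤ 1)
    (g : Equiv.Perm ι → ℝ) (k : ι) {K : ℝ}
    (hK : ∀ j, 𝔼 σ, |g (σ * Equiv.swap k j) - g σ| ≤ K) :
    |𝔼 σ, g σ * b (σ k)| ≤ K := by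
  have : Nonempty ι := ⟨k⟩
  have h1 : ∀ j, 𝔼 σ, g σ * b (σ k) = 𝔼 σ, g (σ * Equiv.swap k j) * b (σ j) := by
    intro j
    refine (Fintype.expect_equiv (Equiv.mulRight (Equiv.swap k j)) _ _ fun σ => ?_).symm
    simp
  have h2 : 𝔼 j : ι, 𝔼 σ : Equiv.Perm ι, g σ * b (σ j) = 0 := by
    rw [Finset.expect_comm]
    refine Finset.expect_eq_zero fun σ _ => ?_
    rw [← Finset.mul_expect, Fintype.expect_eq_sum_div_card, Equiv.sum_comp σ b, hb]
    simp
  have h3 : 𝔼 σ, g σ * b (σ k)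
      = 𝔼 j : ι, 𝔼 σ : Equiv.Perm ι, (g (σ * Equiv.swap k j) - g σ) * b (σ j) := by
    have : 𝔼 j : ι, 𝔼 σ : Equiv.Perm ι, g (σ * Equiv.swap k j) * b (σ j)
        = 𝔼 σ, g σ * b (σ k) := by
      rw [← Fintype.expect_const (ι := ι) (𝔼 σ, g σ * b (σ k))]
      exact Finset.expect_congr rfl fun j _ => (h1 j).symm
    simp only [sub_mul, Finset.expect_sub_distrib]
    rw [this, h2, sub_zero]
  rw [h3]
  refine (Finset.abs_expect_le _ _).trans (expect_le_of_le fun j => ?_)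
  refine (Finset.abs_expect_le _ _).trans ((expect_mono fun σ => ?_).trans (hK j))
  rw [abs_mul]
  exact mul_le_of_le_one_right (abs_nonneg _) (hb1 _)

lemma permLinear_swap (b d : ι → ℝ) (σ : Equiv.Perm ι) (k j : ι) :
    permLinear b d (σ * Equiv.swap k j)
      = permLinear b d σ + (b (σ j) - b (σ k)) * (d k - d j) := by
  rcases eq_or_ne k j with rfl | hkj
  · rw [Equiv.swap_self, ← Equiv.Perm.one_def, mul_one, sub_self, zero_mul, add_zero]
  have hj : j ∈ univ.erase k := Finset.mem_erase.2 ⟨hkj.symm, Finset.mem_univ _⟩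
  unfold permLinear
  rw [← Finset.add_sum_erase _ _ (Finset.mem_univ k), ← Finset.add_sum_erase _ _ hj,
    ← Finset.add_sum_erase univ (fun i => b (σ i) * d i) (Finset.mem_univ k),
    ← Finset.add_sum_erase (univ.erase k) (fun i => b (σ i) * d i) hj]
  have : ∑ x ∈ (univ.erase k).erase j, b ((σ * Equiv.swap k j) x) * d x
      = ∑ x ∈ (univ.erase k).erase j, b (σ x) * d x := by
    refine Finset.sum_congr rfl fun x hx => ?_
    simp only [Finset.mem_erase, Finset.mem_univ, and_true] at hx
    rw [Equiv.Perm.mul_apply, Equiv.swap_apply_of_ne_of_ne hx.2 hx.1]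
  rw [this]
  simp only [Equiv.Perm.mul_apply, Equiv.swap_apply_left, Equiv.swap_apply_right]
  ring

lemma abs_permLinear_swap_sub_le {b d : ι → ℝ} (hb1 : ∀ i, |b i| ≤ 1) (hd : ∀ i, |d i| ≤ 1)
    (σ : Equiv.Perm ι) (k j : ι) :
    |permLinear b d (σ * Equiv.swap k j) - permLinear b d σ| ≤ 4 := by
  rw [permLinear_swap, add_sub_cancel_left, abs_mul]
  have h1 : |b (σ j) - b (σ k)| ≤ 2 :=
    (abs_sub _ _).trans (by linarith [hb1 (σ j), hb1 (σ k)])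
  have h2 : |d k - d j| ≤ 2 := (abs_sub _ _).trans (by linarith [hd k, hd j])
  calc _ ≤ (2 : ℝ) * 2 := mul_le_mul h1 h2 (abs_nonneg _) (by norm_num)
    _ = 4 := by norm_num

/-- A moment bootstrap: taking for `g` the first or third power of the linear statistic bounds its
second or fourth moment, since the change of that power under a transposition involves only lower
moments. -/
lemma expect_mul_permLinear_le {b d : ι → ℝ} (hb : ∑ i, b i = 0) (hb1 : ∀ i, |b i| ≤ 1)
    (hd : ∀ i, |d i| ≤ 1) (g : Equiv.Perm ι → ℝ) {K : ℝ}
    (hK : ∀ k j, 𝔼 σ, |g (σ * Equiv.swap k j) - g σ| ≤ K) :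
    𝔼 σ, g σ * permLinear b d σ ≤ Fintype.card ι * K := by
  have : 𝔼 σ, g σ * permLinear b d σ = ∑ k, d k * 𝔼 σ, g σ * b (σ k) := by
    simp only [permLinear, Finset.mul_sum, Finset.mul_expect]
    rw [Finset.expect_sum_comm]
    exact Finset.sum_congr rfl fun k _ => Finset.expect_congr rfl fun σ _ => by ring
  rw [this, ← nsmul_eq_mul, ← Finset.card_univ]
  refine Finset.sum_le_card_nsmul _ _ _ fun k _ => (le_abs_self _).trans ?_
  rw [abs_mul]
  exact (mul_le_of_le_one_left (abs_nonneg _) (hd k)).trans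
    (abs_expect_mul_weight_le hb hb1 g k (hK k))

/-- Second moment of a linear permutation statistic. -/
lemma expect_permLinear_sq_le {b d : ι → ℝ} (hb : ∑ i, b i = 0) (hb1 : ∀ i, |b i| ≤ 1)
    (hd : ∀ i, |d i| ≤ 1) :
    𝔼 σ, permLinear b d σ ^ 2 ≤ 4 * Fintype.card ι := by
  have := expect_mul_permLinear_le hb hb1 hd (permLinear b d) (K := 4)
    fun k j => expect_le_of_le fun σ => abs_permLinear_swap_sub_le hb1 hd σ k j
  calc _ = 𝔼 σ, permLinear b d σ * permLinear b d σ := by simp only [sq]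
    _ ≤ _ := this
    _ = _ := mul_comm _ _

/-- Fourth moment of a linear permutation statistic. -/
lemma expect_permLinear_pow_four_le [Nonempty ι] {b d : ι → ℝ} (hb : ∑ i, b i = 0)
    (hb1 : ∀ i, |b i| ≤ 1) (hd : ∀ i, |d i| ≤ 1) :
    𝔼 σ, permLinear b d σ ^ 4 ≤ 232 * (Fintype.card ι : ℝ) ^ 2 := by
  have hN : (1 : ℝ) ≤ Fintype.card ι := by exact_mod_cast Fintype.card_pos
  -- A transposition changes the cube by at most 36 x² + 88. The second moment bound 4N and N ≥ 1
  -- give 36 · 4N + 88 ≤ 232 N.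
  have := expect_mul_permLinear_le hb hb1 hd (fun σ => permLinear b d σ ^ 3)
    (K := 232 * Fintype.card ι) fun k j => ?_
  · calc _ = 𝔼 σ, permLinear b d σ ^ 3 * permLinear b d σ := by simp only [← pow_succ]
      _ ≤ _ := this
      _ = _ := by ring
  · calc _ ≤ 𝔼 σ, (36 * permLinear b d σ ^ 2 + 88) := expect_mono fun σ => ?_
      _ = 36 * (𝔼 σ, permLinear b d σ ^ 2) + 88 := by
        rw [Finset.expect_add_distrib, Fintype.expect_const, Finset.mul_expect]
      _ ≤ _ := by linarith [expect_permLinear_sq_le hb hb1 hd]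
    have h := abs_permLinear_swap_sub_le hb1 hd σ k j
    set x := permLinear b d σ
    obtain ⟨t, ht⟩ : ∃ t, permLinear b d (σ * Equiv.swap k j) = x + t :=
      ⟨_, (add_sub_cancel _ _).symm⟩
    rw [ht] at h ⊢
    rw [add_sub_cancel_left] at h
    have e : (x + t) ^ 3 - x ^ 3 = t * (3 * x ^ 2 + 3 * x * t + t ^ 2) := by ring
    have h16 : t ^ 2 ≤ 16 := by
      have := abs_le.1 h
      nlinarith
    have hp : 0 ≤ 3 * x ^ 2 + 3 * x * t + t ^ 2 := by nlinarith [sq_nonneg (x + t)]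
    rw [e, abs_mul, abs_of_nonneg hp]
    have : 3 * x ^ 2 + 3 * x * t + t ^ 2 ≤ 9 * x ^ 2 + 22 := by
      nlinarith [sq_nonneg (4 * x - t), sq_nonneg (x - t / 4)]
    calc _ ≤ 4 * (9 * x ^ 2 + 22) := mul_le_mul h this hp (by norm_num)
      _ = _ := by ring

/-- The quadratic form is a linear statistic whose coefficients are themselves linear statistics, so
`permLinear_swap` applies twice: once outside, and once in each coefficient. -/
lemma permQuadratic_swap {b : ι → ℝ} {e : ι → ι → ℝ} (he : ∀ i j, e i j = e j i)
    (σ : Equiv.Perm ι) (k j : ι) :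
    permQuadratic b e (σ * Equiv.swap k j) = permQuadratic b e σ
      + (b (σ j) - b (σ k)) * (2 * (permLinear b (e k) σ - permLinear b (e j) σ)
        + (b (σ j) - b (σ k)) * (e k k + e j j - 2 * e k j)) := by
  have h1 : permQuadratic b e (σ * Equiv.swap k j)
      = permLinear b (fun i => permLinear b (e i) (σ * Equiv.swap k j))
          (σ * Equiv.swap k j) := rfl
  have h2 : permLinear b (fun i => permLinear b (e i) (σ * Equiv.swap k j)) σ
      = permQuadratic b e σ
        + (b (σ j) - b (σ k)) * (permLinear b (e k) σ - permLinear b (e j) σ) := by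
    simp only [permLinear_swap, permQuadratic]
    rw [permLinear]
    simp only [mul_add, Finset.sum_add_distrib, mul_sub, add_right_inj]
    simp only [sub_mul, permLinear, Finset.mul_sum, Finset.sum_sub_distrib, mul_sub]
    simp only [← Finset.sum_sub_distrib]
    refine Finset.sum_congr rfl fun i _ => ?_
    rw [he i k, he i j]
    ring
  rw [h1, permLinear_swap, h2, permLinear_swap, permLinear_swap, he j k]
  ring

/-- Only two rows are involved, and a row is a linear statistic of size √N. A transposition thus
moves a quadratic form of size N by order √N only. -/
lemma abs_permQuadratic_swap_sub_le {b : ι → ℝ} {e : ι → ι → ℝ} (he : ∀ i j, e i j = e j i)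
    (hb1 : ∀ i, |b i| ≤ 1) (he1 : ∀ i j, |e i j| ≤ 1) (σ : Equiv.Perm ι) (k j : ι) :
    |permQuadratic b e (σ * Equiv.swap k j) - permQuadratic b e σ|
      ≤ 4 * (|permLinear b (e k) σ| + |permLinear b (e j) σ| + 4) := by
  rw [permQuadratic_swap he, add_sub_cancel_left, abs_mul]
  have h1 : |b (σ j) - b (σ k)| ≤ 2 :=
    (abs_sub _ _).trans (by linarith [hb1 (σ j), hb1 (σ k)])
  have h2 : |e k k + e j j - 2 * e k j| ≤ 4 := by
    have a := abs_le.1 (he1 k k)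
    have b := abs_le.1 (he1 j j)
    have c := abs_le.1 (he1 k j)
    rw [abs_le]
    constructor <;> linarith
  have h3 : |(b (σ j) - b (σ k)) * (e k k + e j j - 2 * e k j)| ≤ 8 := by
    rw [abs_mul]
    calc _ ≤ (2 : ℝ) * 4 := mul_le_mul h1 h2 (abs_nonneg _) (by norm_num)
      _ = 8 := by norm_num
  have h4 : |2 * (permLinear b (e k) σ - permLinear b (e j) σ)
        + (b (σ j) - b (σ k)) * (e k k + e j j - 2 * e k j)|
      ≤ 2 * (|permLinear b (e k) σ| + |permLinear b (e j) σ|) + 8 := by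
    refine (abs_add_le _ _).trans (add_le_add ?_ h3)
    rw [abs_mul, abs_two]
    linarith [abs_sub (permLinear b (e k) σ) (permLinear b (e j) σ)]
  calc _ ≤ 2 * (2 * (|permLinear b (e k) σ| + |permLinear b (e j) σ|) + 8) :=
        mul_le_mul h1 h4 (abs_nonneg _) (by norm_num)
    _ = _ := by ring

/-- Second moment of a quadratic permutation statistic. -/
lemma expect_permQuadratic_sq_le [Nonempty ι] {b : ι → ℝ} {e : ι → ι → ℝ}
    (he : ∀ i j, e i j = e j i) (hb : ∑ i, b i = 0) (hb1 : ∀ i, |b i| ≤ 1)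
    (he1 : ∀ i j, |e i j| ≤ 1) :
    𝔼 σ, permQuadratic b e σ ^ 2 ≤ 464 * (Fintype.card ι : ℝ) ^ 2 := by
  set N : ℝ := ((Fintype.card ι : ℕ) : ℝ) with hNdef
  have hN : (1 : ℝ) ≤ N := Nat.one_le_cast.2 Fintype.card_pos
  set V := 𝔼 σ, permQuadratic b e σ ^ 2 with hV
  -- The bound is allowed to contain the unknown moment V, with weight 1/(2N). Summing over the N
  -- indices returns V/2, which is absorbed on the left.
  have key : ∀ k, |𝔼 σ, (permQuadratic b e σ * permLinear b (e k) σ) * b (σ k)|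
      ≤ V / (2 * N) + 232 * N := by
    intro k
    refine abs_expect_mul_weight_le hb hb1 _ k fun j => ?_
    have hL := fun i => expect_permLinear_sq_le hb hb1 (he1 i)
    calc _ ≤ 𝔼 σ, (permQuadratic b e σ ^ 2 * (1 / (2 * N)) + 8 * N
            + (10 * permLinear b (e k) σ ^ 2 + 6 * permLinear b (e j) σ ^ 2 + 160)) :=
          expect_mono fun σ => ?_
      _ = V * (1 / (2 * N)) + 8 * N + (10 * (𝔼 σ, permLinear b (e k) σ ^ 2)
            + 6 * (𝔼 σ, permLinear b (e j) σ ^ 2) + 160) := by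
          simp only [Finset.expect_add_distrib, Fintype.expect_const, Finset.mul_expect,
            Finset.expect_mul, hV]
      _ ≤ V * (1 / (2 * N)) + 8 * N + (10 * (4 * N) + 6 * (4 * N) + 160) := by
          linarith [hL k, hL j]
      _ ≤ _ := by
          rw [mul_one_div]
          linarith
    have hq := abs_permQuadratic_swap_sub_le he hb1 he1 σ k j
    have hl := abs_permLinear_swap_sub_le hb1 (he1 k) σ k j
    set X := permQuadratic b e σ
    set X' := permQuadratic b e (σ * Equiv.swap k j)
    set u := permLinear b (e k) σ
    set u' := permLinear b (e k) (σ * Equiv.swap k j)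
    set v := permLinear b (e j) σ
    have e1 : X' * u' - X * u = X * (u' - u) + (X' - X) * u' := by ring
    have h1 : |u'| ≤ |u| + 4 := by
      have := abs_add_le (u' - u) u
      rw [sub_add_cancel] at this
      linarith
    have h2 : |X * (u' - u)| ≤ X ^ 2 * (1 / (2 * N)) + 8 * N := by
      rw [abs_mul]
      have h0 : |X| * |u' - u| ≤ |X| * 4 := mul_le_mul_of_nonneg_left hl (abs_nonneg _)
      have h3 : X ^ 2 * (1 / (2 * N)) + 8 * N - |X| * 4 = (|X| - 4 * N) ^ 2 / (2 * N) := by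
        rw [← sq_abs X]
        field_simp
        ring
      have : 0 ≤ (|X| - 4 * N) ^ 2 / (2 * N) := by positivity
      linarith
    have h4 : |(X' - X) * u'| ≤ 10 * u ^ 2 + 6 * v ^ 2 + 160 := by
      rw [abs_mul]
      calc _ ≤ 4 * (|u| + |v| + 4) * (|u| + 4) :=
            mul_le_mul hq h1 (abs_nonneg _) (by positivity)
        _ ≤ _ := by
            rw [← sq_abs u, ← sq_abs v]
            nlinarith [sq_nonneg (|u| - |v|), sq_nonneg (|u| - 4), sq_nonneg (|v| - 4),
              sq_nonneg |v|, sq_nonneg |u|]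
    rw [e1]
    exact (abs_add_le _ _).trans (add_le_add h2 h4)
  have hsum : V = ∑ k, 𝔼 σ, (permQuadratic b e σ * permLinear b (e k) σ) * b (σ k) := by
    rw [hV, ← Finset.expect_sum_comm]
    refine Finset.expect_congr rfl fun σ _ => ?_
    rw [sq]
    nth_rewrite 2 [permQuadratic]
    rw [Finset.mul_sum]
    exact Finset.sum_congr rfl fun k _ => by ring
  have hle : V ≤ N * (V / (2 * N) + 232 * N) := by
    nth_rewrite 1 [hsum]
    rw [hNdef, ← nsmul_eq_mul, ← Finset.card_univ]
    exact Finset.sum_le_card_nsmul _ _ _ fun k _ => (le_abs_self _).trans (key k)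
  have : N * (V / (2 * N) + 232 * N) = V / 2 + 232 * N ^ 2 := by
    field_simp
  linarith

end PermutationMoments

end CvM

namespace CvM

open scoped BigOperators
open Finset (univ)

/-! ### Stability of the permutation statistic when one observation changes. -/

section PermutationStatistic

variable {ι : Type*} [Fintype ι]

lemma permQuadratic_sub (b : ι → ℝ) (M M' : ι → ι → ℝ) (σ : Equiv.Perm ι) :
    permQuadratic b M' σ - permQuadratic b M σ
      = permQuadratic b (fun i j => M' i j - M i j) σ := by
  simp only [permQuadratic, permLinear, ← Finset.sum_sub_distrib, ← mul_sub]

lemma permLinear_sub (b r r' : ι → ℝ) (σ : Equiv.Perm ι) :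
    permLinear b r' σ - permLinear b r σ = permLinear b (fun i => r' i - r i) σ := by
  simp only [permLinear, ← Finset.sum_sub_distrib, ← mul_sub]

lemma abs_permLinear_le {b d : ι → ℝ} (hb1 : ∀ i, |b i| ≤ 1) (σ : Equiv.Perm ι) :
    |permLinear b d σ| ≤ ∑ i, |d i| := by
  refine (Finset.abs_sum_le_sum_abs _ _).trans (Finset.sum_le_sum fun i _ => ?_)
  rw [abs_mul]
  exact mul_le_of_le_one_left (abs_nonneg _) (hb1 _)

lemma abs_permQuadratic_le {b : ι → ℝ} {e : ι → ι → ℝ} (hb1 : ∀ i, |b i| ≤ 1)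
    (he1 : ∀ i j, |e i j| ≤ 1) (σ : Equiv.Perm ι) :
    |permQuadratic b e σ| ≤ (Fintype.card ι : ℝ) ^ 2 := by
  refine (Finset.abs_sum_le_sum_abs _ _).trans ?_
  rw [sq, ← nsmul_eq_mul, ← Finset.card_univ]
  refine Finset.sum_le_card_nsmul _ _ _ fun i _ => ?_
  rw [abs_mul]
  refine (mul_le_of_le_one_left (abs_nonneg _) (hb1 _)).trans
    ((abs_permLinear_le hb1 σ).trans ?_)
  refine (Finset.sum_le_card_nsmul _ _ 1 fun j _ => he1 i j).trans_eq ?_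
  simp

variable [DecidableEq ι]

/-- The permutation statistic with quadratic part `M` and linear part `r`. -/
noncomputable def permStat (κ l : ℝ) (b : ι → ℝ) (M : ι → ι → ℝ) (r : ι → ℝ) (σ : Equiv.Perm ι) : ℝ :=
  κ / Fintype.card ι * permQuadratic b M σ + l / Fintype.card ι * permLinear b r σ

/-- After division by N, the two rows touched by a transposition contribute order √N / N, so the
mean square is O(1/N). The constant is 48 · 33, from 4N + 4N + 25 ≤ 33N. -/
lemma expect_permStat_swap_sub_sq_le [Nonempty ι] {κ l c : ℝ} {b : ι → ℝ} {M : ι → ι → ℝ}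
    {r : ι → ℝ} (hκ : |κ| ≤ c) (hl : |l| ≤ c) (hb : ∑ i, b i = 0) (hb1 : ∀ i, |b i| ≤ 1)
    (hM : ∀ i j, M i j = M j i) (hM1 : ∀ i j, |M i j| ≤ 1) (hr : ∀ i, |r i| ≤ 1) (k j : ι) :
    𝔼 σ, (permStat κ l b M r (σ * Equiv.swap k j) - permStat κ l b M r σ) ^ 2
      ≤ 1584 * c ^ 2 / Fintype.card ι := by
  have hN : (1 : ℝ) ≤ Fintype.card ι := Nat.one_le_cast.2 Fintype.card_pos
  have hL := fun i => expect_permLinear_sq_le hb hb1 (hM1 i)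
  calc _ ≤ 𝔼 σ, (48 * c ^ 2 / (Fintype.card ι : ℝ) ^ 2 *
          (permLinear b (M k) σ ^ 2 + permLinear b (M j) σ ^ 2 + 25)) := expect_mono fun σ => ?_
    _ = 48 * c ^ 2 / (Fintype.card ι : ℝ) ^ 2 *
          ((𝔼 σ, permLinear b (M k) σ ^ 2) + (𝔼 σ, permLinear b (M j) σ ^ 2) + 25) := by
        rw [← Finset.mul_expect, Finset.expect_add_distrib, Finset.expect_add_distrib,
          Fintype.expect_const]
    _ ≤ 48 * c ^ 2 / (Fintype.card ι : ℝ) ^ 2 * (33 * Fintype.card ι) := by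
        refine mul_le_mul_of_nonneg_left ?_ (by positivity)
        linarith [hL k, hL j]
    _ = _ := by
        field_simp
        ring
  have hq := abs_permQuadratic_swap_sub_le hM hb1 hM1 σ k j
  have hl' := abs_permLinear_swap_sub_le hb1 hr σ k j
  set u := permLinear b (M k) σ
  set v := permLinear b (M j) σ
  have hc : 0 ≤ c := (abs_nonneg κ).trans hκ
  have h0 : |permStat κ l b M r (σ * Equiv.swap k j) - permStat κ l b M r σ|
      ≤ 4 * c / Fintype.card ι * (|u| + |v| + 5) := by
    have e : permStat κ l b M r (σ * Equiv.swap k j) - permStat κ l b M r σ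
        = κ / Fintype.card ι
            * (permQuadratic b M (σ * Equiv.swap k j) - permQuadratic b M σ)
          + l / Fintype.card ι
            * (permLinear b r (σ * Equiv.swap k j) - permLinear b r σ) := by
      simp only [permStat]
      ring
    rw [e]
    refine (abs_add_le _ _).trans ?_
    rw [abs_mul, abs_mul, abs_div, abs_div, Nat.abs_cast]
    calc _ ≤ c / Fintype.card ι * (4 * (|u| + |v| + 4)) + c / Fintype.card ι * 4 := by gcongr
      _ = _ := by ring
  have h1 : (|u| + |v| + 5) ^ 2 ≤ 3 * (u ^ 2 + v ^ 2 + 25) := by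
    rw [← sq_abs u, ← sq_abs v]
    nlinarith [sq_nonneg (|u| - |v|), sq_nonneg (|u| - 5), sq_nonneg (|v| - 5)]
  rw [← sq_abs]
  calc _ ≤ (4 * c / Fintype.card ι * (|u| + |v| + 5)) ^ 2 :=
        pow_le_pow_left₀ (abs_nonneg _) h0 2
    _ = (4 * c / Fintype.card ι) ^ 2 * (|u| + |v| + 5) ^ 2 := mul_pow _ _ _
    _ ≤ (4 * c / Fintype.card ι) ^ 2 * (3 * (u ^ 2 + v ^ 2 + 25)) := by gcongr
    _ = _ := by ring

/-- Separation of one row and column of a quadratic permutation statistic. -/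
lemma permQuadratic_eq_add_row (b : ι → ℝ) {D : ι → ι → ℝ} (hD : ∀ i j, D i j = D j i)
    (a : ι) (ha : D a a = 0) (σ : Equiv.Perm ι) :
    permQuadratic b D σ = 2 * (b (σ a) * permLinear b (D a) σ)
      + permQuadratic b (fun i j => if i = a ∨ j = a then 0 else D i j) σ := by
  have h1 : ∀ i j, b (σ i) * (b (σ j) * D i j)
      = (if i = a then b (σ i) * (b (σ j) * D i j) else 0)
        + (if j = a then b (σ i) * (b (σ j) * D i j) else 0)
        + b (σ i) * (b (σ j) * if i = a ∨ j = a then 0 else D i j) := by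
    intro i j
    by_cases hi : i = a <;> by_cases hj : j = a <;> simp [hi, hj, ha]
  simp only [permQuadratic, permLinear, Finset.mul_sum]
  rw [Finset.sum_congr rfl fun i _ => Finset.sum_congr rfl fun j _ => h1 i j]
  simp only [Finset.sum_add_distrib, Finset.sum_ite_eq', Finset.mem_univ, if_true]
  rw [Finset.sum_comm]
  simp only [Finset.sum_ite_eq', Finset.mem_univ, if_true]
  congr 1
  rw [← Finset.sum_add_distrib]
  exact Finset.sum_congr rfl fun i _ => by rw [hD i a]; ring

/-- The coefficients `M, r` and `M', r'` of two permutation statistics differ essentially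
only in one row and column. -/
structure RowPerturbation (M M' : ι → ι → ℝ) (r r' : ι → ℝ) (a : ι) : Prop where
  symm : ∀ i j, M i j = M j i
  symm' : ∀ i j, M' i j = M' j i
  diag : M a a = M' a a
  le_one : ∀ i j, |M' i j - M i j| ≤ 1
  le_inv : ∀ i j, i ≠ a → j ≠ a → |M' i j - M i j| ≤ 1 / Fintype.card ι
  sum_le : ∑ i, |r' i - r i| ≤ 3

namespace RowPerturbation

variable {M M' : ι → ι → ℝ} {r r' : ι → ℝ} {a : ι} {κ l c : ℝ} {b : ι → ℝ}

/-- The rescaled part of the perturbation off the distinguished row and column. -/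
noncomputable def rest (M M' : ι → ι → ℝ) (a : ι) (i j : ι) : ℝ :=
  Fintype.card ι * if i = a ∨ j = a then 0 else M' i j - M i j

lemma rest_symm (h : RowPerturbation M M' r r' a) (i j : ι) :
    rest M M' a i j = rest M M' a j i := by
  simp only [rest, h.symm i j, h.symm' i j, or_comm]

lemma abs_rest_le (h : RowPerturbation M M' r r' a) (i j : ι) : |rest M M' a i j| ≤ 1 := by
  have : Nonempty ι := ⟨a⟩
  have hN : (0 : ℝ) < Fintype.card ι := Nat.cast_pos.2 Fintype.card_pos
  unfold rest
  split_ifs with hij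
  · simp
  · push Not at hij
    rw [abs_mul, Nat.abs_cast, ← le_div_iff₀' hN]
    exact h.le_inv i j hij.1 hij.2

/-- The three terms have different sizes: the row `a` gives N^(-1/2), but carries the factor `b (σ
a)`; the remaining matrix is 1/N times a bounded matrix, hence gives 1/N; the linear part gives 1/N
deterministically. -/
lemma permStat_sub (h : RowPerturbation M M' r r' a) (σ : Equiv.Perm ι) :
    permStat κ l b M' r' σ - permStat κ l b M r σ
      = 2 * κ / Fintype.card ι * (permLinear b (fun i => M' a i - M a i) σ * b (σ a))
        + (κ / (Fintype.card ι : ℝ) ^ 2 * permQuadratic b (rest M M' a) σ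
        + l / Fintype.card ι * permLinear b (fun i => r' i - r i) σ) := by
  have : Nonempty ι := ⟨a⟩
  have hN : (0 : ℝ) < Fintype.card ι := Nat.cast_pos.2 Fintype.card_pos
  have h1 := permQuadratic_eq_add_row b (D := fun i j => M' i j - M i j)
    (fun i j => by rw [h.symm, h.symm']) a (by rw [h.diag, sub_self]) σ
  have h2 : permQuadratic b (rest M M' a) σ = Fintype.card ι *
      permQuadratic b (fun i j => if i = a ∨ j = a then 0 else M' i j - M i j) σ := by
    simp only [permQuadratic, permLinear, rest, Finset.mul_sum]
    exact Finset.sum_congr rfl fun i _ => Finset.sum_congr rfl fun j _ => by ring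
  have h3 : permStat κ l b M' r' σ - permStat κ l b M r σ
      = κ / Fintype.card ι * (permQuadratic b M' σ - permQuadratic b M σ)
        + l / Fintype.card ι * (permLinear b r' σ - permLinear b r σ) := by
    simp only [permStat]
    ring
  rw [h3, permQuadratic_sub, permLinear_sub, h1, h2]
  field_simp
  ring

/-- Fourth moment of the effect of a perturbation. -/
lemma expect_sub_pow_four_le (h : RowPerturbation M M' r r' a) (hκ : |κ| ≤ c) (hl : |l| ≤ c)
    (hb : ∑ i, b i = 0) (hb1 : ∀ i, |b i| ≤ 1) :
    𝔼 σ, (permStat κ l b M' r' σ - permStat κ l b M r σ) ^ 4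
      ≤ 120000 * c ^ 4 / (Fintype.card ι : ℝ) ^ 2 := by
  have : Nonempty ι := ⟨a⟩
  have hN : (1 : ℝ) ≤ Fintype.card ι := Nat.one_le_cast.2 Fintype.card_pos
  have hc : 0 ≤ c := (abs_nonneg κ).trans hκ
  set N : ℝ := (Fintype.card ι : ℝ) with hNdef
  have hL := expect_permLinear_pow_four_le hb hb1 (h.le_one a)
  have hX := expect_permQuadratic_sq_le h.rest_symm hb hb1 h.abs_rest_le
  calc _ ≤ 𝔼 σ, (27 * c ^ 4 / N ^ 4 * (16 * permLinear b (fun i => M' a i - M a i) σ ^ 4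
          + permQuadratic b (rest M M' a) σ ^ 2 + 81)) := expect_mono fun σ => ?_
    _ = 27 * c ^ 4 / N ^ 4 * (16 * (𝔼 σ, permLinear b (fun i => M' a i - M a i) σ ^ 4)
          + (𝔼 σ, permQuadratic b (rest M M' a) σ ^ 2) + 81) := by
        simp only [← Finset.mul_expect, Finset.expect_add_distrib, Fintype.expect_const]
    _ ≤ 27 * c ^ 4 / N ^ 4 * (4400 * N ^ 2) := by
        refine mul_le_mul_of_nonneg_left ?_ (by positivity)
        nlinarith
    _ = 118800 * c ^ 4 / N ^ 2 := by
        field_simp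
        ring
    _ ≤ _ := by gcongr; norm_num
  rw [h.permStat_sub, ← hNdef]
  have hXb := abs_permQuadratic_le hb1 h.abs_rest_le σ
  have hrb := (abs_permLinear_le (d := fun i => r' i - r i) hb1 σ).trans h.sum_le
  have hB := hb1 (σ a)
  set L := permLinear b (fun i => M' a i - M a i) σ
  set X := permQuadratic b (rest M M' a) σ
  set R := permLinear b (fun i => r' i - r i) σ
  set B := b (σ a)
  rw [← hNdef] at hXb
  have p4 : ∀ x y : ℝ, |x| ≤ y → x ^ 4 ≤ y ^ 4 := fun x y hxy => by
    rw [← Even.pow_abs (by decide : Even 4) x]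
    exact pow_le_pow_left₀ (abs_nonneg _) hxy 4
  have hN0 : 0 < N := by linarith
  have c4 := p4 κ c hκ
  have h1 : (2 * κ / N * (L * B)) ^ 4 ≤ c ^ 4 / N ^ 4 * (16 * L ^ 4) := by
    have e : (2 * κ / N * (L * B)) ^ 4 = κ ^ 4 * (B ^ 4 * (16 * L ^ 4 / N ^ 4)) := by
      field_simp
      ring
    have b4 : B ^ 4 ≤ 1 := by simpa using p4 B 1 hB
    rw [e]
    calc _ ≤ c ^ 4 * (1 * (16 * L ^ 4 / N ^ 4)) := by gcongr
      _ = _ := by ring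
  -- The crude bound |X| ≤ N² on two of the four factors suffices here, so no fourth moment of a
  -- quadratic form is needed.
  have h2 : (κ / N ^ 2 * X) ^ 4 ≤ c ^ 4 / N ^ 4 * X ^ 2 := by
    have e : (κ / N ^ 2 * X) ^ 4 = κ ^ 4 * (X ^ 2 / N ^ 8 * X ^ 2) := by
      field_simp
    have : X ^ 2 ≤ N ^ 4 := by
      rw [← sq_abs]
      calc _ ≤ (N ^ 2) ^ 2 := pow_le_pow_left₀ (abs_nonneg _) hXb 2
        _ = _ := by ring
    rw [e]
    calc _ ≤ c ^ 4 * (N ^ 4 / N ^ 8 * X ^ 2) := by gcongr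
      _ = _ := by field_simp
  have h3 : (l / N * R) ^ 4 ≤ c ^ 4 / N ^ 4 * 81 := by
    have e : (l / N * R) ^ 4 = l ^ 4 * (R ^ 4 / N ^ 4) := by
      field_simp
    have := p4 R 3 hrb
    have l4 := p4 l c hl
    rw [e]
    calc _ ≤ c ^ 4 * (3 ^ 4 / N ^ 4) := by gcongr
      _ = _ := by ring
  have p3 : ∀ x y z : ℝ, (x + (y + z)) ^ 4 ≤ 27 * (x ^ 4 + y ^ 4 + z ^ 4) := by
    intro x y z
    have s1 : (x + (y + z)) ^ 2 ≤ 3 * (x ^ 2 + y ^ 2 + z ^ 2) := by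
      nlinarith [sq_nonneg (x - y), sq_nonneg (y - z), sq_nonneg (x - z)]
    have s2 : (x ^ 2 + y ^ 2 + z ^ 2) ^ 2 ≤ 3 * (x ^ 4 + y ^ 4 + z ^ 4) := by
      nlinarith [sq_nonneg (x ^ 2 - y ^ 2), sq_nonneg (y ^ 2 - z ^ 2),
        sq_nonneg (x ^ 2 - z ^ 2)]
    calc _ = ((x + (y + z)) ^ 2) ^ 2 := by ring
      _ ≤ (3 * (x ^ 2 + y ^ 2 + z ^ 2)) ^ 2 := pow_le_pow_left₀ (sq_nonneg _) s1 2
      _ = 9 * (x ^ 2 + y ^ 2 + z ^ 2) ^ 2 := by ring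
      _ ≤ _ := by linarith
  refine (p3 _ _ _).trans ?_
  calc _ ≤ 27 * (c ^ 4 / N ^ 4 * (16 * L ^ 4) + c ^ 4 / N ^ 4 * X ^ 2 + c ^ 4 / N ^ 4 * 81) := by
        gcongr
    _ = _ := by ring

lemma expect_sub_sq_le (h : RowPerturbation M M' r r' a) (hκ : |κ| ≤ c) (hl : |l| ≤ c)
    (hb : ∑ i, b i = 0) (hb1 : ∀ i, |b i| ≤ 1) :
    𝔼 σ, (permStat κ l b M' r' σ - permStat κ l b M r σ) ^ 2
      ≤ (60000 * c ^ 4 + 1) / Fintype.card ι := by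
  have : Nonempty ι := ⟨a⟩
  have hN : (0 : ℝ) < Fintype.card ι := Nat.cast_pos.2 Fintype.card_pos
  set N : ℝ := (Fintype.card ι : ℝ) with hNdef
  -- Weighted so that both terms have order 1/N when x² has order 1/N; it avoids taking a root of
  -- the fourth moment.
  calc _ ≤ 𝔼 σ, (N / 2 * (permStat κ l b M' r' σ - permStat κ l b M r σ) ^ 4 + 1 / N) :=
        expect_mono fun σ => ?_
    _ = N / 2 * (𝔼 σ, (permStat κ l b M' r' σ - permStat κ l b M r σ) ^ 4) + 1 / N := by
        simp only [← Finset.mul_expect, Finset.expect_add_distrib, Fintype.expect_const]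
    _ ≤ N / 2 * (120000 * c ^ 4 / N ^ 2) + 1 / N := by
        gcongr
        exact h.expect_sub_pow_four_le hκ hl hb hb1
    _ = _ := by
        field_simp
        ring
  generalize permStat κ l b M' r' σ - permStat κ l b M r σ = x
  have e : N / 2 * x ^ 4 + 1 / N - x ^ 2 = ((N * x ^ 2 - 1) ^ 2 + 1) / (2 * N) := by
    field_simp
    ring
  have : 0 ≤ ((N * x ^ 2 - 1) ^ 2 + 1) / (2 * N) := by positivity
  linarith

/-- A smooth function of the permutation statistic has an expectation that changes by
`O(1 / N)` under a perturbation: the first order effect cancels. -/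
lemma abs_expect_comp_sub_le (h : RowPerturbation M M' r r' a) (hκ : |κ| ≤ c) (hl : |l| ≤ c)
    (hb : ∑ i, b i = 0) (hb1 : ∀ i, |b i| ≤ 1) (hM1 : ∀ i j, |M i j| ≤ 1)
    (hr : ∀ i, |r i| ≤ 1) {f f' : ℝ → ℝ} {K : ℝ} (hf' : ∀ x, |f' x| ≤ K)
    (hf'l : ∀ x y, |f' y - f' x| ≤ K * |y - x|)
    (hf : ∀ x y, |f y - f x - f' x * (y - x)| ≤ K * (y - x) ^ 2) :
    |(𝔼 σ, f (permStat κ l b M' r' σ)) - 𝔼 σ, f (permStat κ l b M r σ)|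
      ≤ K * (60000 * c ^ 4 + 1584 * c ^ 3 + 248 * c + 1) / Fintype.card ι := by
  have : Nonempty ι := ⟨a⟩
  have hN : (1 : ℝ) ≤ Fintype.card ι := Nat.one_le_cast.2 Fintype.card_pos
  have hc : 0 ≤ c := (abs_nonneg κ).trans hκ
  have hK : 0 ≤ K := (abs_nonneg _).trans (hf' 0)
  set N : ℝ := (Fintype.card ι : ℝ) with hNdef
  have hN0 : 0 < N := by linarith
  set S := permStat κ l b M r
  set S' := permStat κ l b M' r'
  set L := permLinear b (fun i => M' a i - M a i)
  set X := permQuadratic b (rest M M' a)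
  set R := permLinear b (fun i => r' i - r i)
  -- The cancellation of the first order effect. Although L has size √N, this expectation is O(1): a
  -- transposition changes L by at most 4 and `f' (S σ)` by order N^(-1/2), so the product `f' (S σ)
  -- * L σ` is stable under transpositions.
  have h1 : |𝔼 σ, (f' (S σ) * L σ) * b (σ a)| ≤ K * (6 + 792 * c ^ 2) := by
    refine abs_expect_mul_weight_le hb hb1 _ a fun j => ?_
    have hS := expect_permStat_swap_sub_sq_le hκ hl hb hb1 h.symm hM1 hr a j
    have hL := expect_permLinear_sq_le hb hb1 (h.le_one a)
    calc _ ≤ 𝔼 σ, (4 * K + K * (N / 2 * (S (σ * Equiv.swap a j) - S σ) ^ 2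
            + 1 / (2 * N) * L σ ^ 2)) := expect_mono fun σ => ?_
      _ = 4 * K + K * (N / 2 * (𝔼 σ, (S (σ * Equiv.swap a j) - S σ) ^ 2)
            + 1 / (2 * N) * 𝔼 σ, L σ ^ 2) := by
          simp only [← Finset.mul_expect, Finset.expect_add_distrib, Fintype.expect_const]
      _ ≤ 4 * K + K * (N / 2 * (1584 * c ^ 2 / N) + 1 / (2 * N) * (4 * N)) := by gcongr
      _ = _ := by
          field_simp
          ring
    have e : f' (S (σ * Equiv.swap a j)) * L (σ * Equiv.swap a j) - f' (S σ) * L σ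
        = f' (S (σ * Equiv.swap a j)) * (L (σ * Equiv.swap a j) - L σ)
          + (f' (S (σ * Equiv.swap a j)) - f' (S σ)) * L σ := by ring
    rw [e]
    refine (abs_add_le _ _).trans (add_le_add ?_ ?_)
    · rw [abs_mul, mul_comm]
      exact mul_le_mul (abs_permLinear_swap_sub_le hb1 (h.le_one a) σ a j) (hf' _)
        (abs_nonneg _) (by norm_num)
    · rw [abs_mul]
      calc _ ≤ K * |S (σ * Equiv.swap a j) - S σ| * |L σ| :=
            mul_le_mul_of_nonneg_right (hf'l _ _) (abs_nonneg _)
        _ = K * (|S (σ * Equiv.swap a j) - S σ| * |L σ|) := mul_assoc _ _ _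
        _ ≤ _ := by
            gcongr
            rw [← sq_abs (S _ - _), ← sq_abs (L σ)]
            generalize |S (σ * Equiv.swap a j) - S σ| = x
            generalize |L σ| = y
            have e : N / 2 * x ^ 2 + 1 / (2 * N) * y ^ 2 - x * y
                = (N * x - y) ^ 2 / (2 * N) := by
              field_simp
              ring
            have : 0 ≤ (N * x - y) ^ 2 / (2 * N) := by positivity
            linarith
  have h2 : |𝔼 σ, f' (S σ) * (κ / N ^ 2 * X σ + l / N * R σ)| ≤ K * (236 * c / N) := by
    have hX := expect_permQuadratic_sq_le h.rest_symm hb hb1 h.abs_rest_le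
    refine (Finset.abs_expect_le _ _).trans ?_
    calc _ ≤ 𝔼 σ, K * (c / N ^ 2 * (1 / (2 * N) * X σ ^ 2 + N / 2) + 3 * c / N) :=
          expect_mono fun σ => ?_
      _ = K * (c / N ^ 2 * (1 / (2 * N) * (𝔼 σ, X σ ^ 2) + N / 2) + 3 * c / N) := by
          simp only [← Finset.mul_expect, Finset.expect_add_distrib, Fintype.expect_const]
      _ ≤ K * (c / N ^ 2 * (1 / (2 * N) * (464 * N ^ 2) + N / 2) + 3 * c / N) := by gcongr
      _ = K * (235.5 * c / N) := by
          field_simp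
          ring
      _ ≤ _ := by gcongr; norm_num
    rw [abs_mul]
    refine mul_le_mul (hf' _) ?_ (abs_nonneg _) hK
    refine (abs_add_le _ _).trans (add_le_add ?_ ?_)
    · rw [abs_mul, abs_div, abs_of_pos (by positivity : 0 < N ^ 2)]
      refine mul_le_mul (by gcongr) ?_ (abs_nonneg _) (by positivity)
      rw [← sq_abs (X σ)]
      generalize |X σ| = x
      have e : 1 / (2 * N) * x ^ 2 + N / 2 - x = (x - N) ^ 2 / (2 * N) := by
        field_simp
        ring
      have : 0 ≤ (x - N) ^ 2 / (2 * N) := by positivity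
      linarith
    · have hrb := (abs_permLinear_le (d := fun i => r' i - r i) hb1 σ).trans h.sum_le
      rw [abs_mul, abs_div, abs_of_pos hN0]
      calc _ ≤ c / N * 3 := by gcongr
        _ = _ := by ring
  have h3 := h.expect_sub_sq_le hκ hl hb hb1
  -- Taylor remainder, centred first order term, and first order term that is already of order 1/N.
  have h4 : (𝔼 σ, f (S' σ)) - 𝔼 σ, f (S σ)
      = (𝔼 σ, (f (S' σ) - f (S σ) - f' (S σ) * (S' σ - S σ)))
        + (2 * κ / N * (𝔼 σ, (f' (S σ) * L σ) * b (σ a))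
          + 𝔼 σ, f' (S σ) * (κ / N ^ 2 * X σ + l / N * R σ)) := by
    rw [Finset.mul_expect, ← Finset.expect_add_distrib, ← Finset.expect_add_distrib,
      ← Finset.expect_sub_distrib]
    refine Finset.expect_congr rfl fun σ _ => ?_
    rw [h.permStat_sub (κ := κ) (l := l) (b := b) σ]
    ring
  have h5 : |𝔼 σ, (f (S' σ) - f (S σ) - f' (S σ) * (S' σ - S σ))|
      ≤ K * ((60000 * c ^ 4 + 1) / N) := by
    refine (Finset.abs_expect_le _ _).trans ((expect_mono fun σ => hf _ _).trans ?_)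
    rw [← Finset.mul_expect]
    exact mul_le_mul_of_nonneg_left h3 hK
  have h6 : |2 * κ / N * (𝔼 σ, (f' (S σ) * L σ) * b (σ a))|
      ≤ 2 * c / N * (K * (6 + 792 * c ^ 2)) := by
    rw [abs_mul, abs_div, abs_mul, abs_two, abs_of_pos hN0]
    gcongr
  rw [h4]
  refine (abs_add_le _ _).trans ((add_le_add h5 ((abs_add_le _ _).trans
    (add_le_add h6 h2))).trans_eq ?_)
  field_simp
  ring

end RowPerturbation

end PermutationStatistic

end CvM

namespace CvM

open scoped BigOperators
open Finset (univ)

/-! ### The angle kernel and the matrix it defines on a pooled sample. -/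

section AngleKernel

variable {d : ℕ}

/-- One half minus the normalized angle at `w` of the triangle `u, v, w`. -/
noncomputable def angleKernel (u v w : EuclideanSpace ℝ (Fin d)) : ℝ :=
  1 / 2 - InnerProductGeometry.angle (u - w) (v - w) / (2 * Real.pi)

lemma kernel_eq_angleKernel (x₁ x₂ y₁ y₂ : EuclideanSpace ℝ (Fin d)) :
    kernel x₁ x₂ y₁ y₂ = angleKernel x₁ x₂ y₁ + angleKernel y₁ y₂ x₁ - 2 / 3 := by
  unfold kernel angleKernel
  ring

lemma angleKernel_comm (u v w : EuclideanSpace ℝ (Fin d)) :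
    angleKernel u v w = angleKernel v u w := by
  unfold angleKernel
  rw [InnerProductGeometry.angle_comm]

lemma angleKernel_nonneg (u v w : EuclideanSpace ℝ (Fin d)) : 0 ≤ angleKernel u v w := by
  unfold angleKernel
  have := InnerProductGeometry.angle_le_pi (u - w) (v - w)
  rw [sub_nonneg, div_le_div_iff₀ Real.two_pi_pos two_pos]
  linarith

lemma angleKernel_le_half (u v w : EuclideanSpace ℝ (Fin d)) : angleKernel u v w ≤ 1 / 2 := by
  unfold angleKernel
  have : 0 ≤ InnerProductGeometry.angle (u - w) (v - w) / (2 * Real.pi) :=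
    div_nonneg (InnerProductGeometry.angle_nonneg _ _) Real.two_pi_pos.le
  linarith

/-- The angles of a triangle sum to `π`. -/
lemma angleKernel_add_add {u v w : EuclideanSpace ℝ (Fin d)} (huv : u ≠ v) :
    angleKernel u v w + angleKernel u w v + angleKernel v w u = 1 := by
  have h := EuclideanGeometry.angle_add_angle_add_angle_eq_pi w huv.symm
  simp only [EuclideanGeometry.angle, vsub_eq_sub] at h
  unfold angleKernel
  rw [InnerProductGeometry.angle_comm (v - w), InnerProductGeometry.angle_comm (w - u)] at h
  field_simp
  linarith

lemma measurable_angleKernel : Measurable fun p : EuclideanSpace ℝ (Fin d) ×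
    EuclideanSpace ℝ (Fin d) × EuclideanSpace ℝ (Fin d) => angleKernel p.1 p.2.1 p.2.2 := by
  unfold angleKernel InnerProductGeometry.angle
  fun_prop

lemma sum_div_card_mem {ι : Type*} [Fintype ι] {f : ι → ℝ} (hf : ∀ i, f i ∈ Set.Icc (0 : ℝ) 1) :
    (∑ i, f i) / Fintype.card ι ∈ Set.Icc (0 : ℝ) 1 := by
  refine ⟨div_nonneg (Finset.sum_nonneg fun i _ => (hf i).1) (Nat.cast_nonneg _),
    div_le_one_of_le₀ ?_ (Nat.cast_nonneg _)⟩
  refine (Finset.sum_le_card_nsmul _ _ 1 fun i _ => (hf i).2).trans_eq ?_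
  simp

variable {ι : Type*} [DecidableEq ι]

/-- The values of `angleKernel` at triples of distinct indices. -/
noncomputable def angleTriple (z : ι → EuclideanSpace ℝ (Fin d)) (i j k : ι) : ℝ :=
  if i ≠ j ∧ j ≠ k ∧ i ≠ k then angleKernel (z i) (z j) (z k) else 0

lemma angleTriple_comm (z : ι → EuclideanSpace ℝ (Fin d)) (i j k : ι) :
    angleTriple z i j k = angleTriple z j i k := by
  unfold angleTriple
  rw [angleKernel_comm]
  exact if_congr (by tauto) rfl rfl

lemma angleTriple_mem (z : ι → EuclideanSpace ℝ (Fin d)) (i j k : ι) :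
    angleTriple z i j k ∈ Set.Icc (0 : ℝ) 1 := by
  unfold angleTriple
  split_ifs
  · exact ⟨angleKernel_nonneg _ _ _, (angleKernel_le_half _ _ _).trans (by norm_num)⟩
  · simp

/-- The only place where distinctness of the observations is used to rewrite the statistic. -/
lemma angleTriple_add_add {z : ι → EuclideanSpace ℝ (Fin d)} (hz : Function.Injective z)
    (i j k : ι) : angleTriple z i j k + angleTriple z i k j + angleTriple z j k i
      = if i ≠ j ∧ j ≠ k ∧ i ≠ k then 1 else 0 := by
  unfold angleTriple
  by_cases h : i ≠ j ∧ j ≠ k ∧ i ≠ k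
  · obtain ⟨h1, h2, h3⟩ := h
    simp only [h1, h2, h3, h1.symm, h2.symm, h3.symm, ne_eq, not_false_eq_true, and_self,
      if_true]
    exact angleKernel_add_add (hz.ne h1)
  · rw [if_neg h, if_neg h, if_neg (by tauto), if_neg (by tauto)]
    simp

variable [Fintype ι]

/-- The average of `angleTriple` over the vertex of the angle. -/
noncomputable def angleMatrix (z : ι → EuclideanSpace ℝ (Fin d)) (i j : ι) : ℝ :=
  (∑ k, angleTriple z i j k) / Fintype.card ι

/-- The row averages of `angleMatrix`. -/
noncomputable def angleRow (z : ι → EuclideanSpace ℝ (Fin d)) (i : ι) : ℝ :=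
  (∑ j, angleMatrix z i j) / Fintype.card ι

lemma angleMatrix_mem (z : ι → EuclideanSpace ℝ (Fin d)) (i j : ι) :
    angleMatrix z i j ∈ Set.Icc (0 : ℝ) 1 :=
  sum_div_card_mem fun k => angleTriple_mem z i j k

lemma angleRow_mem (z : ι → EuclideanSpace ℝ (Fin d)) (i : ι) :
    angleRow z i ∈ Set.Icc (0 : ℝ) 1 :=
  sum_div_card_mem fun j => angleMatrix_mem z i j

lemma angleMatrix_comm (z : ι → EuclideanSpace ℝ (Fin d)) (i j : ι) :
    angleMatrix z i j = angleMatrix z j i := by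
  unfold angleMatrix
  simp only [angleTriple_comm z i j]

lemma angleMatrix_self (z : ι → EuclideanSpace ℝ (Fin d)) (i : ι) :
    angleMatrix z i i = 0 := by
  simp [angleMatrix, angleTriple]

/-- The vertex is averaged over the whole pooled sample, not over one group. This makes the matrix
equivariant, so that a permutation can be transferred from the data to the weights. -/
lemma angleMatrix_comp (z : ι → EuclideanSpace ℝ (Fin d)) (σ : Equiv.Perm ι) (i j : ι) :
    angleMatrix (z ∘ σ) i j = angleMatrix z (σ i) (σ j) := by
  unfold angleMatrix
  rw [← Equiv.sum_comp σ (fun k => angleTriple z (σ i) (σ j) k)]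
  simp [angleTriple]

lemma angleRow_comp (z : ι → EuclideanSpace ℝ (Fin d)) (σ : Equiv.Perm ι) (i : ι) :
    angleRow (z ∘ σ) i = angleRow z (σ i) := by
  unfold angleRow
  simp only [angleMatrix_comp]
  rw [Equiv.sum_comp σ (fun k => angleMatrix z (σ i) k)]

lemma abs_sub_le_one_of_mem {x y : ℝ} (hx : x ∈ Set.Icc (0 : ℝ) 1)
    (hy : y ∈ Set.Icc (0 : ℝ) 1) : |x - y| ≤ 1 := by
  rw [abs_le]
  constructor <;> linarith [hx.1, hx.2, hy.1, hy.2]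

lemma abs_le_one_of_mem {x : ℝ} (hx : x ∈ Set.Icc (0 : ℝ) 1) : |x| ≤ 1 :=
  abs_le.2 ⟨by linarith [hx.1], hx.2⟩

/-- Changing one observation perturbs essentially one row and column. -/
lemma rowPerturbation_angle (z z' : ι → EuclideanSpace ℝ (Fin d)) (a : ι)
    (hz : ∀ i, i ≠ a → z' i = z i) :
    RowPerturbation (angleMatrix z) (angleMatrix z') (angleRow z) (angleRow z') a := by
  have : Nonempty ι := ⟨a⟩
  have hN : (0 : ℝ) < Fintype.card ι := Nat.cast_pos.2 Fintype.card_pos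
  have hinv : ∀ i j, i ≠ a → j ≠ a →
      |angleMatrix z' i j - angleMatrix z i j| ≤ 1 / Fintype.card ι := by
    intro i j hi hj
    unfold angleMatrix
    rw [← sub_div, ← Finset.sum_sub_distrib, abs_div, Nat.abs_cast]
    gcongr
    -- Off the row and column of `a`, only the summand whose vertex is `a` can change.
    rw [Finset.sum_eq_single a]
    · exact abs_sub_le_one_of_mem (angleTriple_mem _ _ _ _) (angleTriple_mem _ _ _ _)
    · intro k _ hk
      simp [angleTriple, hz i hi, hz j hj, hz k hk]
    · simp
  have hone : ∀ i j, |angleMatrix z' i j - angleMatrix z i j| ≤ 1 := fun i j =>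
    abs_sub_le_one_of_mem (angleMatrix_mem _ _ _) (angleMatrix_mem _ _ _)
  refine ⟨angleMatrix_comm z, angleMatrix_comm z', by simp only [angleMatrix_self], hone, hinv,
    ?_⟩
  -- After the double sum and the division by N, each of these three terms contributes 1, whence the
  -- constant 3 in `sum_le`.
  have h1 : ∀ i j, |angleMatrix z' i j - angleMatrix z i j|
      ≤ 1 / Fintype.card ι + (if i = a then 1 else 0) + (if j = a then 1 else 0) := by
    intro i j
    have : (0 : ℝ) ≤ 1 / Fintype.card ι := by positivity
    by_cases hi : i = a <;> by_cases hj : j = a <;> simp only [hi, hj, if_true, if_false]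
    · linarith [hone a a]
    · linarith [hone a j]
    · linarith [hone i a]
    · linarith [hinv i j hi hj]
  calc _ ≤ ∑ i, (∑ j, (1 / Fintype.card ι + (if i = a then 1 else 0)
          + (if j = a then (1 : ℝ) else 0))) / Fintype.card ι := by
        refine Finset.sum_le_sum fun i _ => ?_
        unfold angleRow
        rw [← sub_div, ← Finset.sum_sub_distrib, abs_div, Nat.abs_cast]
        gcongr
        exact (Finset.abs_sum_le_sum_abs _ _).trans (Finset.sum_le_sum fun j _ => h1 i j)
    _ = 3 := by
        rw [← Finset.sum_div]
        simp only [Finset.sum_add_distrib, Finset.sum_const, Finset.sum_ite_eq', Finset.mem_univ,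
          if_true, Finset.card_univ, nsmul_eq_mul, ← Finset.mul_sum]
        field_simp
        norm_num
    _ ≤ 3 := le_rfl

end AngleKernel

end CvM

namespace CvM

open scoped BigOperators
open Finset (univ)

/-! ### The Cramér-von Mises statistic as a polynomial in the group weights. -/

section StatisticIdentity

variable {d m n : ℕ}

/-- The centred group indicators of two samples of sizes `m` and `n`. -/
noncomputable def groupWeight (m n : ℕ) : Fin (m + n) → ℝ :=
  Fin.append (fun _ => (n : ℝ) / (m + n)) (fun _ => -((m : ℝ) / (m + n)))

lemma sum_groupWeight : ∑ i, groupWeight m n i = 0 := by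
  simp only [groupWeight, Fin.sum_univ_add, Fin.append_left, Fin.append_right, Finset.sum_const,
    Finset.card_univ, Fintype.card_fin, nsmul_eq_mul]
  ring

lemma abs_groupWeight_le (i : Fin (m + n)) : |groupWeight m n i| ≤ 1 := by
  have hm : (0 : ℝ) ≤ m := Nat.cast_nonneg _
  have hn : (0 : ℝ) ≤ n := Nat.cast_nonneg _
  refine Fin.addCases (fun i => ?_) (fun j => ?_) i
  · rw [groupWeight, Fin.append_left, abs_of_nonneg (by positivity)]
    exact div_le_one_of_le₀ (by linarith) (by linarith)
  · rw [groupWeight, Fin.append_right, abs_neg, abs_of_nonneg (by positivity)]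
    exact div_le_one_of_le₀ (by linarith) (by linarith)

/-- The coefficient of the quadratic part of the statistic. -/
noncomputable def quadCoef (m n : ℕ) : ℝ :=
  (m + n : ℝ) ^ 3 * (1 / (m * (m - 1) * n) + 1 / (n * (n - 1) * m))

/-- The coefficient of the linear part of the statistic. -/
noncomputable def linCoef (m n : ℕ) : ℝ :=
  2 * (m + n : ℝ) ^ 3 * (1 / ((m - 1) * n) - 1 / ((n - 1) * m))

/-- The deterministic part of the statistic. -/
noncomputable def constCoef (m n : ℕ) : ℝ :=
  (m + n : ℝ) * (((m : ℝ) / ((m - 1) * n) + n / ((n - 1) * m)) / (m + n)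
      * ((m + n - 1) * (m + n - 2) / 3)
    - (m - 2) / (3 * n) - (n - 2) / (3 * m) - 2 / 3)

/-- The statistic written as a quadratic polynomial in the group indicators. -/
noncomputable def polyStat (m n : ℕ) (z : Fin (m + n) → EuclideanSpace ℝ (Fin d)) : ℝ :=
  constCoef m n
    + permStat (quadCoef m n) (linCoef m n) (groupWeight m n) (angleMatrix z) (angleRow z) 1

lemma permQuadratic_inv {ι : Type*} [Fintype ι] (b : ι → ℝ) (M : ι → ι → ℝ)
    (σ : Equiv.Perm ι) :
    permQuadratic b (fun i j => M (σ i) (σ j)) 1 = permQuadratic b M σ⁻¹ := by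
  simp only [permQuadratic, permLinear]
  rw [← Equiv.sum_comp σ (fun j => b (σ⁻¹ j) * ∑ k, b (σ⁻¹ k) * M j k)]
  refine Finset.sum_congr rfl fun i _ => ?_
  rw [← Equiv.sum_comp σ (fun k => b (σ⁻¹ k) * M (σ i) k)]
  simp

lemma permLinear_inv {ι : Type*} [Fintype ι] (b r : ι → ℝ) (σ : Equiv.Perm ι) :
    permLinear b (fun i => r (σ i)) 1 = permLinear b r σ⁻¹ := by
  simp only [permLinear]
  rw [← Equiv.sum_comp σ (fun j => b (σ⁻¹ j) * r j)]
  simp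

/-- Valid for every `z`, with or without ties, unlike the identity with the original statistic. The
inverse is harmless, because only averages over the whole group are taken. -/
lemma polyStat_comp (z : Fin (m + n) → EuclideanSpace ℝ (Fin d)) (σ : Equiv.Perm (Fin (m + n))) :
    polyStat m n (z ∘ σ) = constCoef m n + permStat (quadCoef m n) (linCoef m n)
      (groupWeight m n) (angleMatrix z) (angleRow z) σ⁻¹ := by
  have h1 : angleMatrix (z ∘ σ) = fun i j => angleMatrix z (σ i) (σ j) :=
    funext fun i => funext fun j => angleMatrix_comp z σ i j
  have h2 : angleRow (z ∘ σ) = fun i => angleRow z (σ i) :=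
    funext fun i => angleRow_comp z σ i
  unfold polyStat permStat
  rw [h1, h2, permQuadratic_inv, permLinear_inv]

lemma sum_offDiag_eq {ι : Type*} [Fintype ι] [DecidableEq ι] (f : ι × ι → ℝ) :
    ∑ i ∈ (univ : Finset ι).offDiag, f i = ∑ i, ∑ j, if i = j then 0 else f (i, j) := by
  have h : (univ : Finset ι).offDiag = univ.filter fun i : ι × ι => i.1 ≠ i.2 := by
    ext i
    simp [Finset.mem_offDiag]
  rw [h, Finset.sum_filter, Fintype.sum_prod_type]
  refine Finset.sum_congr rfl fun i _ => Finset.sum_congr rfl fun j _ => ?_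
  by_cases h : i = j <;> simp [h]

lemma sum_distinct {ι : Type*} [Fintype ι] [DecidableEq ι] :
    ∑ i : ι, ∑ j : ι, ∑ k : ι, (if i ≠ j ∧ j ≠ k ∧ i ≠ k then (1 : ℝ) else 0)
      = Fintype.card ι * (Fintype.card ι - 1) * (Fintype.card ι - 2) := by
  have h : ∀ i j k : ι, (if i ≠ j ∧ j ≠ k ∧ i ≠ k then (1 : ℝ) else 0)
      = 1 - (if i = j then 1 else 0) - (if j = k then 1 else 0) - (if i = k then 1 else 0)
        + 2 * (if i = j then (if j = k then 1 else 0) else 0) := by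
    intro i j k
    by_cases h1 : i = j <;> by_cases h2 : j = k <;> by_cases h3 : i = k <;>
      (simp_all; try norm_num)
  simp only [h, Finset.sum_add_distrib, Finset.sum_sub_distrib, Finset.sum_const,
    Finset.card_univ, ← Finset.mul_sum, Finset.sum_ite_eq, Finset.mem_univ, if_true,
    nsmul_eq_mul, mul_one, Finset.sum_ite_irrel, mul_zero]
  ring

variable {z : Fin (m + n) → EuclideanSpace ℝ (Fin d)}

/-- Symmetrizing over the position of the vertex makes each triple of distinct indices count 1, so
the sum within a group carries no randomness. -/
lemma sum_angleTriple_within {ι κ : Type*} [Fintype ι] [DecidableEq ι] [Fintype κ]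
    [DecidableEq κ] {z : ι → EuclideanSpace ℝ (Fin d)} (hz : Function.Injective z)
    {g : κ → ι} (hg : Function.Injective g) :
    ∑ i, ∑ j, ∑ k, angleTriple z (g i) (g j) (g k)
      = Fintype.card κ * (Fintype.card κ - 1) * (Fintype.card κ - 2) / 3 := by
  have h1 : ∑ i, ∑ j, ∑ k, angleTriple z (g i) (g k) (g j)
      = ∑ i, ∑ j, ∑ k, angleTriple z (g i) (g j) (g k) :=
    Finset.sum_congr rfl fun i _ => Finset.sum_comm
  have h2 : ∑ i, ∑ j, ∑ k, angleTriple z (g j) (g k) (g i)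
      = ∑ i, ∑ j, ∑ k, angleTriple z (g i) (g j) (g k) := by
    rw [Finset.sum_comm]
    exact Finset.sum_congr rfl fun i _ => Finset.sum_comm
  have h3 : ∑ i, ∑ j, ∑ k, (angleTriple z (g i) (g j) (g k) + angleTriple z (g i) (g k) (g j)
      + angleTriple z (g j) (g k) (g i))
      = Fintype.card κ * (Fintype.card κ - 1) * (Fintype.card κ - 2) := by
    rw [← sum_distinct]
    refine Finset.sum_congr rfl fun i _ => Finset.sum_congr rfl fun j _ =>
      Finset.sum_congr rfl fun k _ => ?_
    rw [angleTriple_add_add hz]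
    simp only [ne_eq, hg.eq_iff]
  simp only [Finset.sum_add_distrib] at h3
  rw [h1, h2] at h3
  linarith

/-- The same symmetrization for triples with two points in one group and one in the other. It
expresses the sums with the vertex in the larger part through those with the vertex alone in its
group. -/
lemma sum_angleTriple_between {ι κ τ : Type*} [Fintype ι] [DecidableEq ι] [Fintype κ]
    [DecidableEq κ] [Fintype τ] {z : ι → EuclideanSpace ℝ (Fin d)}
    (hz : Function.Injective z)
    {g : κ → ι} (hg : Function.Injective g) {h : τ → ι} (hgh : ∀ i j, g i ≠ h j) :
    ∑ i, ∑ j, ∑ k, angleTriple z (g i) (g j) (h k)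
      + 2 * ∑ i, ∑ j, ∑ k, angleTriple z (g i) (h j) (g k)
      = Fintype.card κ * (Fintype.card κ - 1) * Fintype.card τ := by
  have h1 : ∑ i, ∑ j, ∑ k, angleTriple z (g i) (h k) (g j)
      = ∑ i, ∑ j, ∑ k, angleTriple z (g i) (h j) (g k) :=
    Finset.sum_congr rfl fun i _ => Finset.sum_comm
  have h2 : ∑ i, ∑ j, ∑ k, angleTriple z (g j) (h k) (g i)
      = ∑ i, ∑ j, ∑ k, angleTriple z (g i) (h j) (g k) := by
    rw [Finset.sum_comm]
    exact Finset.sum_congr rfl fun i _ => Finset.sum_comm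
  have h3 : ∑ i, ∑ j, ∑ k, (angleTriple z (g i) (g j) (h k) + angleTriple z (g i) (h k) (g j)
      + angleTriple z (g j) (h k) (g i))
      = Fintype.card κ * (Fintype.card κ - 1) * Fintype.card τ := by
    have : ∀ i j k, angleTriple z (g i) (g j) (h k) + angleTriple z (g i) (h k) (g j)
        + angleTriple z (g j) (h k) (g i) = 1 - if i = j then 1 else 0 := by
      intro i j k
      rw [angleTriple_add_add hz]
      by_cases hij : i = j <;> simp [hij, hgh, hg.eq_iff]
    simp only [this, Finset.sum_sub_distrib, Finset.sum_const, Finset.card_univ, nsmul_eq_mul,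
      mul_one, Finset.sum_ite_eq, Finset.mem_univ, if_true, ← Finset.mul_sum]
    ring
  simp only [Finset.sum_add_distrib] at h3
  rw [h1, h2] at h3
  linarith

lemma sum_offDiag_fst {ι : Type*} [Fintype ι] [DecidableEq ι] (f : ι → ℝ) :
    ∑ i ∈ (univ : Finset ι).offDiag, f i.1 = (Fintype.card ι - 1) * ∑ i, f i := by
  rw [sum_offDiag_eq, Finset.mul_sum]
  refine Finset.sum_congr rfl fun i _ => ?_
  have : ∀ j, (if i = j then 0 else f i) = f i - if i = j then f i else 0 := by
    intro j
    split_ifs <;> simp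
  simp only [this, Finset.sum_sub_distrib, Finset.sum_const, Finset.card_univ, nsmul_eq_mul,
    Finset.sum_ite_eq, Finset.mem_univ, if_true]
  ring

lemma castAdd_ne_natAdd (i : Fin m) (j : Fin n) : Fin.castAdd n i ≠ Fin.natAdd m j := by
  intro h
  have := congrArg Fin.val h
  simp only [Fin.val_castAdd, Fin.val_natAdd] at this
  omega

/-- For distinct observations the Cramér-von Mises statistic is a quadratic polynomial in the
group indicators. -/
lemma scaledStat_eq_polyStat (hm : 2 ≤ m) (hn : 2 ≤ n) (hz : Function.Injective z) :
    scaledStat m n z = polyStat m n z := by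
  set x : Fin m → Fin (m + n) := Fin.castAdd n
  set y : Fin n → Fin (m + n) := Fin.natAdd m
  have hx : Function.Injective x := Fin.castAdd_injective m n
  have hy : Function.Injective y := Fin.natAdd_injective n m
  have hxy : ∀ i j, x i ≠ y j := castAdd_ne_natAdd
  have hyx : ∀ i j, y i ≠ x j := fun i j => (castAdd_ne_natAdd j i).symm
  have hS := sum_angleTriple_within hz hx
  have hS' := sum_angleTriple_within hz hy
  have hR := sum_angleTriple_between hz hx hxy
  have hR' := sum_angleTriple_between hz hy hyx
  simp only [Fintype.card_fin] at hS hS' hR hR'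
  set P := ∑ i, ∑ j, ∑ k, angleTriple z (x i) (x j) (y k) with hP
  set P' := ∑ i, ∑ j, ∑ k, angleTriple z (y i) (y j) (x k) with hP'
  set R := ∑ i, ∑ j, ∑ k, angleTriple z (x i) (y j) (x k) with hRd
  set R' := ∑ i, ∑ j, ∑ k, angleTriple z (y i) (x j) (y k) with hRd'
  set S := ∑ i, ∑ j, ∑ k, angleTriple z (x i) (x j) (x k) with hSd
  set S' := ∑ i, ∑ j, ∑ k, angleTriple z (y i) (y j) (y k) with hSd'
  have hR2 : ∑ i, ∑ j, ∑ k, angleTriple z (y i) (x j) (x k) = R := by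
    rw [Finset.sum_comm]
    simp only [hRd, angleTriple_comm z (y _)]
  have hR2' : ∑ i, ∑ j, ∑ k, angleTriple z (x i) (y j) (y k) = R' := by
    rw [Finset.sum_comm]
    simp only [hRd', angleTriple_comm z (y _) (x _)]
  have m2 : (2 : ℝ) ≤ m := by exact_mod_cast hm
  have n2 : (2 : ℝ) ≤ n := by exact_mod_cast hn
  have hm0 : (m : ℝ) ≠ 0 := by linarith
  have hn0 : (n : ℝ) ≠ 0 := by linarith
  have hm1 : (m : ℝ) - 1 ≠ 0 := by linarith
  have hn1 : (n : ℝ) - 1 ≠ 0 := by linarith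
  have hmn : (m : ℝ) + n ≠ 0 := by linarith
  have hT : scaledStat m n z = (m + n) * (P / (m * (m - 1) * n) + P' / (n * (n - 1) * m)
      - 2 / 3) := by
    have h1 : ∑ i ∈ (univ : Finset (Fin m)).offDiag, ∑ k,
        angleKernel (z (x i.1)) (z (x i.2)) (z (y k)) = P := by
      rw [sum_offDiag_eq]
      refine Finset.sum_congr rfl fun i _ => Finset.sum_congr rfl fun j _ => ?_
      by_cases h : i = j <;> simp [h, angleTriple, hxy, hx.eq_iff]
    have h2 : ∑ i ∈ (univ : Finset (Fin n)).offDiag, ∑ k,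
        angleKernel (z (y i.1)) (z (y i.2)) (z (x k)) = P' := by
      rw [sum_offDiag_eq]
      refine Finset.sum_congr rfl fun i _ => Finset.sum_congr rfl fun j _ => ?_
      by_cases h : i = j <;> simp [h, angleTriple, hyx, hy.eq_iff]
    have h3 : ∑ i ∈ (univ : Finset (Fin m)).offDiag, ∑ j ∈ (univ : Finset (Fin n)).offDiag,
        angleKernel (z (x i.1)) (z (x i.2)) (z (y j.1)) = (n - 1) * P := by
      rw [← h1, Finset.mul_sum]
      refine Finset.sum_congr rfl fun i _ => ?_
      rw [sum_offDiag_fst (fun k => angleKernel (z (x i.1)) (z (x i.2)) (z (y k))),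
        Fintype.card_fin]
    have h4 : ∑ i ∈ (univ : Finset (Fin m)).offDiag, ∑ j ∈ (univ : Finset (Fin n)).offDiag,
        angleKernel (z (y j.1)) (z (y j.2)) (z (x i.1)) = (m - 1) * P' := by
      rw [← h2, Finset.mul_sum, Finset.sum_comm]
      refine Finset.sum_congr rfl fun i _ => ?_
      rw [sum_offDiag_fst (fun k => angleKernel (z (y i.1)) (z (y i.2)) (z (x k))),
        Fintype.card_fin]
    have h5 : ∑ i ∈ (univ : Finset (Fin m)).offDiag, ∑ j ∈ (univ : Finset (Fin n)).offDiag,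
        kernel (z (x i.1)) (z (x i.2)) (z (y j.1)) (z (y j.2))
        = (n - 1) * P + (m - 1) * P' - m * (m - 1) * (n * (n - 1)) * (2 / 3) := by
      simp only [kernel_eq_angleKernel, Finset.sum_sub_distrib, Finset.sum_add_distrib, h3, h4,
        Finset.sum_const, Finset.offDiag_card, Finset.card_univ, Fintype.card_fin, nsmul_eq_mul]
      rw [Nat.cast_sub (Nat.le_mul_self m), Nat.cast_sub (Nat.le_mul_self n)]
      push_cast
      ring
    rw [scaledStat, uStat, h5, Nat.cast_descFactorial_two, Nat.cast_descFactorial_two,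
      Nat.cast_add]
    field_simp
  have hQ : permQuadratic (groupWeight m n) (angleMatrix z) 1
      = ((n / (m + n)) ^ 2 * (S + P) - 2 * ((n / (m + n)) * (m / (m + n))) * (R + R')
        + (m / (m + n)) ^ 2 * (P' + S')) / (m + n) := by
    simp only [permQuadratic, permLinear, groupWeight, angleMatrix, Equiv.Perm.one_apply,
      Fin.sum_univ_add, Fin.append_left, Fin.append_right, Fintype.card_fin, Nat.cast_add]
    simp only [add_div, mul_add, Finset.sum_add_distrib, ← Finset.mul_sum, ← Finset.sum_div]
    rw [← hP, ← hP', ← hRd, ← hRd', ← hSd, ← hSd', hR2, hR2']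
    ring
  have hL : permLinear (groupWeight m n) (angleRow z) 1
      = ((n / (m + n)) * (S + P + R + R') - (m / (m + n)) * (R + R' + P' + S')) / (m + n) ^ 2 := by
    simp only [permLinear, groupWeight, angleRow, angleMatrix, Equiv.Perm.one_apply,
      Fin.sum_univ_add, Fin.append_left, Fin.append_right, Fintype.card_fin, Nat.cast_add]
    simp only [add_div, mul_add, Finset.sum_add_distrib, ← Finset.mul_sum, ← Finset.sum_div]
    rw [← hP, ← hP', ← hRd, ← hRd', ← hSd, ← hSd', hR2, hR2']
    field_simp
    ring
  -- Six sums occur. S and S' are deterministic, and R, R' are eliminated through P, P'. Both sides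
  -- are then affine in P and P', and `quadCoef`, `linCoef` and `constCoef` are what matching the
  -- coefficients forces.
  have eR : R = ((m : ℝ) * (m - 1) * n - P) / 2 := by linarith
  have eR' : R' = ((n : ℝ) * (n - 1) * m - P') / 2 := by linarith
  rw [hT, polyStat, permStat, hQ, hL, hS, hS', eR, eR']
  unfold quadCoef linCoef constCoef
  simp only [Fintype.card_fin, Nat.cast_add]
  generalize (m : ℝ) = a at *
  generalize (n : ℝ) = b at *
  field_simp
  ring

end StatisticIdentity

end CvM

namespace CvM

open scoped BigOperators
open Finset (univ)

/-! ### Bounded measurable functions, for which all integrability questions are automatic. -/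

/-- Bounded measurable real functions. -/
structure BddMeasurable {A : Type*} [MeasurableSpace A] (f : A → ℝ) : Prop where
  meas : Measurable f
  bdd : ∃ C, ∀ x, |f x| ≤ C

namespace BddMeasurable

variable {A B : Type*} [MeasurableSpace A] [MeasurableSpace B] {f g : A → ℝ}

lemma comp (hf : BddMeasurable f) {u : B → A} (hu : Measurable u) :
    BddMeasurable fun x => f (u x) :=
  ⟨hf.meas.comp hu, hf.bdd.imp fun _ h _ => h _⟩

lemma const (c : ℝ) : BddMeasurable fun _ : A => c := ⟨measurable_const, |c|, fun _ => le_rfl⟩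

lemma add (hf : BddMeasurable f) (hg : BddMeasurable g) : BddMeasurable fun x => f x + g x := by
  obtain ⟨C, hC⟩ := hf.bdd
  obtain ⟨D, hD⟩ := hg.bdd
  exact ⟨hf.meas.add hg.meas, C + D, fun x => (abs_add_le _ _).trans (add_le_add (hC x) (hD x))⟩

lemma sub (hf : BddMeasurable f) (hg : BddMeasurable g) : BddMeasurable fun x => f x - g x := by
  obtain ⟨C, hC⟩ := hf.bdd
  obtain ⟨D, hD⟩ := hg.bdd
  exact ⟨hf.meas.sub hg.meas, C + D, fun x => (abs_sub _ _).trans (add_le_add (hC x) (hD x))⟩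

lemma mul (hf : BddMeasurable f) (hg : BddMeasurable g) : BddMeasurable fun x => f x * g x := by
  obtain ⟨C, hC⟩ := hf.bdd
  obtain ⟨D, hD⟩ := hg.bdd
  refine ⟨hf.meas.mul hg.meas, C * D, fun x => ?_⟩
  rw [abs_mul]
  exact mul_le_mul (hC x) (hD x) (abs_nonneg _) ((abs_nonneg _).trans (hC x))

lemma pow (hf : BddMeasurable f) (k : ℕ) : BddMeasurable fun x => f x ^ k := by
  obtain ⟨C, hC⟩ := hf.bdd
  refine ⟨hf.meas.pow_const k, C ^ k, fun x => ?_⟩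
  rw [abs_pow]
  exact pow_le_pow_left₀ (abs_nonneg _) (hC x) k

lemma const_mul (c : ℝ) (hf : BddMeasurable f) : BddMeasurable fun x => c * f x :=
  (const c).mul hf

lemma sum {κ : Type*} (s : Finset κ) {F : κ → A → ℝ} (hF : ∀ i, BddMeasurable (F i)) :
    BddMeasurable fun x => ∑ i ∈ s, F i x := by
  classical
  induction s using Finset.induction_on with
  | empty => simpa using const (A := A) 0
  | insert i s hi ih => simpa [Finset.sum_insert hi] using (hF i).add ih

lemma expect {κ : Type*} [Fintype κ] {F : κ → A → ℝ} (hF : ∀ i, BddMeasurable (F i)) :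
    BddMeasurable fun x => 𝔼 i, F i x := by
  have := (sum univ hF).const_mul ((Fintype.card κ : ℝ)⁻¹)
  simpa [Fintype.expect_eq_sum_div_card, div_eq_inv_mul] using this

lemma indicator {s : Set A} (hs : MeasurableSet s) : BddMeasurable (s.indicator fun _ => (1 : ℝ)) :=
  ⟨measurable_const.indicator hs, 1, fun x => by
    by_cases h : x ∈ s <;> simp [h]⟩

lemma integrable (hf : BddMeasurable f) (μ : Measure A) [IsFiniteMeasure μ] :
    Integrable f μ := by
  obtain ⟨C, hC⟩ := hf.bdd
  exact Integrable.of_bound hf.meas.aestronglyMeasurable C (ae_of_all _ hC)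

lemma memLp (hf : BddMeasurable f) (μ : Measure A) [IsFiniteMeasure μ] : MemLp f 2 μ := by
  obtain ⟨C, hC⟩ := hf.bdd
  exact MemLp.of_bound hf.meas.aestronglyMeasurable C (ae_of_all _ hC)

lemma integral_right {f : A × B → ℝ} (hf : BddMeasurable f) (ν : Measure B)
    [IsProbabilityMeasure ν] : BddMeasurable fun x => ∫ y, f (x, y) ∂ν := by
  obtain ⟨C, hC⟩ := hf.bdd
  refine ⟨hf.meas.stronglyMeasurable.integral_prod_right'.measurable, C, fun x => ?_⟩
  refine (norm_integral_le_of_norm_le_const (ae_of_all ν fun y => (Real.norm_eq_abs _).trans_le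
    (hC (x, y)))).trans_eq ?_
  simp

lemma integral_sq_le (hf : BddMeasurable f) (μ : Measure A) [IsProbabilityMeasure μ] :
    (∫ x, f x ∂μ) ^ 2 ≤ ∫ x, f x ^ 2 ∂μ := by
  have h1 := variance_eq_sub (hf.memLp μ)
  have h2 := variance_nonneg f μ
  rw [h1] at h2
  simpa using h2

end BddMeasurable

/-! ### The Efron-Stein inequality and concentration. -/

section EfronStein

variable {A B : Type*} [MeasurableSpace A] [MeasurableSpace B]

lemma two_mul_variance_eq {f : A → ℝ} (hf : BddMeasurable f) (μ : Measure A)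
    [IsProbabilityMeasure μ] :
    2 * (∫ x, f x ^ 2 ∂μ - (∫ x, f x ∂μ) ^ 2) = ∫ x, ∫ y, (f x - f y) ^ 2 ∂μ ∂μ := by
  have h : ∀ x, ∫ y, (f x - f y) ^ 2 ∂μ
      = f x ^ 2 - 2 * f x * ∫ y, f y ∂μ + ∫ y, f y ^ 2 ∂μ := by
    intro x
    have e : ∀ y, (f x - f y) ^ 2 = f x ^ 2 - 2 * f x * f y + f y ^ 2 := fun y => by ring
    simp only [e]
    rw [integral_add, integral_sub, integral_const_mul]
    · simp
    · exact integrable_const _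
    · exact (hf.const_mul _).integrable μ
    · exact ((BddMeasurable.const _).sub (hf.const_mul _)).integrable μ
    · exact (hf.pow 2).integrable μ
  simp only [h]
  have e : ∀ x, f x ^ 2 - 2 * f x * ∫ y, f y ∂μ + ∫ y, f y ^ 2 ∂μ
      = f x ^ 2 - (2 * ∫ y, f y ∂μ) * f x + ∫ y, f y ^ 2 ∂μ := fun x => by ring
  simp only [e]
  rw [integral_add, integral_sub, integral_const_mul]
  · simp
    ring
  · exact (hf.pow 2).integrable μ
  · exact (hf.const_mul _).integrable μ
  · exact ((hf.pow 2).sub (hf.const_mul _)).integrable μ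
  · exact integrable_const _

/-- Tensorization of the variance over a product of two spaces. -/
lemma variance_prod_le {g : A × B → ℝ} (hg : BddMeasurable g) (μ : Measure A) (ν : Measure B)
    [IsProbabilityMeasure μ] [IsProbabilityMeasure ν] :
    (∫ a, ∫ b, g (a, b) ^ 2 ∂ν ∂μ) - (∫ a, ∫ b, g (a, b) ∂ν ∂μ) ^ 2
      ≤ (∫ a, ((∫ b, g (a, b) ^ 2 ∂ν) - (∫ b, g (a, b) ∂ν) ^ 2) ∂μ)
        + 1 / 2 * ∫ a, ∫ b, ∫ a', (g (a, b) - g (a', b)) ^ 2 ∂μ ∂ν ∂μ := by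
  have hG := hg.integral_right ν
  have h2 := two_mul_variance_eq hG μ
  have hd : BddMeasurable fun p : A × B × A => g (p.1, p.2.1) - g (p.2.2, p.2.1) :=
    (hg.comp (u := fun p : A × B × A => (p.1, p.2.1)) (by fun_prop)).sub
      (hg.comp (u := fun p : A × B × A => (p.2.2, p.2.1)) (by fun_prop))
  -- The left side is twice the variance of the conditional mean. Jensen's inequality moves the
  -- square inside the integral over `b`.
  have h3 : ∫ a, ∫ a', ((∫ b, g (a, b) ∂ν) - ∫ b, g (a', b) ∂ν) ^ 2 ∂μ ∂μ
      ≤ ∫ a, ∫ b, ∫ a', (g (a, b) - g (a', b)) ^ 2 ∂μ ∂ν ∂μ := by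
    have hL : BddMeasurable fun p : A × A => ((∫ b, g (p.1, b) ∂ν) - ∫ b, g (p.2, b) ∂ν) ^ 2 :=
      ((hG.comp measurable_fst).sub (hG.comp measurable_snd)).pow 2
    have hM : BddMeasurable fun p : (A × A) × B => (g (p.1.1, p.2) - g (p.1.2, p.2)) ^ 2 :=
      ((hg.comp (u := fun p : (A × A) × B => (p.1.1, p.2)) (by fun_prop)).sub
      (hg.comp (u := fun p : (A × A) × B => (p.1.2, p.2)) (by fun_prop))).pow 2
    have hR : ∀ a, ∫ b, ∫ a', (g (a, b) - g (a', b)) ^ 2 ∂μ ∂ν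
        = ∫ a', ∫ b, (g (a, b) - g (a', b)) ^ 2 ∂ν ∂μ := fun a =>
      integral_integral_swap (((hd.comp (u := fun q : B × A => (a, q)) (by fun_prop)).pow 2).integrable _)
    simp only [hR]
    refine integral_mono ((hL.integral_right μ).integrable μ)
      (((hM.integral_right ν).integral_right μ).integrable μ) fun a => ?_
    refine integral_mono ((hL.comp (u := fun x => (a, x)) (by fun_prop)).integrable μ)
      (((hM.integral_right ν).comp (u := fun x => (a, x)) (by fun_prop)).integrable μ)
      fun a' => ?_
    have i1 := (hg.comp (u := fun x => (a, x)) (by fun_prop))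
    have i2 := (hg.comp (u := fun x => (a', x)) (by fun_prop))
    change ((∫ b, g (a, b) ∂ν) - ∫ b, g (a', b) ∂ν) ^ 2 ≤ ∫ b, (g (a, b) - g (a', b)) ^ 2 ∂ν
    rw [← integral_sub (i1.integrable ν) (i2.integrable ν)]
    exact (i1.sub i2).integral_sq_le ν
  rw [integral_sub (((hg.pow 2).integral_right ν).integrable μ) ((hG.pow 2).integrable μ)]
  linarith

variable {E : Type*} [MeasurableSpace E]

lemma integral_pi_succ {n : ℕ} (μ : Fin (n + 1) → Measure E) [∀ i, IsProbabilityMeasure (μ i)]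
    {F : (Fin (n + 1) → E) → ℝ} (hF : BddMeasurable F) :
    ∫ z, F z ∂Measure.pi μ
      = ∫ a, ∫ b, F (Fin.cons a b) ∂Measure.pi (fun i : Fin n => μ i.succ) ∂μ 0 := by
  have h := (measurePreserving_piFinSuccAbove μ 0).symm
  rw [← h.integral_comp' (g := F), integral_prod]
  · have e : ∀ (a : E) (b : Fin n → E),
        (MeasurableEquiv.piFinSuccAbove (fun _ => E) 0).symm (a, b) = Fin.cons a b := by
      intro a b
      simp [MeasurableEquiv.piFinSuccAbove, Fin.insertNthEquiv]
    simp only [e, Fin.succAbove_zero]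
  · exact (hF.comp (MeasurableEquiv.measurable _)).integrable _

lemma measurable_update_prod {ι : Type*} [DecidableEq ι] (i : ι) :
    Measurable fun p : (ι → E) × E => Function.update p.1 i p.2 := by
  refine measurable_pi_lambda _ fun j => ?_
  by_cases h : j = i
  · subst h
    simpa using measurable_snd
  · simp only [Function.update_of_ne h]
    fun_prop

lemma measurable_cons {n : ℕ} :
    Measurable fun p : E × (Fin n → E) => (Fin.cons p.1 p.2 : Fin (n + 1) → E) := by
  refine measurable_pi_lambda _ fun j => ?_
  refine Fin.cases ?_ (fun i => ?_) j
  · simpa using measurable_fst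
  · simp only [Fin.cons_succ]
    fun_prop

/-- The Efron-Stein inequality for bounded functions. -/
theorem efron_stein {n : ℕ} (μ : Fin n → Measure E) [∀ i, IsProbabilityMeasure (μ i)]
    {g : (Fin n → E) → ℝ} (hg : BddMeasurable g) :
    (∫ z, g z ^ 2 ∂Measure.pi μ) - (∫ z, g z ∂Measure.pi μ) ^ 2
      ≤ 1 / 2 * ∑ i, ∫ z, ∫ x, (g z - g (Function.update z i x)) ^ 2 ∂μ i ∂Measure.pi μ := by
  induction n with
  | zero =>
    have h : ∀ z : Fin 0 → E, g z = g default := fun z => congrArg g (Subsingleton.elim _ _)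
    simp only [h]
    simp
  | succ n ih =>
    set ν := Measure.pi fun i : Fin n => μ i.succ
    have hgc : BddMeasurable fun p : E × (Fin n → E) => g (Fin.cons p.1 p.2) :=
      hg.comp measurable_cons
    have hH : ∀ i, BddMeasurable fun z => ∫ x, (g z - g (Function.update z i x)) ^ 2 ∂μ i :=
      fun i => BddMeasurable.integral_right (f := fun p : (Fin (n + 1) → E) × E =>
        (g p.1 - g (Function.update p.1 i p.2)) ^ 2)
        (((hg.comp measurable_fst).sub (hg.comp (measurable_update_prod i))).pow 2) _
    rw [integral_pi_succ μ hg, integral_pi_succ μ (hg.pow 2),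
      Finset.sum_congr rfl fun i _ => integral_pi_succ μ (hH i), Fin.sum_univ_succ]
    simp only [Fin.update_cons_zero, ← Fin.cons_update]
    refine (variance_prod_le hgc (μ 0) ν).trans ?_
    rw [mul_add, add_comm]
    -- The resampling term of coordinate 0 is the second term of the tensorized bound. The
    -- conditional variance given `a` is left to the induction hypothesis.
    refine add_le_add le_rfl ?_
    have hT : ∀ i : Fin n, BddMeasurable fun a : E =>
        ∫ b, ∫ x, (g (Fin.cons a b) - g (Fin.cons a (Function.update b i x))) ^ 2
          ∂μ i.succ ∂ν := by
      intro i
      refine BddMeasurable.integral_right (f := fun p : E × (Fin n → E) =>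
        ∫ x, (g (Fin.cons p.1 p.2) - g (Fin.cons p.1 (Function.update p.2 i x))) ^ 2
          ∂μ i.succ) ?_ ν
      refine BddMeasurable.integral_right (f := fun q : (E × (Fin n → E)) × E =>
        (g (Fin.cons q.1.1 q.1.2) - g (Fin.cons q.1.1 (Function.update q.1.2 i q.2))) ^ 2) ?_ _
      refine ((hgc.comp measurable_fst).sub (hgc.comp (u := fun q : (E × (Fin n → E)) × E =>
        (q.1.1, Function.update q.1.2 i q.2)) ?_)).pow 2
      exact measurable_fst.fst.prodMk ((measurable_update_prod i).comp
        (measurable_fst.snd.prodMk measurable_snd))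
    rw [← integral_finsetSum _ fun i _ => (hT i).integrable _, ← integral_const_mul]
    refine integral_mono
      ((((hgc.pow 2).integral_right ν).sub ((hgc.integral_right ν).pow 2)).integrable _)
      (((BddMeasurable.sum univ hT).const_mul _).integrable _) fun a => ?_
    exact ih (fun i => μ i.succ) (hgc.comp (u := fun b => (a, b)) (by fun_prop))

/-- Concentration of functions with small differences. -/
lemma measure_abs_sub_integral_ge_le {n : ℕ} (μ : Fin n → Measure E)
    [∀ i, IsProbabilityMeasure (μ i)] {g : (Fin n → E) → ℝ} (hg : BddMeasurable g) {L δ : ℝ}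
    (hL : ∀ z i x, |g (Function.update z i x) - g z| ≤ L) (hδ : 0 < δ) :
    Measure.pi μ {z | δ ≤ |g z - ∫ w, g w ∂Measure.pi μ|}
      ≤ ENNReal.ofReal (n * L ^ 2 / (2 * δ ^ 2)) := by
  refine (meas_ge_le_variance_div_sq (hg.memLp _) hδ).trans (ENNReal.ofReal_le_ofReal ?_)
  have h1 := efron_stein μ hg
  have h2 := variance_eq_sub (hg.memLp (Measure.pi μ))
  have h3 : ∀ i, ∫ z, ∫ x, (g z - g (Function.update z i x)) ^ 2 ∂μ i ∂Measure.pi μ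
      ≤ L ^ 2 := by
    intro i
    have hH : BddMeasurable fun p : (Fin n → E) × E =>
        (g p.1 - g (Function.update p.1 i p.2)) ^ 2 :=
      ((hg.comp measurable_fst).sub (hg.comp (measurable_update_prod i))).pow 2
    calc _ ≤ ∫ z, L ^ 2 ∂Measure.pi μ := by
          refine integral_mono ((hH.integral_right _).integrable _) (integrable_const _)
            fun z => ?_
          calc _ ≤ ∫ x, L ^ 2 ∂μ i := by
                refine integral_mono ((hH.comp (u := fun x => (z, x))
                  (by fun_prop)).integrable _) (integrable_const _) fun x => ?_
                change (g z - g (Function.update z i x)) ^ 2 ≤ L ^ 2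
                rw [← sq_abs, abs_sub_comm]
                exact pow_le_pow_left₀ (abs_nonneg _) (hL z i x) 2
            _ = L ^ 2 := by simp
      _ = L ^ 2 := by simp
  have h4 : ∑ i, ∫ z, ∫ x, (g z - g (Function.update z i x)) ^ 2 ∂μ i ∂Measure.pi μ
      ≤ n * L ^ 2 := by
    refine (Finset.sum_le_card_nsmul _ _ _ fun i _ => h3 i).trans_eq ?_
    simp
  have h5 : Var[g; Measure.pi μ] ≤ n * L ^ 2 / 2 := by
    rw [h2]
    simp only [Pi.pow_apply]
    linarith
  calc _ ≤ n * L ^ 2 / 2 / δ ^ 2 := by gcongr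
    _ = _ := by rw [div_div]

end EfronStein

end CvM

namespace CvM

open scoped BigOperators
open Finset (univ)

/-! ### Relabelling and resampling coordinates of a product measure. -/

section ProductMeasure

variable {E : Type*} [MeasurableSpace E] {ι : Type*}

lemma isProbabilityMeasure_update [DecidableEq ι] {μ : ι → Measure E} (hμ : ∀ i, IsProbabilityMeasure (μ i))
    (i : ι) {ν : Measure E} (hν : IsProbabilityMeasure ν) (j : ι) :
    IsProbabilityMeasure (Function.update μ i ν j) := by
  rcases eq_or_ne j i with rfl | h
  · rwa [Function.update_self]
  · rw [Function.update_of_ne h]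
    exact hμ j

variable [Fintype ι]

/-- Integrals against product measures are invariant under simultaneous relabelling. -/
lemma integral_pi_comp (μ : ι → Measure E) [∀ i, IsProbabilityMeasure (μ i)]
    (σ : Equiv.Perm ι) (g : (ι → E) → ℝ) :
    ∫ z, g (z ∘ σ) ∂Measure.pi μ = ∫ z, g z ∂Measure.pi (fun i => μ (σ i)) := by
  have h := measurePreserving_piCongrLeft (α := fun _ => E) μ σ
  rw [← h.integral_comp']
  refine integral_congr_ae (ae_of_all _ fun z => congrArg g (funext fun i => ?_))
  exact Equiv.piCongrLeft_apply_apply (P := fun _ => E) σ z i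

variable [DecidableEq ι]

/-- Resampling one coordinate of a product measure. -/
lemma measurePreserving_update (μ : ι → Measure E) [hμ : ∀ i, IsProbabilityMeasure (μ i)] (i : ι)
    (ν : Measure E) [hν : IsProbabilityMeasure ν] :
    MeasurePreserving (fun p : (ι → E) × E => Function.update p.1 i p.2)
      ((Measure.pi μ).prod ν) (Measure.pi (Function.update μ i ν)) := by
  have := isProbabilityMeasure_update hμ i hν
  refine ⟨measurable_update_prod i, (Measure.pi_eq fun s hs => ?_).symm⟩
  have hpre : (fun p : (ι → E) × E => Function.update p.1 i p.2) ⁻¹' (Set.univ.pi s)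
      = (Set.univ.pi (Function.update s i Set.univ)) ×ˢ s i := by
    ext p
    simp only [Set.mem_preimage, Set.mem_pi, Set.mem_univ, true_imp_iff, Set.mem_prod]
    constructor
    · intro h
      refine ⟨fun j => ?_, by simpa using h i⟩
      rcases eq_or_ne j i with rfl | hj
      · simp
      · simpa [hj] using h j
    · rintro ⟨h1, h2⟩ j
      rcases eq_or_ne j i with rfl | hj
      · simpa using h2
      · simpa [hj] using h1 j
  rw [Measure.map_apply (measurable_update_prod i) (MeasurableSet.univ_pi hs), hpre,
    Measure.prod_prod, Measure.pi_pi, ← Finset.mul_prod_erase univ _ (Finset.mem_univ i),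
    ← Finset.mul_prod_erase univ (fun j => Function.update μ i ν j (s j)) (Finset.mem_univ i)]
  simp only [Function.update_self, measure_univ, one_mul]
  rw [mul_comm]
  congr 1
  refine Finset.prod_congr rfl fun j hj => ?_
  rw [Function.update_of_ne (Finset.ne_of_mem_erase hj),
    Function.update_of_ne (Finset.ne_of_mem_erase hj)]

lemma integral_pi_update (μ : ι → Measure E) [hμ : ∀ i, IsProbabilityMeasure (μ i)] (i : ι)
    (ν : Measure E) [hν : IsProbabilityMeasure ν] {g : (ι → E) → ℝ} (hg : BddMeasurable g) :
    ∫ z, g z ∂Measure.pi (Function.update μ i ν)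
      = ∫ z, ∫ x, g (Function.update z i x) ∂ν ∂Measure.pi μ := by
  have h := measurePreserving_update μ i ν
  rw [← h.map_eq, integral_map h.measurable.aemeasurable hg.meas.aestronglyMeasurable,
    integral_prod _ ((hg.comp (measurable_update_prod i)).integrable _)]

lemma integral_pi_resample (μ : ι → Measure E) [hμ : ∀ i, IsProbabilityMeasure (μ i)] (i : ι)
    {g : (ι → E) → ℝ} (hg : BddMeasurable g) :
    ∫ z, ∫ x, g (Function.update z i x) ∂μ i ∂Measure.pi μ = ∫ z, g z ∂Measure.pi μ := by
  rw [← integral_pi_update μ i (μ i) hg, Function.update_eq_self]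

end ProductMeasure

/-! ### Comparing the two-sample design with the i.i.d. mixture. -/

section MeanComparison

lemma abs_integral_le_of_abs_le {A : Type*} [MeasurableSpace A] (μ : Measure A)
    [IsProbabilityMeasure μ] {f : A → ℝ} {L : ℝ} (h : ∀ x, |f x| ≤ L) :
    |∫ x, f x ∂μ| ≤ L := by
  rw [← Real.norm_eq_abs]
  refine (norm_integral_le_of_norm_le_const (ae_of_all μ fun x => ?_)).trans_eq
    (by simp : L * μ.real Set.univ = L)
  exact (Real.norm_eq_abs _).trans_le (h x)

variable {E : Type*} [MeasurableSpace E] {ι : Type*} [Fintype ι] [DecidableEq ι]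

lemma abs_integral_update_sub_le (μ : ι → Measure E) [hμ : ∀ i, IsProbabilityMeasure (μ i)]
    (i : ι) (ν : Measure E) [hν : IsProbabilityMeasure ν] {g : (ι → E) → ℝ}
    (hg : BddMeasurable g) {L : ℝ} (hL : ∀ z i x, |g (Function.update z i x) - g z| ≤ L) :
    |∫ z, g z ∂Measure.pi (Function.update μ i ν) - ∫ z, g z ∂Measure.pi μ| ≤ L := by
  have hu := hg.comp (measurable_update_prod (E := E) i)
  have h1 : ∀ z, |(∫ x, g (Function.update z i x) ∂ν) - g z| ≤ L := by
    intro z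
    have e : (∫ x, g (Function.update z i x) ∂ν) - g z
        = ∫ x, (g (Function.update z i x) - g z) ∂ν := by
      rw [integral_sub ((hu.comp (u := fun x => (z, x)) (by fun_prop)).integrable ν)
        (integrable_const _)]
      simp
    rw [e]
    exact abs_integral_le_of_abs_le ν fun x => hL z i x
  rw [integral_pi_update μ i ν hg,
    ← integral_sub ((hu.integral_right ν).integrable _) (hg.integrable _)]
  exact abs_integral_le_of_abs_le _ h1

/-- The family of laws equal to `H` on `J`, to `P` on `S \ J` and to `Q` elsewhere. -/
def lawFamily (H P Q : Measure E) (J S : Finset ι) (i : ι) : Measure E :=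
  if i ∈ J then H else if i ∈ S then P else Q

variable {H P Q : Measure E} [hH : IsProbabilityMeasure H] [hP : IsProbabilityMeasure P]
  [hQ : IsProbabilityMeasure Q]

instance isProbabilityMeasure_lawFamily (J S : Finset ι) (i : ι) :
    IsProbabilityMeasure (lawFamily H P Q J S i) := by
  unfold lawFamily
  split_ifs <;> assumption

lemma isProbabilityMeasure_mixture {p q : ℝ} (hp : 0 ≤ p) (hq : 0 ≤ q) (hpq : p + q = 1) :
    IsProbabilityMeasure (mixture p q P Q) := by
  refine ⟨?_⟩
  simp only [mixture, Measure.coe_add, Measure.coe_smul, Pi.add_apply, Pi.smul_apply,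
    measure_univ, smul_eq_mul, mul_one]
  rw [← ENNReal.ofReal_add hp hq, hpq, ENNReal.ofReal_one]

lemma integral_mixture {p q : ℝ} (hp : 0 ≤ p) (hq : 0 ≤ q) {f : E → ℝ} (hf : BddMeasurable f) :
    ∫ x, f x ∂mixture p q P Q = p * ∫ x, f x ∂P + q * ∫ x, f x ∂Q := by
  unfold mixture
  rw [integral_add_measure ((hf.integrable P).smul_measure ENNReal.ofReal_ne_top)
    ((hf.integrable Q).smul_measure ENNReal.ofReal_ne_top), integral_smul_measure,
    integral_smul_measure, ENNReal.toReal_ofReal hp, ENNReal.toReal_ofReal hq, smul_eq_mul,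
    smul_eq_mul]

/-- Passing from `S` to `S'` changes the law of one coordinate at a time, at a cost of at most `L`
each. -/
lemma abs_integral_lawFamily_sub_le_of_subset {g : (ι → E) → ℝ} (hg : BddMeasurable g) {L : ℝ}
    (hL : ∀ z i x, |g (Function.update z i x) - g z| ≤ L) {S S' : Finset ι} (hS : S ⊆ S') :
    |∫ z, g z ∂Measure.pi (lawFamily H P Q ∅ S') - ∫ z, g z ∂Measure.pi (lawFamily H P Q ∅ S)|
      ≤ L * ((S'.card : ℝ) - S.card) := by
  induction S' using Finset.strongInduction with
  | H S' ih =>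
    rcases hS.eq_or_ssubset with rfl | hlt
    · simp
    · obtain ⟨i, hi, hiS⟩ := Finset.exists_of_ssubset hlt
      have h1 := ih (S'.erase i) (Finset.erase_ssubset hi) (Finset.subset_erase.2 ⟨hS, hiS⟩)
      have e : lawFamily H P Q ∅ S' = Function.update (lawFamily H P Q ∅ (S'.erase i)) i P := by
        funext j
        rcases eq_or_ne j i with rfl | hj
        · simp [lawFamily, hi]
        · simp [lawFamily, hj]
      have h2 := abs_integral_update_sub_le (lawFamily H P Q ∅ (S'.erase i)) i P hg hL
      rw [← e] at h2
      rw [Finset.card_erase_of_mem hi, Nat.cast_sub (Finset.card_pos.2 ⟨i, hi⟩)] at h1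
      have h3 := abs_sub_le (∫ z, g z ∂Measure.pi (lawFamily H P Q ∅ S'))
        (∫ z, g z ∂Measure.pi (lawFamily H P Q ∅ (S'.erase i)))
        (∫ z, g z ∂Measure.pi (lawFamily H P Q ∅ S))
      push_cast at h1
      linarith

lemma exists_perm_mem_iff {S S' : Finset ι} (h : S.card = S'.card) :
    ∃ σ : Equiv.Perm ι, ∀ i, σ i ∈ S' ↔ i ∈ S := by
  let e : {x // x ∈ S} ≃ {x // x ∈ S'} := Finset.equivOfCardEq h
  refine ⟨e.extendSubtype, fun i => ⟨fun hi => ?_, fun hi => ?_⟩⟩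
  · by_contra h
    exact e.extendSubtype_not_mem i h hi
  · exact e.extendSubtype_mem i hi

lemma integral_lawFamily_eq_of_card_eq {g : (ι → E) → ℝ}
    (hsymm : ∀ z (σ : Equiv.Perm ι), g (z ∘ σ) = g z) {S S' : Finset ι} (h : S.card = S'.card) :
    ∫ z, g z ∂Measure.pi (lawFamily H P Q ∅ S')
      = ∫ z, g z ∂Measure.pi (lawFamily H P Q ∅ S) := by
  obtain ⟨σ, hσ⟩ := exists_perm_mem_iff h
  have h1 := integral_pi_comp (lawFamily H P Q ∅ S') σ g
  simp only [hsymm] at h1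
  rw [h1]
  congr 2
  funext i
  simp [lawFamily, hσ]

/-- By symmetry the mean depends only on the number of coordinates with law `P`, so the sets may be
taken nested. -/
lemma abs_integral_lawFamily_sub_le {g : (ι → E) → ℝ} (hg : BddMeasurable g) {L : ℝ}
    (hL : ∀ z i x, |g (Function.update z i x) - g z| ≤ L)
    (hsymm : ∀ z (σ : Equiv.Perm ι), g (z ∘ σ) = g z) (S S' : Finset ι) :
    |∫ z, g z ∂Measure.pi (lawFamily H P Q ∅ S) - ∫ z, g z ∂Measure.pi (lawFamily H P Q ∅ S')|
      ≤ L * |(S.card : ℝ) - S'.card| := by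
  rcases le_total S.card S'.card with h | h
  · obtain ⟨T, hT, hc⟩ := Finset.exists_superset_card_eq h (Finset.card_le_univ S')
    rw [integral_lawFamily_eq_of_card_eq hsymm hc, abs_sub_comm, abs_sub_comm (S.card : ℝ),
      abs_of_nonneg (sub_nonneg.2 (Nat.cast_le.2 h)), ← hc]
    exact abs_integral_lawFamily_sub_le_of_subset hg hL hT
  · obtain ⟨T, hT, hc⟩ := Finset.exists_superset_card_eq h (Finset.card_le_univ S)
    rw [integral_lawFamily_eq_of_card_eq hsymm hc,
      abs_of_nonneg (sub_nonneg.2 (Nat.cast_le.2 h)), ← hc]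
    exact abs_integral_lawFamily_sub_le_of_subset hg hL hT

/-- Comparison of the mean of a stable symmetric function under the mixture and under a
two-sample design. -/
lemma abs_integral_mixture_sub_le {p q : ℝ} (hp : 0 ≤ p) (hq : 0 ≤ q) (hpq : p + q = 1)
    (hHd : H = mixture p q P Q) {g : (ι → E) → ℝ} (hg : BddMeasurable g) {L : ℝ}
    (hL0 : 0 ≤ L) (hL : ∀ z i x, |g (Function.update z i x) - g z| ≤ L)
    (hsymm : ∀ z (σ : Equiv.Perm ι), g (z ∘ σ) = g z) (S₀ : Finset ι) {s : ℝ} (hs : 0 < s)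
    (J S : Finset ι) (hJS : Disjoint J S) :
    |∫ z, g z ∂Measure.pi (lawFamily H P Q J S)
        - ∫ z, g z ∂Measure.pi (lawFamily H P Q ∅ S₀)|
      ≤ L * (s / 2 * ((S.card + J.card * p - S₀.card) ^ 2 + J.card * (p * q)) + 1 / (2 * s)) := by
  induction J using Finset.induction_on generalizing S with
  | empty =>
    refine (abs_integral_lawFamily_sub_le hg hL hsymm S S₀).trans
      (mul_le_mul_of_nonneg_left ?_ hL0)
    simp only [Finset.card_empty, Nat.cast_zero, zero_mul, add_zero]
    rw [← sq_abs]
    generalize |(S.card : ℝ) - S₀.card| = x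
    -- Replacing |x| by a quadratic makes the bound propagate exactly in the induction; `s` is
    -- optimized later.
    have e : s / 2 * x ^ 2 + 1 / (2 * s) - x = (s * x - 1) ^ 2 / (2 * s) := by
      field_simp
      ring
    have : 0 ≤ (s * x - 1) ^ 2 / (2 * s) := by positivity
    linarith
  | insert i J hi ih =>
    rw [Finset.disjoint_insert_left] at hJS
    obtain ⟨hiS, hJS⟩ := hJS
    set μ := lawFamily H P Q J S with hμ
    have e1 : lawFamily H P Q (insert i J) S = Function.update μ i H := by
      funext j
      rcases eq_or_ne j i with rfl | hj
      · simp [lawFamily]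
      · simp [lawFamily, hj, hμ]
    have e2 : lawFamily H P Q J (insert i S) = Function.update μ i P := by
      funext j
      rcases eq_or_ne j i with rfl | hj
      · simp [lawFamily, hi]
      · simp [lawFamily, hj, hμ]
    have e3 : μ = Function.update μ i Q := by
      funext j
      rcases eq_or_ne j i with rfl | hj
      · simp [lawFamily, hi, hiS, hμ]
      · simp [hj]
    have hu := hg.comp (measurable_update_prod (E := E) i)
    -- Condition on whether coordinate `i` of the mixture is drawn from `P` or from `Q`.
    have key : ∫ z, g z ∂Measure.pi (lawFamily H P Q (insert i J) S)
        = p * ∫ z, g z ∂Measure.pi (lawFamily H P Q J (insert i S))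
          + q * ∫ z, g z ∂Measure.pi μ := by
      rw [e1, e2]
      nth_rewrite 3 [e3]
      rw [integral_pi_update μ i H hg, integral_pi_update μ i P hg, integral_pi_update μ i Q hg]
      have : ∀ z, ∫ x, g (Function.update z i x) ∂H
          = p * ∫ x, g (Function.update z i x) ∂P + q * ∫ x, g (Function.update z i x) ∂Q := by
        intro z
        rw [hHd]
        exact integral_mixture hp hq (hu.comp (u := fun x => (z, x)) (by fun_prop))
      simp only [this]
      rw [integral_add (((hu.integral_right P).const_mul p).integrable _)
        (((hu.integral_right Q).const_mul q).integrable _), integral_const_mul,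
        integral_const_mul]
    have h1 := ih (insert i S) (Finset.disjoint_insert_right.2 ⟨hi, hJS⟩)
    have h2 := ih S hJS
    rw [Finset.card_insert_of_notMem hiS] at h1
    rw [Finset.card_insert_of_notMem hi, key]
    set G := ∫ z, g z ∂Measure.pi (lawFamily H P Q ∅ S₀)
    set A := ∫ z, g z ∂Measure.pi (lawFamily H P Q J (insert i S))
    set B := ∫ z, g z ∂Measure.pi μ
    have e4 : p * A + q * B - G = p * (A - G) + q * (B - G) := by
      linear_combination G * hpq
    rw [e4]
    refine (abs_add_le _ _).trans ?_
    rw [abs_mul, abs_mul, abs_of_nonneg hp, abs_of_nonneg hq]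
    refine (add_le_add (mul_le_mul_of_nonneg_left h1 hp)
      (mul_le_mul_of_nonneg_left h2 hq)).trans_eq ?_
    -- The quadratic in the bound is the second moment of |S| + Bin(|J|, p) - |S₀|, which satisfies
    -- this one-step recursion with equality.
    have hq' : q = 1 - p := by linarith
    subst hq'
    push_cast
    ring

end MeanComparison

/-! ### No nearly empty gaps in the law of a function with small differences. -/

section NonFlatness

variable {E : Type*} [MeasurableSpace E] {N : ℕ}

/-- A function on a product space with small fourth moments of its differences puts a
substantial mass on every gap between two substantial parts of its range. -/
lemma gap_mass_inequality (μ : Fin N → Measure E) [∀ i, IsProbabilityMeasure (μ i)]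
    {T : (Fin N → E) → ℝ} (hT : BddMeasurable T) {η : ℝ}
    (hη : ∑ i, ∫ z, ∫ x, (T z - T (Function.update z i x)) ^ 4 ∂μ i ∂Measure.pi μ ≤ η)
    {a b t : ℝ} (hab : a < b) (ht : 0 < t) :
    (Measure.pi μ).real {z | T z ≤ a} * (Measure.pi μ).real {z | b ≤ T z} * (b - a) ^ 2
      ≤ 1 / 2 * (t / 2 * η + N * (Measure.pi μ).real {z | a < T z ∧ T z < b} / t
        + η / (b - a) ^ 2) := by
  set π := Measure.pi μ
  have hba : 0 < b - a := sub_pos.2 hab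
  -- Truncation to [a, b]. Its variance is at least p₁ p₂ (b - a)², with p₁, p₂ the masses on the
  -- two sides, while resampling a coordinate changes it only if the gap is visited or jumped over.
  set f : (Fin N → E) → ℝ := fun z => max a (min (T z) b) with hfdef
  have hf : BddMeasurable f := by
    refine ⟨measurable_const.max (hT.meas.min measurable_const), |a| + |b|, fun z => ?_⟩
    have h1 : a ≤ f z := le_max_left _ _
    have h2 : f z ≤ b := max_le hab.le (min_le_right _ _)
    rw [abs_le]
    constructor <;> linarith [neg_abs_le a, le_abs_self b, abs_nonneg a, abs_nonneg b]
  have hA : MeasurableSet {z | T z ≤ a} := hT.meas measurableSet_Iic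
  have hB : MeasurableSet {z | b ≤ T z} := hT.meas measurableSet_Ici
  have hG : MeasurableSet {z | a < T z ∧ T z < b} := hT.meas measurableSet_Ioo
  set I : (Fin N → E) → ℝ := {z | a < T z ∧ T z < b}.indicator fun _ => (1 : ℝ) with hI
  have hIb : BddMeasurable I := BddMeasurable.indicator hG
  have hI0 : ∀ z, 0 ≤ I z := fun z => Set.indicator_nonneg (fun _ _ => zero_le_one) z
  have hIint : ∫ z, I z ∂π = π.real {z | a < T z ∧ T z < b} := by
    rw [hI, integral_indicator_const _ hG]
    simp
  -- lower bound
  set M := ∫ z, f z ∂π with hM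
  have hMa : a ≤ M := by
    calc a = ∫ _, a ∂π := by simp
      _ ≤ M := integral_mono (integrable_const _) (hf.integrable _) fun z => le_max_left _ _
  have hMb : M ≤ b := by
    calc M ≤ ∫ _, b ∂π := integral_mono (hf.integrable _) (integrable_const _)
          fun z => max_le hab.le (min_le_right _ _)
      _ = b := by simp
  have hlow : π.real {z | T z ≤ a} * (a - M) ^ 2 + π.real {z | b ≤ T z} * (b - M) ^ 2
      ≤ ∫ z, (f z - M) ^ 2 ∂π := by
    have hAi := BddMeasurable.indicator hA
    have hBi := BddMeasurable.indicator hB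
    have e : π.real {z | T z ≤ a} * (a - M) ^ 2 + π.real {z | b ≤ T z} * (b - M) ^ 2
        = ∫ z, ((a - M) ^ 2 * {z | T z ≤ a}.indicator (fun _ => (1 : ℝ)) z
          + (b - M) ^ 2 * {z | b ≤ T z}.indicator (fun _ => (1 : ℝ)) z) ∂π := by
      rw [integral_add ((hAi.const_mul _).integrable _) ((hBi.const_mul _).integrable _),
        integral_const_mul, integral_const_mul, integral_indicator_const _ hA,
        integral_indicator_const _ hB]
      simp [mul_comm]
    rw [e]
    refine integral_mono (((hAi.const_mul _).add (hBi.const_mul _)).integrable _)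
      (((hf.sub (BddMeasurable.const M)).pow 2).integrable _) fun z => ?_
    change (a - M) ^ 2 * _ + (b - M) ^ 2 * _ ≤ (f z - M) ^ 2
    by_cases h1 : T z ≤ a
    · have h2 : ¬ b ≤ T z := by linarith
      have h3 : f z = a := by
        simp only [hfdef]
        rw [min_eq_left (by linarith), max_eq_left h1]
      simp [h1, h2, h3]
    · by_cases h2 : b ≤ T z
      · have h3 : f z = b := by
          simp only [hfdef]
          rw [min_eq_right h2, max_eq_right hab.le]
        simp [h1, h2, h3]
      · simp [h1, h2, sq_nonneg]
  have hvar : ∫ z, (f z - M) ^ 2 ∂π = ∫ z, f z ^ 2 ∂π - M ^ 2 := by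
    have e : ∀ z, (f z - M) ^ 2 = f z ^ 2 - 2 * M * f z + M ^ 2 := fun z => by ring
    simp only [e]
    rw [integral_add, integral_sub, integral_const_mul, ← hM]
    · simp
      ring
    · exact (hf.pow 2).integrable _
    · exact (hf.const_mul _).integrable _
    · exact ((hf.pow 2).sub (hf.const_mul _)).integrable _
    · exact integrable_const _
  -- upper bound
  have hpt : ∀ u v : Fin N → E, (f u - f v) ^ 2
      ≤ (t / 2 + 1 / (b - a) ^ 2) * (T u - T v) ^ 4 + 1 / (2 * t) * I u + 1 / (2 * t) * I v := by
    intro u v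
    have hlip : (f u - f v) ^ 2 ≤ (T u - T v) ^ 2 := by
      rw [← sq_abs (f u - f v), ← sq_abs (T u - T v)]
      refine pow_le_pow_left₀ (abs_nonneg _) ?_ 2
      have h1 := abs_max_sub_max_le_max a (min (T u) b) a (min (T v) b)
      have h2 := abs_min_sub_min_le_max (T u) b (T v) b
      rw [sub_self, abs_zero, max_eq_right (abs_nonneg (min (T u) b - min (T v) b))] at h1
      rw [sub_self, abs_zero, max_eq_left (abs_nonneg (T u - T v))] at h2
      exact h1.trans h2
    -- If an endpoint lies in the gap, the squared increment is split into a fourth power and a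
    -- constant charged to the mass of the gap, with `t` balancing the two. Otherwise the increment
    -- of `f` vanishes or `T` jumps by at least b - a, and the fourth power alone pays.
    by_cases hin : I u = 1 ∨ I v = 1
    · have h1 : 1 ≤ I u + I v := by
        rcases hin with h | h <;> linarith [hI0 u, hI0 v]
      have h2 : (T u - T v) ^ 2 ≤ t / 2 * (T u - T v) ^ 4 + 1 / (2 * t) := by
        have e : t / 2 * (T u - T v) ^ 4 + 1 / (2 * t) - (T u - T v) ^ 2
            = (t * (T u - T v) ^ 2 - 1) ^ 2 / (2 * t) := by
          field_simp
          ring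
        have : 0 ≤ (t * (T u - T v) ^ 2 - 1) ^ 2 / (2 * t) := by positivity
        linarith
      have h3 : 0 ≤ 1 / (b - a) ^ 2 * (T u - T v) ^ 4 := by positivity
      have h4 : 1 / (2 * t) * 1 ≤ 1 / (2 * t) * (I u + I v) := by gcongr
      linarith
    · have hnot : ∀ w, I w ≠ 1 → T w ≤ a ∨ b ≤ T w := by
        intro w hw
        by_contra hcon
        push Not at hcon
        exact hw (Set.indicator_of_mem (s := {z | a < T z ∧ T z < b}) hcon _)
      push Not at hin
      have h4 : 0 ≤ t / 2 * (T u - T v) ^ 4 + 1 / (2 * t) * I u + 1 / (2 * t) * I v := by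
        have := hI0 u
        have := hI0 v
        positivity
      suffices h : (f u - f v) ^ 2 ≤ 1 / (b - a) ^ 2 * (T u - T v) ^ 4 by linarith
      have hfa : ∀ w, T w ≤ a → f w = a := fun w hw => by
        simp only [hfdef]
        rw [min_eq_left (by linarith), max_eq_left hw]
      have hfb : ∀ w, b ≤ T w → f w = b := fun w hw => by
        simp only [hfdef]
        rw [min_eq_right hw, max_eq_right hab.le]
      have hjump : ∀ x : ℝ, (b - a) ^ 2 ≤ x ^ 2 → (b - a) ^ 2 ≤ 1 / (b - a) ^ 2 * x ^ 4 := by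
        intro x hx
        rw [one_div, inv_mul_eq_div, le_div_iff₀ (by positivity)]
        nlinarith [sq_nonneg (b - a), sq_nonneg x]
      rcases hnot u hin.1 with hu | hu <;> rcases hnot v hin.2 with hv | hv
      · rw [hfa u hu, hfa v hv, sub_self]
        simp only [ne_eq, OfNat.ofNat_ne_zero, not_false_eq_true, zero_pow]
        positivity
      · rw [hfa u hu, hfb v hv]
        have := hjump (T u - T v) (by nlinarith)
        nlinarith
      · rw [hfb u hu, hfa v hv]
        exact hjump (T u - T v) (by nlinarith)
      · rw [hfb u hu, hfb v hv, sub_self]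
        simp only [ne_eq, OfNat.ofNat_ne_zero, not_false_eq_true, zero_pow]
        positivity
  have hup : ∀ i, ∫ z, ∫ x, (f z - f (Function.update z i x)) ^ 2 ∂μ i ∂π
      ≤ (t / 2 + 1 / (b - a) ^ 2) * ∫ z, ∫ x, (T z - T (Function.update z i x)) ^ 4 ∂μ i ∂π
        + 1 / t * ∫ z, I z ∂π := by
    intro i
    have hTu := hT.comp (measurable_update_prod (E := E) i)
    have hIu := hIb.comp (measurable_update_prod (E := E) i)
    have hfu := hf.comp (measurable_update_prod (E := E) i)
    have b1 : BddMeasurable fun p : (Fin N → E) × E =>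
        (f p.1 - f (Function.update p.1 i p.2)) ^ 2 := ((hf.comp measurable_fst).sub hfu).pow 2
    have b2 : BddMeasurable fun p : (Fin N → E) × E =>
        (T p.1 - T (Function.update p.1 i p.2)) ^ 4 := ((hT.comp measurable_fst).sub hTu).pow 4
    have b3 := (b2.const_mul (t / 2 + 1 / (b - a) ^ 2))
    have b4 : BddMeasurable fun p : (Fin N → E) × E => 1 / (2 * t) * I p.1 :=
      (hIb.comp measurable_fst).const_mul _
    have b5 := hIu.const_mul (1 / (2 * t))
    rw [← integral_prod _ (b1.integrable (π.prod (μ i))),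
      ← integral_prod _ (b2.integrable (π.prod (μ i)))]
    -- The resampled point has the same law as the original one, so both visits to the gap cost the
    -- same.
    have e1 : ∫ p, I (Function.update p.1 i p.2) ∂(π.prod (μ i)) = ∫ z, I z ∂π := by
      rw [integral_prod _ (hIu.integrable _)]
      exact integral_pi_resample μ i hIb
    have e2 : ∫ p : (Fin N → E) × E, I p.1 ∂(π.prod (μ i)) = ∫ z, I z ∂π := by
      rw [integral_prod _ ((hIb.comp measurable_fst).integrable _)]
      simp
    calc _ ≤ ∫ p : (Fin N → E) × E, ((t / 2 + 1 / (b - a) ^ 2)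
            * (T p.1 - T (Function.update p.1 i p.2)) ^ 4
            + 1 / (2 * t) * I p.1 + 1 / (2 * t) * I (Function.update p.1 i p.2))
            ∂(π.prod (μ i)) :=
          integral_mono (b1.integrable _) (((b3.add b4).add b5).integrable _)
            fun p => hpt p.1 (Function.update p.1 i p.2)
      _ = (t / 2 + 1 / (b - a) ^ 2) * ∫ p : (Fin N → E) × E,
            (T p.1 - T (Function.update p.1 i p.2)) ^ 4 ∂(π.prod (μ i))
          + 1 / (2 * t) * (∫ z, I z ∂π) + 1 / (2 * t) * ∫ z, I z ∂π := by
          rw [integral_add ((b3.add b4).integrable _) (b5.integrable _),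
            integral_add (b3.integrable _) (b4.integrable _), integral_const_mul,
            integral_const_mul, integral_const_mul, e1, e2]
      _ = _ := by
          field_simp
          ring
  have hES := efron_stein μ hf
  have hsum : ∑ i, ∫ z, ∫ x, (f z - f (Function.update z i x)) ^ 2 ∂μ i ∂π
      ≤ (t / 2 + 1 / (b - a) ^ 2) * η + N * (1 / t * ∫ z, I z ∂π) := by
    refine (Finset.sum_le_sum fun i _ => hup i).trans ?_
    rw [Finset.sum_add_distrib, ← Finset.mul_sum, Finset.sum_const, Finset.card_univ,
      Fintype.card_fin, nsmul_eq_mul]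
    gcongr
  have hp1 : 0 ≤ π.real {z | T z ≤ a} := measureReal_nonneg
  have hp2 : 0 ≤ π.real {z | b ≤ T z} := measureReal_nonneg
  have hp12 : π.real {z | T z ≤ a} + π.real {z | b ≤ T z} ≤ 1 := by
    rw [← measureReal_union _ hB]
    · exact measureReal_le_one
    · exact Set.disjoint_left.2 fun z h1 h2 => absurd (le_trans (show b ≤ T z from h2) h1)
        (not_le.2 hab)
  rw [← hIint]
  set p₁ := π.real {z | T z ≤ a}
  set p₂ := π.real {z | b ≤ T z}
  have halg : p₁ * p₂ * (b - a) ^ 2 ≤ p₁ * (a - M) ^ 2 + p₂ * (b - M) ^ 2 := by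
    have hs : 0 ≤ p₁ * (a - M) ^ 2 + p₂ * (b - M) ^ 2 := by positivity
    have h1 : (p₁ + p₂) * (p₁ * (a - M) ^ 2 + p₂ * (b - M) ^ 2)
        ≤ 1 * (p₁ * (a - M) ^ 2 + p₂ * (b - M) ^ 2) := mul_le_mul_of_nonneg_right hp12 hs
    have e : (p₁ + p₂) * (p₁ * (a - M) ^ 2 + p₂ * (b - M) ^ 2) - p₁ * p₂ * (b - a) ^ 2
        = (p₁ * (a - M) + p₂ * (b - M)) ^ 2 := by ring
    have := sq_nonneg (p₁ * (a - M) + p₂ * (b - M))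
    linarith
  calc _ ≤ _ := halg
    _ ≤ _ := hlow
    _ = _ := hvar
    _ ≤ _ := hES
    _ ≤ 1 / 2 * ((t / 2 + 1 / (b - a) ^ 2) * η + N * (1 / t * ∫ z, I z ∂π)) := by gcongr
    _ = _ := by ring

/-- Averaging over relabellings of the coordinates of an i.i.d. sample. -/
lemma sum_integral_update_eq_expect (H : Measure E) [IsProbabilityMeasure H]
    {T : (Fin N → E) → ℝ} (hT : BddMeasurable T) :
    ∑ i, ∫ z, ∫ x, (T z - T (Function.update z i x)) ^ 4 ∂H ∂Measure.pi (fun _ : Fin N => H)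
      = ∑ i, ∫ z, ∫ x, 𝔼 σ : Equiv.Perm (Fin N),
        (T (z ∘ σ) - T (Function.update z i x ∘ σ)) ^ 4 ∂H ∂Measure.pi (fun _ : Fin N => H) := by
  set π := Measure.pi fun _ : Fin N => H
  have hσm : ∀ σ : Equiv.Perm (Fin N), Measurable fun z : Fin N → E => z ∘ σ := fun σ =>
    measurable_pi_lambda _ fun i => measurable_pi_apply _
  have hb : ∀ (σ : Equiv.Perm (Fin N)) i, BddMeasurable fun p : (Fin N → E) × E =>
      (T (p.1 ∘ σ) - T (Function.update p.1 i p.2 ∘ σ)) ^ 4 := fun σ i =>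
    ((hT.comp ((hσm σ).comp measurable_fst)).sub
      (hT.comp ((hσm σ).comp (measurable_update_prod i)))).pow 4
  -- An i.i.d. law is invariant under σ and relabelling permutes the summands. This lets a
  -- permutation moment bound, valid for each fixed sample, control the sampling moments.
  have h1 : ∀ σ : Equiv.Perm (Fin N),
      ∑ i, ∫ z, ∫ x, (T z - T (Function.update z i x)) ^ 4 ∂H ∂π
        = ∑ i, ∫ z, ∫ x, (T (z ∘ σ) - T (Function.update z i x ∘ σ)) ^ 4 ∂H ∂π := by
    intro σ
    rw [← Equiv.sum_comp σ (fun i => ∫ z, ∫ x,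
      (T (z ∘ σ) - T (Function.update z i x ∘ σ)) ^ 4 ∂H ∂π)]
    refine Finset.sum_congr rfl fun i _ => ?_
    rw [← integral_pi_comp (fun _ => H) σ]
    simp only [Function.update_comp_eq_of_injective _ σ.injective]
    rfl
  have h2 : ∀ i, ∫ z, ∫ x, 𝔼 σ : Equiv.Perm (Fin N),
        (T (z ∘ σ) - T (Function.update z i x ∘ σ)) ^ 4 ∂H ∂π
      = 𝔼 σ : Equiv.Perm (Fin N),
        ∫ z, ∫ x, (T (z ∘ σ) - T (Function.update z i x ∘ σ)) ^ 4 ∂H ∂π := by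
    intro i
    simp only [Fintype.expect_eq_sum_div_card, integral_div]
    have : ∀ z, ∫ x, ∑ σ : Equiv.Perm (Fin N),
          (T (z ∘ σ) - T (Function.update z i x ∘ σ)) ^ 4 ∂H
        = ∑ σ : Equiv.Perm (Fin N),
          ∫ x, (T (z ∘ σ) - T (Function.update z i x ∘ σ)) ^ 4 ∂H := fun z =>
      integral_finsetSum _ fun σ _ =>
        ((hb σ i).comp (u := fun x => (z, x)) (by fun_prop)).integrable _
    simp only [this]
    rw [integral_finsetSum _ fun σ _ => ((hb σ i).integral_right H).integrable _]
  rw [Finset.sum_congr rfl fun i _ => h2 i, ← Finset.expect_sum_comm,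
    ← Fintype.expect_const (ι := Equiv.Perm (Fin N))
      (∑ i, ∫ z, ∫ x, (T z - T (Function.update z i x)) ^ 4 ∂H ∂π)]
  exact Finset.expect_congr rfl fun σ _ => h1 σ

end NonFlatness

end CvM

namespace CvM

open scoped BigOperators
open Finset (univ)

/-! ### Smooth approximations of indicator functions. -/

section SmoothStep

lemma taylor_bound {g : ℝ → ℝ} {K : ℝ} (hg : Differentiable ℝ g)
    (hK : ∀ x y, |deriv g y - deriv g x| ≤ K * |y - x|) (x y : ℝ) :
    |g y - g x - deriv g x * (y - x)| ≤ K * (y - x) ^ 2 := by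
  have hK0 : 0 ≤ K := by
    have := (abs_nonneg _).trans (hK 0 1)
    simpa using this
  have hd : ∀ u, HasDerivAt (fun u => g u - deriv g x * u) (deriv g u - deriv g x) u := by
    intro u
    have h := (hg u).hasDerivAt.sub ((hasDerivAt_id' u).const_mul (deriv g x))
    rw [mul_one] at h
    exact h
  have h := Convex.norm_image_sub_le_of_norm_deriv_le (f := fun u => g u - deriv g x * u)
    (s := Set.uIcc x y) (x := x) (y := y) (C := K * |y - x|)
    (fun u _ => (hd u).differentiableAt) (fun u hu => ?_) (convex_uIcc x y)
    Set.left_mem_uIcc Set.right_mem_uIcc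
  · rw [Real.norm_eq_abs, Real.norm_eq_abs, mul_assoc, abs_mul_abs_self] at h
    calc _ = |g y - deriv g x * y - (g x - deriv g x * x)| := by ring_nf
      _ ≤ _ := h
      _ = _ := by ring
  · rw [(hd u).deriv, Real.norm_eq_abs]
    exact (hK x u).trans (mul_le_mul_of_nonneg_left (Set.abs_sub_left_of_mem_uIcc hu) hK0)

/-- The derivative vanishes outside [0, 1], so it and its own derivative are continuous with compact
support, hence bounded. -/
lemma exists_deriv_smoothTransition_bound :
    ∃ K : ℝ, (∀ x, |deriv Real.smoothTransition x| ≤ K) ∧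
      ∀ x y, |deriv Real.smoothTransition y - deriv Real.smoothTransition x| ≤ K * |y - x| := by
  have h2 : ContDiff ℝ 2 Real.smoothTransition := Real.smoothTransition.contDiff (n := 2)
  have h1 : ContDiff ℝ 1 (deriv Real.smoothTransition) := by
    have := (contDiff_succ_iff_deriv (n := 1)).1 h2
    exact this.2.2
  have hz : ∀ x, x ∉ Set.Icc (0 : ℝ) 1 → deriv Real.smoothTransition x = 0 := by
    intro x hx
    rcases not_and_or.1 hx with h | h
    · have : Real.smoothTransition =ᶠ[𝓝 x] fun _ => (0 : ℝ) := by
        filter_upwards [Iio_mem_nhds (not_le.1 h)] with y hy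
        exact Real.smoothTransition.zero_of_nonpos (le_of_lt hy)
      rw [this.deriv_eq, deriv_const]
    · have : Real.smoothTransition =ᶠ[𝓝 x] fun _ => (1 : ℝ) := by
        filter_upwards [Ioi_mem_nhds (not_le.1 h)] with y hy
        exact Real.smoothTransition.one_of_one_le (le_of_lt hy)
      rw [this.deriv_eq, deriv_const]
  have hc : HasCompactSupport (deriv Real.smoothTransition) :=
    HasCompactSupport.intro isCompact_Icc hz
  obtain ⟨C₁, hC₁⟩ := h1.continuous.bounded_above_of_compact_support hc
  obtain ⟨C₂, hC₂⟩ := (h1.continuous_deriv le_rfl).bounded_above_of_compact_support hc.deriv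
  refine ⟨max C₁ C₂, fun x => (hC₁ x).trans (le_max_left _ _), fun x y => ?_⟩
  have := Convex.norm_image_sub_le_of_norm_deriv_le (f := deriv Real.smoothTransition)
    (s := Set.univ) (x := x) (y := y) (C := max C₁ C₂)
    (fun u _ => (h1.differentiable one_ne_zero) u)
    (fun u _ => (hC₂ u).trans (le_max_right _ _)) convex_univ trivial trivial
  simpa [Real.norm_eq_abs] using this

/-- A function with a bounded Lipschitz derivative, and the corresponding Taylor bound. -/
structure SmoothBound (f : ℝ → ℝ) (K : ℝ) : Prop where
  bound : ∀ x, |deriv f x| ≤ K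
  lip : ∀ x y, |deriv f y - deriv f x| ≤ K * |y - x|
  taylor : ∀ x y, |f y - f x - deriv f x * (y - x)| ≤ K * (y - x) ^ 2

/-- The smooth step that equals `1` up to `c` and `0` from `c + ε` on. -/
noncomputable def smoothStep (c ε t : ℝ) : ℝ := Real.smoothTransition ((c + ε - t) / ε)

lemma smoothStep_eq_one {c ε t : ℝ} (hε : 0 < ε) (ht : t ≤ c) : smoothStep c ε t = 1 :=
  Real.smoothTransition.one_of_one_le (by rw [le_div_iff₀ hε]; linarith)

lemma smoothStep_eq_zero {c ε t : ℝ} (hε : 0 < ε) (ht : c + ε ≤ t) : smoothStep c ε t = 0 :=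
  Real.smoothTransition.zero_of_nonpos (div_nonpos_of_nonpos_of_nonneg (by linarith) hε.le)

lemma smoothStep_nonneg (c ε t : ℝ) : 0 ≤ smoothStep c ε t := Real.smoothTransition.nonneg _

lemma smoothStep_le_one (c ε t : ℝ) : smoothStep c ε t ≤ 1 := Real.smoothTransition.le_one _

lemma bddMeasurable_smoothStep (c ε : ℝ) : BddMeasurable (smoothStep c ε) := by
  refine ⟨?_, 1, fun t => ?_⟩
  · unfold smoothStep
    have : Continuous Real.smoothTransition := Real.smoothTransition.continuous
    exact (this.comp (by fun_prop)).measurable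
  · rw [abs_of_nonneg (smoothStep_nonneg _ _ _)]
    exact smoothStep_le_one _ _ _

/-- The constant depends only on the width `ε`. Uniformity in `c` and in the shift `s` means that
neither the oracle quantile nor `constCoef` has to be bounded as N grows. -/
lemma exists_smoothBound_smoothStep {ε : ℝ} (hε : 0 < ε) :
    ∃ K, 0 ≤ K ∧ ∀ c s, SmoothBound (fun t => smoothStep c ε (s + t)) K := by
  obtain ⟨K, hK1, hK2⟩ := exists_deriv_smoothTransition_bound
  have hK0 : 0 ≤ K := (abs_nonneg _).trans (hK1 0)
  have hdiff : Differentiable ℝ Real.smoothTransition :=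
    (Real.smoothTransition.contDiff (n := 1)).differentiable one_ne_zero
  refine ⟨K / ε + K / ε ^ 2, by positivity, fun c s => ?_⟩
  have hd : ∀ t, HasDerivAt (fun t => smoothStep c ε (s + t))
      (deriv Real.smoothTransition ((c + ε - (s + t)) / ε) * (-1 / ε)) t := by
    intro t
    have h1 : HasDerivAt (fun t => (c + ε - (s + t)) / ε) (-1 / ε) t := by
      have := (((hasDerivAt_id t).const_add s).const_sub (c + ε)).div_const ε
      simpa using this
    exact (hdiff _).hasDerivAt.comp t h1
  have hde : deriv (fun t => smoothStep c ε (s + t))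
      = fun t => deriv Real.smoothTransition ((c + ε - (s + t)) / ε) * (-1 / ε) :=
    funext fun t => (hd t).deriv
  have h1 : |(-1 : ℝ) / ε| = 1 / ε := by rw [abs_div, abs_neg, abs_one, abs_of_pos hε]
  have hlip : ∀ x y, |deriv (fun t => smoothStep c ε (s + t)) y
      - deriv (fun t => smoothStep c ε (s + t)) x| ≤ (K / ε + K / ε ^ 2) * |y - x| := by
    intro x y
    rw [hde]
    simp only [← sub_mul]
    rw [abs_mul, h1]
    have h2 := hK2 ((c + ε - (s + x)) / ε) ((c + ε - (s + y)) / ε)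
    have h3 : (c + ε - (s + y)) / ε - (c + ε - (s + x)) / ε = (x - y) / ε := by ring
    rw [h3, abs_div, abs_of_pos hε, abs_sub_comm x y] at h2
    calc _ ≤ K * (|y - x| / ε) * (1 / ε) := by gcongr
      _ = K / ε ^ 2 * |y - x| := by field_simp
      _ ≤ _ := by
        gcongr
        have : 0 ≤ K / ε := by positivity
        linarith
  refine ⟨fun x => ?_, hlip, taylor_bound (fun t => (hd t).differentiableAt) hlip⟩
  rw [hde]
  simp only
  rw [abs_mul, h1]
  calc _ ≤ K * (1 / ε) := by gcongr; exact hK1 _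
    _ ≤ _ := by
      have : 0 ≤ K / ε ^ 2 := by positivity
      rw [mul_one_div]
      linarith

end SmoothStep

/-! ### Quantiles as infima of level sets. -/

section Quantile

variable {G : ℝ → ℝ} {β t : ℝ}

lemma sInf_level_le (hG : Monotone G) (hlo : ∃ s, G s < β) (ht : β ≤ G t) :
    sInf {s | β ≤ G s} ≤ t := by
  obtain ⟨s, hs⟩ := hlo
  refine csInf_le ⟨s, fun u hu => ?_⟩ ht
  by_contra h
  exact absurd (hu.trans (hG (not_le.1 h).le)) (not_le.2 hs)

lemma le_sInf_level (hG : Monotone G) (hhi : ∃ s, β ≤ G s) (ht : G t < β) :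
    t ≤ sInf {s | β ≤ G s} := by
  refine le_csInf hhi fun u hu => ?_
  by_contra h
  exact absurd (le_trans hu (hG (not_le.1 h).le)) (not_le.2 ht)

lemma le_of_sInf_level_lt (hG : Monotone G) (hhi : ∃ s, β ≤ G s)
    (ht : sInf {s | β ≤ G s} < t) : β ≤ G t := by
  obtain ⟨s, hs, hst⟩ := exists_lt_of_csInf_lt hhi ht
  exact le_trans hs (hG hst.le)

lemma lt_of_lt_sInf_level (hG : Monotone G) (hlo : ∃ s, G s < β)
    (ht : t < sInf {s | β ≤ G s}) : G t < β := by
  by_contra h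
  exact absurd (sInf_level_le hG hlo (not_lt.1 h)) (not_le.2 ht)

end Quantile

/-! ### The general estimates applied to the statistic. -/

section Statistic

variable {d m n : ℕ}

lemma bddMeasurable_polyStat : BddMeasurable (polyStat (d := d) m n) := by
  have hT : ∀ i j k, BddMeasurable fun z : Fin (m + n) → EuclideanSpace ℝ (Fin d) =>
      angleTriple z i j k := by
    intro i j k
    refine ⟨?_, 1, fun z => abs_le_one_of_mem (angleTriple_mem z i j k)⟩
    unfold angleTriple
    split_ifs
    · exact measurable_angleKernel.comp (f := fun z : Fin (m + n) → EuclideanSpace ℝ (Fin d) =>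
        (z i, z j, z k)) (by fun_prop)
    · exact measurable_const
  have hM : ∀ i j, BddMeasurable fun z : Fin (m + n) → EuclideanSpace ℝ (Fin d) =>
      angleMatrix z i j := by
    intro i j
    have := (BddMeasurable.sum univ (hT i j)).const_mul ((Fintype.card (Fin (m + n)) : ℝ)⁻¹)
    simpa only [angleMatrix, div_eq_inv_mul] using this
  have hr : ∀ i, BddMeasurable fun z : Fin (m + n) → EuclideanSpace ℝ (Fin d) =>
      angleRow z i := by
    intro i
    have := (BddMeasurable.sum univ (hM i)).const_mul ((Fintype.card (Fin (m + n)) : ℝ)⁻¹)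
    simpa only [angleRow, div_eq_inv_mul] using this
  unfold polyStat permStat permQuadratic permLinear
  refine (BddMeasurable.const _).add (BddMeasurable.add (BddMeasurable.const_mul _ ?_)
    (BddMeasurable.const_mul _ ?_))
  · exact BddMeasurable.sum _ fun i => BddMeasurable.const_mul _
      (BddMeasurable.sum _ fun j => (hM i j).const_mul _)
  · exact BddMeasurable.sum _ fun i => (hr i).const_mul _

/-- The average of `f (T (z ∘ σ))` over all permutations `σ`. -/
noncomputable def permMean (m n : ℕ) (f : ℝ → ℝ) (z : Fin (m + n) → EuclideanSpace ℝ (Fin d)) :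
    ℝ :=
  𝔼 σ : Equiv.Perm (Fin (m + n)), f (polyStat m n (z ∘ σ))

lemma measurable_comp_perm {N : ℕ} {E : Type*} [MeasurableSpace E] (σ : Equiv.Perm (Fin N)) :
    Measurable fun z : Fin N → E => z ∘ σ :=
  measurable_pi_lambda _ fun _ => measurable_pi_apply _

lemma bddMeasurable_permMean {f : ℝ → ℝ} (hf : BddMeasurable f) :
    BddMeasurable (permMean (d := d) m n f) :=
  BddMeasurable.expect fun σ =>
    hf.comp (bddMeasurable_polyStat.meas.comp (measurable_comp_perm σ))

lemma permMean_comp (f : ℝ → ℝ) (z : Fin (m + n) → EuclideanSpace ℝ (Fin d))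
    (τ : Equiv.Perm (Fin (m + n))) : permMean m n f (z ∘ τ) = permMean m n f z :=
  Fintype.expect_equiv (Equiv.mulLeft τ) _ _ fun _ => rfl

/-- Exchangeability: under an i.i.d. law every permuted statistic has the same distribution. -/
lemma integral_permMean (H : Measure (EuclideanSpace ℝ (Fin d))) [IsProbabilityMeasure H]
    {f : ℝ → ℝ} (hf : BddMeasurable f) :
    ∫ z, permMean m n f z ∂Measure.pi (fun _ : Fin (m + n) => H)
      = ∫ z, f (polyStat m n z) ∂Measure.pi (fun _ : Fin (m + n) => H) := by
  have hb : ∀ σ : Equiv.Perm (Fin (m + n)), BddMeasurable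
      fun z : Fin (m + n) → EuclideanSpace ℝ (Fin d) => f (polyStat m n (z ∘ σ)) := fun σ =>
    hf.comp (bddMeasurable_polyStat.meas.comp (measurable_comp_perm σ))
  unfold permMean
  simp only [Fintype.expect_eq_sum_div_card, integral_div]
  rw [integral_finsetSum _ fun σ _ => (hb σ).integrable _, ← Fintype.expect_eq_sum_div_card,
    ← Fintype.expect_const (ι := Equiv.Perm (Fin (m + n)))
      (∫ z, f (polyStat m n z) ∂Measure.pi (fun _ : Fin (m + n) => H))]
  exact Finset.expect_congr rfl fun σ _ =>
    integral_pi_comp (fun _ => H) σ fun z => f (polyStat m n z)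

variable {c : ℝ}

lemma abs_permMean_update_sub_le (hκ : |quadCoef m n| ≤ c) (hl : |linCoef m n| ≤ c) {f : ℝ → ℝ}
    {K : ℝ} (hf : ∀ s, SmoothBound (fun t => f (s + t)) K)
    (z : Fin (m + n) → EuclideanSpace ℝ (Fin d)) (i : Fin (m + n))
    (x : EuclideanSpace ℝ (Fin d)) :
    |permMean m n f (Function.update z i x) - permMean m n f z|
      ≤ K * (60000 * c ^ 4 + 1584 * c ^ 3 + 248 * c + 1) / ((m + n : ℕ) : ℝ) := by
  have hpert := rowPerturbation_angle z (Function.update z i x) i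
    fun j hj => Function.update_of_ne hj _ _
  have h := hpert.abs_expect_comp_sub_le hκ hl sum_groupWeight abs_groupWeight_le
    (fun j k => abs_le_one_of_mem (angleMatrix_mem z j k))
    (fun j => abs_le_one_of_mem (angleRow_mem z j))
    (hf (constCoef m n)).bound (hf (constCoef m n)).lip (hf (constCoef m n)).taylor
  rw [Fintype.card_fin] at h
  have e : ∀ w : Fin (m + n) → EuclideanSpace ℝ (Fin d), permMean m n f w
      = 𝔼 σ, f (constCoef m n + permStat (quadCoef m n) (linCoef m n) (groupWeight m n)
        (angleMatrix w) (angleRow w) σ) := by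
    intro w
    unfold permMean
    simp only [polyStat_comp]
    exact Fintype.expect_equiv (Equiv.inv _) _ _ fun _ => rfl
  rw [e, e]
  exact h

lemma sum_integral_polyStat_update_le (hκ : |quadCoef m n| ≤ c) (hl : |linCoef m n| ≤ c)
    (H : Measure (EuclideanSpace ℝ (Fin d))) [IsProbabilityMeasure H] (hN : 0 < m + n) :
    ∑ i, ∫ z, ∫ x, (polyStat m n z - polyStat m n (Function.update z i x)) ^ 4
      ∂H ∂Measure.pi (fun _ : Fin (m + n) => H) ≤ 120000 * c ^ 4 / ((m + n : ℕ) : ℝ) := by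
  have hN' : (0 : ℝ) < ((m + n : ℕ) : ℝ) := Nat.cast_pos.2 hN
  have key : ∀ (z : Fin (m + n) → EuclideanSpace ℝ (Fin d)) i x,
      𝔼 σ : Equiv.Perm (Fin (m + n)), (polyStat m n (z ∘ σ)
        - polyStat m n (Function.update z i x ∘ σ)) ^ 4
        ≤ 120000 * c ^ 4 / ((m + n : ℕ) : ℝ) ^ 2 := by
    intro z i x
    have hpert := rowPerturbation_angle z (Function.update z i x) i
      fun j hj => Function.update_of_ne hj _ _
    have h := hpert.expect_sub_pow_four_le hκ hl sum_groupWeight abs_groupWeight_le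
    rw [Fintype.card_fin] at h
    refine le_of_eq_of_le (Fintype.expect_equiv (Equiv.inv _) _ _ fun σ => ?_) h
    rw [polyStat_comp, polyStat_comp, Equiv.inv_apply]
    ring
  rw [sum_integral_update_eq_expect H bddMeasurable_polyStat]
  have hb : ∀ i, BddMeasurable fun p : (Fin (m + n) → EuclideanSpace ℝ (Fin d)) ×
      EuclideanSpace ℝ (Fin d) => 𝔼 σ : Equiv.Perm (Fin (m + n)), (polyStat m n (p.1 ∘ σ)
        - polyStat m n (Function.update p.1 i p.2 ∘ σ)) ^ 4 := fun i =>
    BddMeasurable.expect fun σ => BddMeasurable.pow (BddMeasurable.sub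
      (bddMeasurable_polyStat.comp ((measurable_comp_perm σ).comp measurable_fst))
      (bddMeasurable_polyStat.comp ((measurable_comp_perm σ).comp (measurable_update_prod i)))) 4
  have h2 : ∀ i, ∫ z, ∫ x, 𝔼 σ : Equiv.Perm (Fin (m + n)), (polyStat m n (z ∘ σ)
        - polyStat m n (Function.update z i x ∘ σ)) ^ 4 ∂H
        ∂Measure.pi (fun _ : Fin (m + n) => H)
      ≤ 120000 * c ^ 4 / ((m + n : ℕ) : ℝ) ^ 2 := by
    intro i
    have h3 : ∀ z, ∫ x, 𝔼 σ : Equiv.Perm (Fin (m + n)), (polyStat m n (z ∘ σ)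
        - polyStat m n (Function.update z i x ∘ σ)) ^ 4 ∂H
      ≤ 120000 * c ^ 4 / ((m + n : ℕ) : ℝ) ^ 2 := fun z =>
      (integral_mono (((hb i).comp (u := fun x => (z, x)) (by fun_prop)).integrable H)
        (integrable_const _) fun x => key z i x).trans_eq (by simp)
    exact (integral_mono (((hb i).integral_right H).integrable _) (integrable_const _)
      h3).trans_eq (by simp)
  refine (Finset.sum_le_card_nsmul _ _ _ fun i _ => h2 i).trans_eq ?_
  rw [Finset.card_univ, Fintype.card_fin, nsmul_eq_mul]
  field_simp

/-- The law of the statistic under an i.i.d. sample has no nearly empty gaps. -/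
lemma exists_gap_mass {c g a' : ℝ} (hg : 0 < g) (ha : 0 < a') :
    ∃ ρ N₀ : ℝ, 0 < ρ ∧ ∀ (d m n : ℕ) (H : Measure (EuclideanSpace ℝ (Fin d))),
      IsProbabilityMeasure H → |quadCoef m n| ≤ c → |linCoef m n| ≤ c →
      0 < m + n → N₀ ≤ ((m + n : ℕ) : ℝ) → ∀ a : ℝ,
      a' ≤ (Measure.pi fun _ : Fin (m + n) => H).real {z | polyStat m n z ≤ a} →
      a' ≤ (Measure.pi fun _ : Fin (m + n) => H).real {z | a + g ≤ polyStat m n z} →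
      ρ ≤ (Measure.pi fun _ : Fin (m + n) => H).real
        {z | a < polyStat m n z ∧ polyStat m n z < a + g} := by
  set A : ℝ := 120000 * c ^ 4 with hA
  have hA0 : 0 ≤ A := by positivity
  set Δ : ℝ := a' ^ 2 * g ^ 2 with hΔ
  have hΔ0 : 0 < Δ := by positivity
  -- With η = A/N and t = Ns, the gap inequality has the terms sA/2, r/s and A/(N g²). This `s`
  -- makes the first at most Δ/2 and the threshold on N does the same for the last, leaving Δ ≤ r/s.
  set s : ℝ := Δ / (A + 1) with hs
  have hs0 : 0 < s := by positivity
  refine ⟨s * Δ, 2 * A / (Δ * g ^ 2), by positivity, ?_⟩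
  intro d m n H hH hκ hl hN hN₀ a h1 h2
  have hN' : (0 : ℝ) < ((m + n : ℕ) : ℝ) := Nat.cast_pos.2 hN
  have key := gap_mass_inequality (fun _ : Fin (m + n) => H) (bddMeasurable_polyStat (d := d))
    (sum_integral_polyStat_update_le hκ hl H hN) (a := a) (b := a + g)
    (t := ((m + n : ℕ) : ℝ) * s) (by linarith) (by positivity)
  rw [add_sub_cancel_left, ← hA] at key
  set N : ℝ := ((m + n : ℕ) : ℝ)
  set r := (Measure.pi fun _ : Fin (m + n) => H).real
        {z | a < polyStat m n z ∧ polyStat m n z < a + g}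
  have h3 : Δ ≤ (Measure.pi fun _ : Fin (m + n) => H).real {z | polyStat m n z ≤ a}
      * (Measure.pi fun _ : Fin (m + n) => H).real {z | a + g ≤ polyStat m n z} * g ^ 2 := by
    rw [hΔ, sq a']
    gcongr
  have h4 : N * s / 2 * (A / N) + N * r / (N * s) + A / N / g ^ 2
      = s * A / 2 + r / s + A / (N * g ^ 2) := by
    field_simp
  rw [h4] at key
  have h5 : s * A ≤ Δ := by
    rw [hs, div_mul_eq_mul_div, div_le_iff₀ (by positivity)]
    nlinarith
  have h6 : A / (N * g ^ 2) ≤ Δ / 2 := by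
    rw [div_le_iff₀ (by positivity)] at hN₀ ⊢
    nlinarith
  have h7 : Δ ≤ r / s := by linarith
  rw [le_div_iff₀ hs0] at h7
  linarith

end Statistic

end CvM

namespace CvM

open scoped BigOperators
open Finset (univ)

/-! ### Critical values and the increase of the oracle distribution function at its quantile. -/

section CriticalValues

variable {d m n : ℕ}

/-- The distribution function of the permutation distribution of the statistic. -/
noncomputable def permCdf (m n : ℕ) (z : Fin (m + n) → EuclideanSpace ℝ (Fin d)) (t : ℝ) : ℝ :=
  permMean m n ((Set.Iic t).indicator fun _ => (1 : ℝ)) z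

lemma permutationCriticalValue_eq (α : ℝ) (hm : 2 ≤ m) (hn : 2 ≤ n)
    {z : Fin (m + n) → EuclideanSpace ℝ (Fin d)} (hz : Function.Injective z) :
    permutationCriticalValue α (scaledStat m n) z = sInf {t | 1 - α ≤ permCdf m n z t} := by
  unfold permutationCriticalValue
  congr 1
  ext t
  simp only [Set.mem_ofPred_eq, permCdf, permMean, Fintype.expect_eq_sum_div_card,
    Fintype.card_perm, Fintype.card_fin]
  rw [one_div, inv_mul_eq_div]
  have : ∀ σ : Equiv.Perm (Fin (m + n)), (Set.Iic t).indicator (fun _ => (1 : ℝ))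
      (polyStat m n (z ∘ σ)) = if scaledStat m n (fun i => z (σ i)) ≤ t then 1 else 0 := by
    intro σ
    rw [← scaledStat_eq_polyStat hm hn (hz.comp σ.injective)]
    rfl
  simp only [this]

/-- Resampling coordinate `i` independently of coordinate `j` turns a tie into an atom of `μ i`. -/
lemma ae_injective {N : ℕ} (μ : Fin N → Measure (EuclideanSpace ℝ (Fin d)))
    [∀ i, IsProbabilityMeasure (μ i)] (hμ : ∀ i x, μ i {x} = 0) :
    ∀ᵐ z ∂Measure.pi μ, Function.Injective z := by
  have h : ∀ i j : Fin N, i ≠ j → ∀ᵐ z ∂Measure.pi μ, z i ≠ z j := by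
    intro i j hij
    have hS : MeasurableSet {z : Fin N → EuclideanSpace ℝ (Fin d) | z i = z j} :=
      measurableSet_eq_fun (measurable_pi_apply i) (measurable_pi_apply j)
    have hp := measurePreserving_update μ i (μ i)
    rw [Function.update_eq_self] at hp
    have h0 : Measure.pi μ {z | z i = z j} = 0 := by
      rw [← hp.measure_preimage hS.nullMeasurableSet,
        Measure.measure_prod_null (hp.measurable hS)]
      refine ae_of_all _ fun z => ?_
      refine measure_mono_null ?_ (hμ i (z j))
      intro x hx
      simpa [hij.symm] using hx
    rw [ae_iff]
    simpa using h0
  have h2 : ∀ᵐ z ∂Measure.pi μ, ∀ i j : Fin N, i ≠ j → z i ≠ z j := by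
    rw [ae_all_iff]
    intro i
    rw [ae_all_iff]
    intro j
    by_cases hij : i = j
    · exact ae_of_all _ fun z hne => absurd hij hne
    · filter_upwards [h i j hij] with z hz _ using hz
  filter_upwards [h2] with z hz i j hij
  by_contra hne
  exact hz i j hne hij

/-- The distribution function of the statistic for an i.i.d. sample. -/
noncomputable def oracleCdf (m n : ℕ) (H : Measure (EuclideanSpace ℝ (Fin d))) (t : ℝ) : ℝ :=
  (Measure.pi fun _ : Fin (m + n) => H).real {z | polyStat m n z ≤ t}

lemma oracleCriticalValue_eq (α : ℝ) (hm : 2 ≤ m) (hn : 2 ≤ n)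
    (H : Measure (EuclideanSpace ℝ (Fin d))) [IsProbabilityMeasure H] (hH : ∀ x, H {x} = 0) :
    oracleCriticalValue α (scaledStat m n) H = sInf {t | 1 - α ≤ oracleCdf m n H t} := by
  unfold oracleCriticalValue oracleCdf
  have : ∀ t, (Measure.pi fun _ : Fin (m + n) => H).real {z | scaledStat m n z ≤ t}
      = (Measure.pi fun _ : Fin (m + n) => H).real {z | polyStat m n z ≤ t} := by
    intro t
    refine measureReal_congr ?_
    filter_upwards [ae_injective (fun _ : Fin (m + n) => H) fun _ => hH] with z hz
    exact congrArg (· ≤ t) (scaledStat_eq_polyStat hm hn hz)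
  simp only [this]

lemma permMean_mono {f g : ℝ → ℝ} (h : ∀ t, f t ≤ g t)
    (z : Fin (m + n) → EuclideanSpace ℝ (Fin d)) : permMean m n f z ≤ permMean m n g z :=
  expect_mono fun _ => h _

lemma permCdf_mono (z : Fin (m + n) → EuclideanSpace ℝ (Fin d)) : Monotone (permCdf m n z) :=
  fun _ _ hst => permMean_mono (fun _ =>
    Set.indicator_le_indicator_of_subset (Set.Iic_subset_Iic.2 hst) (fun _ => zero_le_one) _) z

lemma oracleCdf_mono (H : Measure (EuclideanSpace ℝ (Fin d))) [IsProbabilityMeasure H] :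
    Monotone (oracleCdf m n H) :=
  fun _ _ hst => measureReal_mono fun _ hz => le_trans hz hst

lemma smoothStep_le_indicator {c ε : ℝ} (hε : 0 < ε) (t : ℝ) :
    smoothStep c ε t ≤ (Set.Iic (c + ε)).indicator (fun _ => (1 : ℝ)) t := by
  by_cases h : t ≤ c + ε
  · rw [Set.indicator_of_mem (Set.mem_Iic.2 h)]
    exact smoothStep_le_one _ _ _
  · rw [smoothStep_eq_zero hε (not_le.1 h).le]
    exact Set.indicator_nonneg (fun _ _ => zero_le_one) _

lemma indicator_le_smoothStep {c ε : ℝ} (hε : 0 < ε) (t : ℝ) :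
    (Set.Iic c).indicator (fun _ => (1 : ℝ)) t ≤ smoothStep c ε t := by
  by_cases h : t ≤ c
  · rw [smoothStep_eq_one hε h]
    exact Set.indicator_le_self' (fun _ _ => zero_le_one) _
  · rw [Set.indicator_of_notMem (by simpa using h)]
    exact smoothStep_nonneg _ _ _

lemma integral_indicator_polyStat (H : Measure (EuclideanSpace ℝ (Fin d)))
    [IsProbabilityMeasure H] (t : ℝ) :
    ∫ z, (Set.Iic t).indicator (fun _ => (1 : ℝ)) (polyStat m n z)
      ∂Measure.pi (fun _ : Fin (m + n) => H) = oracleCdf m n H t := by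
  have h : MeasurableSet {z : Fin (m + n) → EuclideanSpace ℝ (Fin d) | polyStat m n z ≤ t} :=
    bddMeasurable_polyStat.meas measurableSet_Iic
  have := integral_indicator_const (μ := Measure.pi fun _ : Fin (m + n) => H) (1 : ℝ) h
  rw [smul_eq_mul, mul_one] at this
  exact this

lemma oracleCdf_le_integral_permMean (H : Measure (EuclideanSpace ℝ (Fin d)))
    [IsProbabilityMeasure H] {c ε : ℝ} (hε : 0 < ε) :
    oracleCdf m n H c
      ≤ ∫ z, permMean m n (smoothStep c ε) z ∂Measure.pi (fun _ : Fin (m + n) => H) := by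
  rw [integral_permMean H (bddMeasurable_smoothStep c ε), ← integral_indicator_polyStat]
  exact integral_mono
    (((BddMeasurable.indicator measurableSet_Iic).comp bddMeasurable_polyStat.meas).integrable _)
    (((bddMeasurable_smoothStep c ε).comp bddMeasurable_polyStat.meas).integrable _)
    fun z => indicator_le_smoothStep hε _

lemma integral_permMean_le_oracleCdf (H : Measure (EuclideanSpace ℝ (Fin d)))
    [IsProbabilityMeasure H] {c ε : ℝ} (hε : 0 < ε) :
    ∫ z, permMean m n (smoothStep c ε) z ∂Measure.pi (fun _ : Fin (m + n) => H)
      ≤ oracleCdf m n H (c + ε) := by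
  rw [integral_permMean H (bddMeasurable_smoothStep c ε), ← integral_indicator_polyStat]
  exact integral_mono
    (((bddMeasurable_smoothStep c ε).comp bddMeasurable_polyStat.meas).integrable _)
    (((BddMeasurable.indicator measurableSet_Iic).comp bddMeasurable_polyStat.meas).integrable _)
    fun z => smoothStep_le_indicator hε _

lemma exists_oracleCdf_level (H : Measure (EuclideanSpace ℝ (Fin d))) [IsProbabilityMeasure H] :
    ∃ C, oracleCdf m n H C = 1 ∧ oracleCdf m n H (-C - 1) = 0 := by
  obtain ⟨C, hC⟩ := (bddMeasurable_polyStat (d := d) (m := m) (n := n)).bdd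
  refine ⟨C, ?_, ?_⟩
  · have : {z : Fin (m + n) → EuclideanSpace ℝ (Fin d) | polyStat m n z ≤ C} = Set.univ :=
      Set.eq_univ_of_forall fun z => (le_abs_self _).trans (hC z)
    simp [oracleCdf, this]
  · have : {z : Fin (m + n) → EuclideanSpace ℝ (Fin d) | polyStat m n z ≤ -C - 1} = ∅ :=
      Set.eq_empty_of_forall_notMem fun z hz => by
        have h1 := neg_abs_le (polyStat m n z)
        have h2 := hC z
        have h3 : polyStat m n z ≤ -C - 1 := hz
        linarith
    simp [oracleCdf, this]

lemma exists_permCdf_level (z : Fin (m + n) → EuclideanSpace ℝ (Fin d)) :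
    ∃ C, permCdf m n z C = 1 ∧ permCdf m n z (-C - 1) = 0 := by
  obtain ⟨C, hC⟩ := (bddMeasurable_polyStat (d := d) (m := m) (n := n)).bdd
  refine ⟨C, ?_, ?_⟩
  · have h : ∀ σ : Equiv.Perm (Fin (m + n)),
        (Set.Iic C).indicator (fun _ => (1 : ℝ)) (polyStat m n (z ∘ σ)) = 1 := fun σ =>
      Set.indicator_of_mem (Set.mem_Iic.2 ((le_abs_self _).trans (hC (z ∘ σ)))) _
    simp only [permCdf, permMean, h]
    exact Fintype.expect_const (1 : ℝ)
  · refine Finset.expect_eq_zero fun σ _ => Set.indicator_of_notMem (fun hz => ?_) _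
    have h1 := neg_abs_le (polyStat m n (z ∘ σ))
    have h2 := hC (z ∘ σ)
    have h3 : polyStat m n (z ∘ σ) ≤ -C - 1 := hz
    linarith

/-- Around its quantile the distribution function of the statistic increases substantially. -/
lemma exists_quantile_increase {α c g : ℝ} (hα : α ∈ Set.Ioo (0 : ℝ) 1) (hg : 0 < g) :
    ∃ ρ N₀ : ℝ, 0 < ρ ∧ ∀ (d m n : ℕ) (H : Measure (EuclideanSpace ℝ (Fin d))),
      IsProbabilityMeasure H → |quadCoef m n| ≤ c → |linCoef m n| ≤ c →
      0 < m + n → N₀ ≤ ((m + n : ℕ) : ℝ) →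
      1 - α + ρ ≤ oracleCdf m n H (sInf {t | 1 - α ≤ oracleCdf m n H t} + 2 * g) ∧
      oracleCdf m n H (sInf {t | 1 - α ≤ oracleCdf m n H t} - 2 * g) ≤ 1 - α - ρ := by
  obtain ⟨hα0, hα1⟩ := hα
  obtain ⟨ρ, N₀, hρ, h⟩ := exists_gap_mass (c := c) hg
    (lt_min (half_pos hα0) (half_pos (sub_pos.2 hα1)))
  set a' := min (α / 2) ((1 - α) / 2) with ha'
  have ha1 : a' ≤ α / 2 := min_le_left _ _
  have ha2 : a' ≤ (1 - α) / 2 := min_le_right _ _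
  have ha0 : 0 < a' := lt_min (half_pos hα0) (half_pos (sub_pos.2 hα1))
  refine ⟨min ρ a', N₀, lt_min hρ ha0, ?_⟩
  intro d m n H hH hκ hl hN hN₀
  have hmin1 : min ρ a' ≤ ρ := min_le_left _ _
  have hmin2 : min ρ a' ≤ a' := min_le_right _ _
  obtain ⟨C, hC1, hC0⟩ := exists_oracleCdf_level (m := m) (n := n) H
  have hhi : ∃ s, 1 - α ≤ oracleCdf m n H s := ⟨C, by rw [hC1]; linarith⟩
  have hlo : ∃ s, oracleCdf m n H s < 1 - α := ⟨-C - 1, by rw [hC0]; linarith⟩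
  set q := sInf {t | 1 - α ≤ oracleCdf m n H t} with hq
  have hup := le_of_sInf_level_lt (oracleCdf_mono (m := m) (n := n) H) hhi
    (show q < q + g by linarith)
  have hdn := lt_of_lt_sInf_level (oracleCdf_mono (m := m) (n := n) H) hlo
    (show q - g < q by linarith)
  have hgap := h d m n H hH hκ hl hN hN₀
  set π := Measure.pi fun _ : Fin (m + n) => H
  have hmeas : Measurable (polyStat (d := d) m n) := bddMeasurable_polyStat.meas
  -- the part of the mass below `t` splits at `s`
  have hsplit : ∀ s t, s ≤ t → oracleCdf m n H s
      + π.real {z | s < polyStat m n z ∧ polyStat m n z < t} ≤ oracleCdf m n H t := by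
    intro s t hst
    have hd : Disjoint {z | polyStat m n z ≤ s}
        {z : Fin (m + n) → EuclideanSpace ℝ (Fin d) | s < polyStat m n z ∧ polyStat m n z < t} :=
      Set.disjoint_left.2 fun z h1 h2 => absurd h2.1 (not_lt.2 h1)
    refine (measureReal_union (μ := π) hd (hmeas measurableSet_Ioo)).symm.trans_le
      (measureReal_mono fun z hz => ?_)
    rcases hz with hz | hz
    · exact le_trans hz hst
    · exact hz.2.le
  have hcompl : ∀ t, 1 ≤ oracleCdf m n H t + π.real {z | t ≤ polyStat m n z} := by
    intro t
    have hu : (Set.univ : Set (Fin (m + n) → EuclideanSpace ℝ (Fin d)))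
        ⊆ {z | polyStat m n z ≤ t} ∪ {z | t ≤ polyStat m n z} := fun z _ => le_total (polyStat m n z) t
    calc (1 : ℝ) = π.real Set.univ := by simp
      _ ≤ _ := measureReal_mono hu
      _ ≤ _ := measureReal_union_le _ _
  constructor
  -- Either substantial mass lies beyond q + 2g, and then the gap (q + g, q + 2g) carries mass ρ; or
  -- the distribution function at q + 2g already exceeds 1 - a', with a' ≤ α/2. The lower side is
  -- the mirror image.
  · by_cases hcase : a' ≤ π.real {z | q + g + g ≤ polyStat m n z}
    · have h1 := hgap (q + g) (by
        change a' ≤ oracleCdf m n H (q + g)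
        linarith) hcase
      have h2 := hsplit (q + g) (q + g + g) (by linarith)
      rw [show q + 2 * g = q + g + g by ring]
      linarith
    · have h1 := hcompl (q + g + g)
      rw [show q + 2 * g = q + g + g by ring]
      linarith
  · by_cases hcase : a' ≤ π.real {z | polyStat m n z ≤ q - 2 * g}
    · have h0 := hcompl (q - g)
      have h1 := hgap (q - 2 * g) hcase (by
        rw [show q - 2 * g + g = q - g by ring]
        linarith)
      have h2 := hsplit (q - 2 * g) (q - 2 * g + g) (by linarith)
      rw [show q - 2 * g + g = q - g by ring] at h1 h2
      linarith
    · have : oracleCdf m n H (q - 2 * g) < a' := not_le.1 hcase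
      linarith

end CriticalValues

/-! ### Concentration of permutation averages and comparison of critical values. -/

section Concentration

variable {d m n : ℕ}

lemma append_eq_lawFamily (H P Q : Measure (EuclideanSpace ℝ (Fin d))) :
    Fin.append (fun _ : Fin m => P) (fun _ : Fin n => Q)
      = lawFamily H P Q ∅ (univ.map (Fin.castAddEmb n : Fin m ↪ Fin (m + n))) := by
  funext i
  refine Fin.addCases (fun i => ?_) (fun j => ?_) i
  · simp [lawFamily]
  · have : ∀ i : Fin m, Fin.castAdd n i ≠ Fin.natAdd m j := fun i => castAdd_ne_natAdd i j
    simp [lawFamily, this]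

lemma const_eq_lawFamily {ι : Type*} [Fintype ι] [DecidableEq ι]
    (H P Q : Measure (EuclideanSpace ℝ (Fin d))) :
    (fun _ : ι => H) = lawFamily H P Q univ ∅ := by
  funext i
  simp [lawFamily]

instance isProbabilityMeasure_append (P Q : Measure (EuclideanSpace ℝ (Fin d)))
    [IsProbabilityMeasure P] [IsProbabilityMeasure Q] (i : Fin (m + n)) :
    IsProbabilityMeasure (Fin.append (fun _ : Fin m => P) (fun _ : Fin n => Q) i) := by
  refine Fin.addCases (fun i => ?_) (fun j => ?_) i
  · rwa [Fin.append_left]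
  · rwa [Fin.append_right]

/-- The permutation average at the pooled sample concentrates around its mean under the
mixture. -/
lemma exists_concentration {K c ρ : ℝ} (hK : 0 ≤ K) (hc : 0 ≤ c) (hρ : 0 < ρ) :
    ∃ B η : ℝ, 0 ≤ B ∧ 0 < η ∧ ∀ (d m n : ℕ) (P Q : Measure (EuclideanSpace ℝ (Fin d))) (p q : ℝ)
      (f : ℝ → ℝ), IsProbabilityMeasure P → IsProbabilityMeasure Q → 0 ≤ p → 0 ≤ q →
      p + q = 1 → |quadCoef m n| ≤ c → |linCoef m n| ≤ c → 0 < m + n →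
      |p - (m : ℝ) / ((m + n : ℕ) : ℝ)| ≤ η → 1 / ((m + n : ℕ) : ℝ) ≤ η → BddMeasurable f →
      (∀ s, SmoothBound (fun t => f (s + t)) K) →
      Measure.pi (Fin.append (fun _ : Fin m => P) (fun _ : Fin n => Q))
        {z | ρ ≤ |permMean m n f z - ∫ w, permMean m n f w
          ∂Measure.pi (fun _ : Fin (m + n) => mixture p q P Q)|}
        ≤ ENNReal.ofReal (B / ((m + n : ℕ) : ℝ)) := by
  set D : ℝ := K * (60000 * c ^ 4 + 1584 * c ^ 3 + 248 * c + 1) with hD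
  have hD0 : 0 ≤ D := by positivity
  -- With s = w/N, the terms of the mean comparison are at most ρ/4 from 1/(2w), and ρ/4 from the
  -- proportion error and the binomial variance. The other ρ/2 is left for Chebyshev.
  set w : ℝ := 2 * (D + 1) / ρ with hw
  have hw0 : 0 < w := by positivity
  refine ⟨2 * D ^ 2 / ρ ^ 2, min 1 (ρ / (4 * (D + 1) * w)), by positivity,
    lt_min one_pos (by positivity), ?_⟩
  intro d m n P Q p q f hP hQ hp hq hpq hκ hl hN hη1 hη2 hf hfs
  set η := min 1 (ρ / (4 * (D + 1) * w)) with hη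
  have hN' : (0 : ℝ) < ((m + n : ℕ) : ℝ) := Nat.cast_pos.2 hN
  have hH := isProbabilityMeasure_mixture (P := P) (Q := Q) hp hq hpq
  have hL := abs_permMean_update_sub_le (d := d) hκ hl hfs
  rw [← hD] at hL
  have hg := bddMeasurable_permMean (d := d) (m := m) (n := n) hf
  have hmean := abs_integral_mixture_sub_le (H := mixture p q P Q) (P := P) (Q := Q) hp hq hpq rfl
    hg (by positivity : 0 ≤ D / ((m + n : ℕ) : ℝ)) hL (fun z σ => permMean_comp f z σ)
    (univ.map (Fin.castAddEmb n : Fin m ↪ Fin (m + n)))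
    (s := w / ((m + n : ℕ) : ℝ)) (by positivity) univ ∅ (Finset.disjoint_empty_right _)
  rw [← const_eq_lawFamily, ← append_eq_lawFamily] at hmean
  simp only [Finset.card_empty, Nat.cast_zero, Finset.card_univ, Fintype.card_fin,
    Finset.card_map, zero_add] at hmean
  set N : ℝ := ((m + n : ℕ) : ℝ) with hNd
  set I := ∫ z, permMean m n f z ∂Measure.pi (fun _ : Fin (m + n) => mixture p q P Q)
  set I' := ∫ z, permMean m n f z ∂Measure.pi
    (Fin.append (fun _ : Fin m => P) (fun _ : Fin n => Q))
  have hb : |I - I'| ≤ ρ / 2 := by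
    refine hmean.trans ?_
    have e : D / N * (w / N / 2 * ((N * p - m) ^ 2 + N * (p * q)) + 1 / (2 * (w / N)))
        = D * (w / 2 * ((p - m / N) ^ 2 + 1 / N * (p * q)) + 1 / (2 * w)) := by
      field_simp
    rw [e]
    have hη0 : 0 < η := lt_min one_pos (by positivity)
    have h1 : (p - m / N) ^ 2 ≤ η := by
      rw [← sq_abs]
      have : η ≤ 1 := min_le_left _ _
      nlinarith [abs_nonneg (p - m / N)]
    have h2 : 1 / N * (p * q) ≤ η := by
      have : p * q ≤ 1 := by nlinarith
      calc _ ≤ 1 / N * 1 := by gcongr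
        _ ≤ η := by rwa [mul_one]
    have h3 : η ≤ ρ / (4 * (D + 1) * w) := min_le_right _ _
    calc _ ≤ (D + 1) * (w / 2 * (ρ / (4 * (D + 1) * w) + ρ / (4 * (D + 1) * w))
          + 1 / (2 * w)) := by
          gcongr
          · linarith
          · exact h1.trans h3
          · exact h2.trans h3
      _ = ρ / 2 := by
          rw [hw]
          field_simp
          norm_num
  have hsub : {z | ρ ≤ |permMean m n f z - I|} ⊆ {z : Fin (m + n) → EuclideanSpace ℝ (Fin d) |
      ρ / 2 ≤ |permMean m n f z - I'|} := by
    intro z hz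
    have h1 : ρ ≤ |permMean m n f z - I| := hz
    have h2 := abs_sub_le (permMean m n f z) I' I
    rw [abs_sub_comm I' I] at h2
    change ρ / 2 ≤ |permMean m n f z - I'|
    linarith
  refine (measure_mono hsub).trans ((measure_abs_sub_integral_ge_le _ hg hL
    (half_pos hρ)).trans (ENNReal.ofReal_le_ofReal (le_of_eq ?_)))
  rw [← hNd]
  field_simp

/-- The permutation critical value is close to the oracle critical value with high
probability. -/
theorem exists_criticalValue_bound {α ε c : ℝ} (hα : α ∈ Set.Ioo (0 : ℝ) 1) (hε : 0 < ε)
    (hc : 0 ≤ c) :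
    ∃ B η N₀ : ℝ, 0 ≤ B ∧ 0 < η ∧ ∀ (d m n : ℕ) (P Q : Measure (EuclideanSpace ℝ (Fin d)))
      (p q : ℝ), IsProbabilityMeasure P → IsProbabilityMeasure Q → (∀ x, P {x} = 0) →
      (∀ x, Q {x} = 0) → 0 ≤ p → 0 ≤ q → p + q = 1 → 2 ≤ m → 2 ≤ n →
      |quadCoef m n| ≤ c → |linCoef m n| ≤ c → N₀ ≤ ((m + n : ℕ) : ℝ) →
      |p - (m : ℝ) / ((m + n : ℕ) : ℝ)| ≤ η → 1 / ((m + n : ℕ) : ℝ) ≤ η →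
      Measure.pi (Fin.append (fun _ : Fin m => P) (fun _ : Fin n => Q))
        {z | ε ≤ |oracleCriticalValue α (scaledStat m n) (mixture p q P Q)
          - permutationCriticalValue α (scaledStat m n) z|}
        ≤ ENNReal.ofReal (B / ((m + n : ℕ) : ℝ)) + ENNReal.ofReal (B / ((m + n : ℕ) : ℝ)) := by
  have hg : 0 < ε / 4 := by positivity
  obtain ⟨ρ, N₀, hρ, hinc⟩ := exists_quantile_increase (c := c) hα hg
  obtain ⟨K, hK, hstep⟩ := exists_smoothBound_smoothStep hg
  obtain ⟨B, η, hB, hη, hcon⟩ := exists_concentration hK hc (half_pos hρ)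
  refine ⟨B, η, N₀, hB, hη, ?_⟩
  intro d m n P Q p q hP hQ hP0 hQ0 hp hq hpq hm hn hκ hl hN₀ hη1 hη2
  have hN : 0 < m + n := by omega
  have hH := isProbabilityMeasure_mixture (P := P) (Q := Q) hp hq hpq
  have hH0 : ∀ x, mixture p q P Q {x} = 0 := by
    intro x
    simp [mixture, hP0, hQ0]
  obtain ⟨hup, hdn⟩ := hinc d m n (mixture p q P Q) hH hκ hl hN hN₀
  rw [oracleCriticalValue_eq α hm hn _ hH0]
  set t := sInf {t | 1 - α ≤ oracleCdf m n (mixture p q P Q) t}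
  set g := ε / 4 with hgd
  -- Two deterministic test functions suffice, since `t` is the oracle quantile. They test at
  -- distance 2g from it, where the oracle distribution function has gained ρ; half is lost to
  -- concentration. Smoothing costs a further g, so the total distance is 3g < ε.
  have c1 := hcon d m n P Q p q (smoothStep (t + 2 * g) g) hP hQ hp hq hpq hκ hl hN hη1 hη2
    (bddMeasurable_smoothStep _ _) (hstep _)
  have c2 := hcon d m n P Q p q (smoothStep (t - 3 * g) g) hP hQ hp hq hpq hκ hl hN hη1 hη2
    (bddMeasurable_smoothStep _ _) (hstep _)
  have m1 := oracleCdf_le_integral_permMean (m := m) (n := n) (mixture p q P Q)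
    (c := t + 2 * g) hg
  have m2 := integral_permMean_le_oracleCdf (m := m) (n := n) (mixture p q P Q)
    (c := t - 3 * g) hg
  rw [show t - 3 * g + g = t - 2 * g by ring] at m2
  refine (measure_mono_ae (t := {z | ρ / 2 ≤ |permMean m n (smoothStep (t + 2 * g) g) z - _|}
    ∪ {z | ρ / 2 ≤ |permMean m n (smoothStep (t - 3 * g) g) z - _|}) ?_).trans
    ((measure_union_le _ _).trans (add_le_add c1 c2))
  have hinj := ae_injective (Fin.append (fun _ : Fin m => P) (fun _ : Fin n => Q)) (by
    intro i x
    refine Fin.addCases (fun i => ?_) (fun j => ?_) i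
    · rw [Fin.append_left]
      exact hP0 x
    · rw [Fin.append_right]
      exact hQ0 x)
  filter_upwards [hinj] with z hz hbad
  by_contra hgood
  obtain ⟨h1, h2⟩ := not_or.1 hgood
  rw [Set.mem_ofPred_eq, not_le, abs_lt] at h1 h2
  have hbad' : ε ≤ |t - permutationCriticalValue α (scaledStat m n) z| := hbad
  rw [permutationCriticalValue_eq α hm hn hz] at hbad'
  obtain ⟨C, hC1, hC0⟩ := exists_permCdf_level z
  have hhi : ∃ s, 1 - α ≤ permCdf m n z s := ⟨C, by rw [hC1]; linarith [hα.1]⟩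
  have hlo : ∃ s, permCdf m n z s < 1 - α := ⟨-C - 1, by rw [hC0]; linarith [hα.2]⟩
  have b1 : sInf {s | 1 - α ≤ permCdf m n z s} ≤ t + 3 * g := by
    refine sInf_level_le (permCdf_mono z) hlo ?_
    have := permMean_mono (m := m) (n := n)
      (fun s => smoothStep_le_indicator (c := t + 2 * g) hg s) z
    rw [show t + 2 * g + g = t + 3 * g by ring] at this
    refine le_trans ?_ this
    linarith
  have b2 : t - 3 * g ≤ sInf {s | 1 - α ≤ permCdf m n z s} := by
    refine le_sInf_level (permCdf_mono z) hhi ?_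
    have := permMean_mono (m := m) (n := n)
      (fun s => indicator_le_smoothStep (c := t - 3 * g) hg s) z
    refine lt_of_le_of_lt this ?_
    linarith
  have : |t - sInf {s | 1 - α ≤ permCdf m n z s}| ≤ 3 * g := by
    rw [abs_le]
    constructor <;> linarith
  linarith

end Concentration

/-! ### Verification of the hypotheses and passage to the limit. -/

section Assembly

variable {d : ℕ}

/-- Over a common denominator both coefficients are at most a multiple of N⁴ / (m(m-1)n(n-1)), and m
- 1 ≥ m/2, n - 1 ≥ n/2 because m, n ≥ 2. -/
lemma abs_coef_le {m n : ℕ} (hm : 2 ≤ m) (hn : 2 ≤ n) {c : ℝ} (hc : 0 < c)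
    (hmc : c ≤ (m : ℝ) / (m + n)) (hnc : c ≤ (n : ℝ) / (m + n)) :
    |quadCoef m n| ≤ 8 / c ^ 4 ∧ |linCoef m n| ≤ 8 / c ^ 4 := by
  have m2 : (2 : ℝ) ≤ m := by exact_mod_cast hm
  have n2 : (2 : ℝ) ≤ n := by exact_mod_cast hn
  unfold quadCoef linCoef
  generalize (m : ℝ) = a at *
  generalize (n : ℝ) = b at *
  have ha : 0 < a := by linarith
  have hb : 0 < b := by linarith
  have ha1 : 0 < a - 1 := by linarith
  have hb1 : 0 < b - 1 := by linarith
  have hN : 0 < a + b := by linarith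
  rw [le_div_iff₀ hN] at hmc hnc
  have hc1 : c ≤ 1 := by nlinarith
  have key : (a + b) ^ 4 / (a * (a - 1) * (b * (b - 1))) ≤ 4 / c ^ 4 := by
    rw [div_le_div_iff₀ (by positivity) (by positivity)]
    have h1 : a ^ 2 ≤ 2 * (a * (a - 1)) := by nlinarith
    have h2 : b ^ 2 ≤ 2 * (b * (b - 1)) := by nlinarith
    have h3 : (c * (a + b)) ^ 2 ≤ a ^ 2 := pow_le_pow_left₀ (by positivity) hmc 2
    have h4 : (c * (a + b)) ^ 2 ≤ b ^ 2 := pow_le_pow_left₀ (by positivity) hnc 2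
    calc (a + b) ^ 4 * c ^ 4 = (c * (a + b)) ^ 2 * (c * (a + b)) ^ 2 := by ring
      _ ≤ (2 * (a * (a - 1))) * (2 * (b * (b - 1))) :=
        mul_le_mul (h3.trans h1) (h4.trans h2) (by positivity) (by positivity)
      _ = _ := by ring
  have e1 : (a + b) ^ 3 * (1 / (a * (a - 1) * b) + 1 / (b * (b - 1) * a))
      = (a + b) ^ 3 * (a + b - 2) / (a * (a - 1) * (b * (b - 1))) := by
    field_simp
    ring
  have e2 : 2 * (a + b) ^ 3 * (1 / ((a - 1) * b) - 1 / ((b - 1) * a))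
      = 2 * (a + b) ^ 3 * (b - a) / (a * (a - 1) * (b * (b - 1))) := by
    field_simp
    ring
  have hab : |b - a| ≤ a + b := by
    rw [abs_le]
    constructor <;> linarith
  have hpos : 0 < a * (a - 1) * (b * (b - 1)) := by positivity
  have h48 : 2 * (4 / c ^ 4) = 8 / c ^ 4 := by ring
  rw [e1, e2, ← h48]
  constructor
  · rw [abs_of_nonneg (div_nonneg (mul_nonneg (by positivity) (by linarith)) hpos.le)]
    calc _ ≤ (a + b) ^ 4 / (a * (a - 1) * (b * (b - 1))) := by
          gcongr
          nlinarith [pow_pos hN 3]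
      _ ≤ 4 / c ^ 4 := key
      _ ≤ _ := by
          have : 0 < 4 / c ^ 4 := by positivity
          linarith
  · rw [abs_div, abs_of_pos hpos, abs_mul, abs_of_pos (by positivity : 0 < 2 * (a + b) ^ 3)]
    calc _ ≤ 2 * (a + b) ^ 3 * (a + b) / (a * (a - 1) * (b * (b - 1))) := by gcongr
      _ = 2 * ((a + b) ^ 4 / (a * (a - 1) * (b * (b - 1)))) := by ring
      _ ≤ _ := by gcongr

/-- An atom of `P` projects to an atom in every direction, so a single good direction excludes it.
One exists because the uniform measure on the sphere is nonzero for d ≥ 1. -/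
lemma measure_singleton_eq_zero_of_hasContinuousProjections (hd : 1 ≤ d)
    {P : Measure (EuclideanSpace ℝ (Fin d))} [IsProbabilityMeasure P]
    (h : HasContinuousProjections P) (x : EuclideanSpace ℝ (Fin d)) : P {x} = 0 := by
  have : Nonempty (Fin d) := ⟨⟨0, hd⟩⟩
  have : Nontrivial (EuclideanSpace ℝ (Fin d)) := inferInstance
  set S := (volume : Measure (EuclideanSpace ℝ (Fin d))).toSphere with hS
  have hne : NeBot (ae (uniformSphere d)) := by
    rw [ae_neBot]
    intro h0
    have h1 : uniformSphere d = (S Set.univ)⁻¹ • S := rfl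
    have h2 := congrArg (fun ν => ν Set.univ) (h1.symm.trans h0)
    simp only [Measure.smul_apply, smul_eq_mul, Measure.coe_zero, Pi.zero_apply] at h2
    rw [ENNReal.inv_mul_cancel] at h2
    · exact one_ne_zero h2
    · rw [Ne, Measure.measure_univ_eq_zero]
      exact Measure.toSphere_ne_zero _
    · exact measure_ne_top _ _
  obtain ⟨β, hβ⟩ := h.exists
  have hm : Measurable fun y : EuclideanSpace ℝ (Fin d) => inner ℝ β.1 y := by fun_prop
  have hprob : IsProbabilityMeasure (P.map fun y => inner ℝ β.1 y) :=
    Measure.isProbabilityMeasure_map hm.aemeasurable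
  have h3 : (P.map fun y => inner ℝ β.1 y) {inner ℝ β.1 x} = 0 := by
    rw [← measure_cdf (P.map fun y => inner ℝ β.1 y), StieltjesFunction.measure_singleton,
      (hβ.continuousAt.continuousWithinAt).leftLim_eq, sub_self, ENNReal.ofReal_zero]
  refine measure_mono_null ?_ ((Measure.map_apply hm (measurableSet_singleton _)).symm.trans h3)
  intro y hy
  rw [Set.mem_singleton_iff.1 hy]
  rfl

lemma IsTwoSample.map_pooled {Ω : Type*} [MeasurableSpace Ω] {m n : ℕ} {μ : Measure Ω}
    [IsProbabilityMeasure μ] {X : Fin m → Ω → EuclideanSpace ℝ (Fin d)}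
    {Y : Fin n → Ω → EuclideanSpace ℝ (Fin d)} {P Q : Measure (EuclideanSpace ℝ (Fin d))}
    (h : IsTwoSample μ X Y P Q) :
    AEMeasurable (pooled X Y) μ ∧ μ.map (pooled X Y)
      = Measure.pi (Fin.append (fun _ : Fin m => P) (fun _ : Fin n => Q)) := by
  have hap : ∀ i ω, Fin.append X Y i ω = pooled X Y ω i := by
    intro i ω
    refine Fin.addCases (fun i => ?_) (fun j => ?_) i
    · simp [pooled]
    · simp [pooled]
  have hlaw : ∀ i, AEMeasurable (Fin.append X Y i) μ
      ∧ μ.map (Fin.append X Y i) = Fin.append (fun _ : Fin m => P) (fun _ : Fin n => Q) i := by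
    intro i
    refine Fin.addCases (fun i => ?_) (fun j => ?_) i
    · rw [Fin.append_left, Fin.append_left]
      exact ⟨(h.law_left i).aemeasurable, (h.law_left i).map_eq⟩
    · rw [Fin.append_right, Fin.append_right]
      exact ⟨(h.law_right j).aemeasurable, (h.law_right j).map_eq⟩
  have e : pooled X Y = fun ω i => Fin.append X Y i ω :=
    funext fun ω => funext fun i => (hap i ω).symm
  refine ⟨?_, ?_⟩
  · rw [e]
    exact aemeasurable_pi_lambda _ fun i => (hlaw i).1
  · rw [e, (iIndepFun_iff_map_fun_eq_pi_map fun i => (hlaw i).1).1 h.indep]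
    simp only [(hlaw _).2]

/-- Convergence of the critical values for arbitrary arrays of laws without atoms. -/
theorem tendstoZero_criticalValue {α ϑX ϑY : ℝ} (hα : α ∈ Set.Ioo (0 : ℝ) 1)
    (hϑX : ϑX ∈ Set.Ioo (0 : ℝ) 1) (hϑY : ϑY ∈ Set.Ioo (0 : ℝ) 1)
    (m n : ℕ → ℕ) (hm : ∀ ν, 2 ≤ m ν) (hn : ∀ ν, 2 ≤ n ν)
    (hN : Tendsto (fun ν => m ν + n ν) atTop atTop)
    (hX : Tendsto (fun ν => (m ν : ℝ) / ((m ν : ℝ) + (n ν : ℝ))) atTop (𝓝 ϑX))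
    (hY : Tendsto (fun ν => (n ν : ℝ) / ((m ν : ℝ) + (n ν : ℝ))) atTop (𝓝 ϑY))
    {Ω : ℕ → Type*} [∀ ν, MeasurableSpace (Ω ν)]
    (μ : ∀ ν, Measure (Ω ν)) [∀ ν, IsProbabilityMeasure (μ ν)]
    (X : ∀ ν, Fin (m ν) → Ω ν → EuclideanSpace ℝ (Fin d))
    (Y : ∀ ν, Fin (n ν) → Ω ν → EuclideanSpace ℝ (Fin d))
    (P Q : ℕ → Measure (EuclideanSpace ℝ (Fin d)))
    (hP : ∀ᶠ ν in atTop, IsProbabilityMeasure (P ν) ∧ ∀ x, P ν {x} = 0)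
    (hQ : ∀ᶠ ν in atTop, IsProbabilityMeasure (Q ν) ∧ ∀ x, Q ν {x} = 0)
    (hXY : ∀ᶠ ν in atTop, IsTwoSample (μ ν) (X ν) (Y ν) (P ν) (Q ν)) :
    TendstoZeroInProbability μ fun ν ω =>
      oracleCriticalValue α (scaledStat (m ν) (n ν)) (mixture ϑX ϑY (P ν) (Q ν))
        - permutationCriticalValue α (scaledStat (m ν) (n ν)) (pooled (X ν) (Y ν) ω) := by
  intro ε hε
  -- Forced by the limits of the two proportions, whose sum is 1 for every ν.
  have hsum : ϑX + ϑY = 1 := by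
    refine tendsto_nhds_unique (hX.add hY) (tendsto_const_nhds.congr fun ν => ?_)
    have h1 := hm ν
    have : (0 : ℝ) < (m ν : ℝ) + n ν := by
      have : (0 : ℝ) < m ν := by exact_mod_cast (by omega : 0 < m ν)
      positivity
    rw [← add_div, div_self this.ne']
  set c₀ := min (ϑX / 2) (ϑY / 2) with hc₀
  have hc₀pos : 0 < c₀ := lt_min (half_pos hϑX.1) (half_pos hϑY.1)
  obtain ⟨B, η, N₀, hB, hη, hmain⟩ := exists_criticalValue_bound (c := 8 / c₀ ^ 4) hα hε
    (by positivity)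
  have hNr : Tendsto (fun ν => ((m ν + n ν : ℕ) : ℝ)) atTop atTop :=
    tendsto_natCast_atTop_atTop.comp hN
  have hinv : Tendsto (fun ν => 1 / ((m ν + n ν : ℕ) : ℝ)) atTop (𝓝 0) :=
    hNr.const_div_atTop 1
  have hBN : Tendsto (fun ν => ENNReal.ofReal (B / ((m ν + n ν : ℕ) : ℝ))
      + ENNReal.ofReal (B / ((m ν + n ν : ℕ) : ℝ))) atTop (𝓝 0) := by
    have h1 := ENNReal.tendsto_ofReal (hNr.const_div_atTop B)
    rw [ENNReal.ofReal_zero] at h1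
    simpa using h1.add h1
  have e1 : ∀ᶠ ν in atTop, c₀ ≤ (m ν : ℝ) / (m ν + n ν) :=
    (hX.eventually_const_lt (show c₀ < ϑX from
      (min_le_left _ _).trans_lt (half_lt_self hϑX.1))).mono fun _ h => h.le
  have e2 : ∀ᶠ ν in atTop, c₀ ≤ (n ν : ℝ) / (m ν + n ν) :=
    (hY.eventually_const_lt (show c₀ < ϑY from
      (min_le_right _ _).trans_lt (half_lt_self hϑY.1))).mono fun _ h => h.le
  have e3 : ∀ᶠ ν in atTop, |ϑX - (m ν : ℝ) / ((m ν + n ν : ℕ) : ℝ)| ≤ η := by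
    have := (hX.const_sub ϑX).abs
    rw [sub_self, abs_zero] at this
    filter_upwards [this.eventually_lt_const hη] with ν h
    rw [Nat.cast_add]
    exact h.le
  refine tendsto_of_tendsto_of_tendsto_of_le_of_le' tendsto_const_nhds hBN
    (Eventually.of_forall fun _ => zero_le) ?_
  filter_upwards [e1, e2, e3, hinv.eventually_le_const hη, hNr.eventually_ge_atTop N₀, hP, hQ,
    hXY] with ν h1 h2 h3 h4 h5 hPν hQν hXYν
  obtain ⟨hq, hl⟩ := abs_coef_le (hm ν) (hn ν) hc₀pos h1 h2
  have key := hmain d (m ν) (n ν) (P ν) (Q ν) ϑX ϑY hPν.1 hQν.1 hPν.2 hQν.2 hϑX.1.le hϑY.1.le hsum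
    (hm ν) (hn ν) hq hl h5 h3 h4
  obtain ⟨hae, hmap⟩ := hXYν.map_pooled
  rw [← hmap] at key
  -- An inequality is enough, so the exceptional set need not be shown measurable.
  exact (Measure.le_map_apply hae _).trans key

end Assembly

end CvM

theorem mainTheorem6 {d : ℕ} (hd : 1 ≤ d)
    {α ϑX ϑY : ℝ} (hα : α ∈ Set.Ioo (0 : ℝ) 1)
    (hϑX : ϑX ∈ Set.Ioo (0 : ℝ) 1) (hϑY : ϑY ∈ Set.Ioo (0 : ℝ) 1)
    (m n : ℕ → ℕ) (hm : ∀ ν, 2 ≤ m ν) (hn : ∀ ν, 2 ≤ n ν)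
    (hN : Tendsto (fun ν => m ν + n ν) atTop atTop)
    (hX : Tendsto (fun ν => (m ν : ℝ) / ((m ν : ℝ) + (n ν : ℝ))) atTop (𝓝 ϑX))
    (hY : Tendsto (fun ν => (n ν : ℝ) / ((m ν : ℝ) + (n ν : ℝ))) atTop (𝓝 ϑY))
    {Ω : ℕ → Type*} [∀ ν, MeasurableSpace (Ω ν)]
    (μ : ∀ ν, Measure (Ω ν)) [∀ ν, IsProbabilityMeasure (μ ν)]
    (X : ∀ ν, Fin (m ν) → Ω ν → EuclideanSpace ℝ (Fin d))
    (Y : ∀ ν, Fin (n ν) → Ω ν → EuclideanSpace ℝ (Fin d)) :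
    -- null hypothesis (`PX = PY`) and fixed alternatives (`PX ≠ PY`)
    (∀ PX PY : Measure (EuclideanSpace ℝ (Fin d)),
      IsProbabilityMeasure PX → IsProbabilityMeasure PY →
      CvM.HasContinuousProjections PX → CvM.HasContinuousProjections PY →
      (∀ ν, CvM.IsTwoSample (μ ν) (X ν) (Y ν) PX PY) →
      CvM.TendstoZeroInProbability μ fun ν ω =>
        CvM.oracleCriticalValue α (CvM.scaledStat (m ν) (n ν)) (CvM.mixture ϑX ϑY PX PY)
          - CvM.permutationCriticalValue α (CvM.scaledStat (m ν) (n ν))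
              (CvM.pooled (X ν) (Y ν) ω)) ∧
    -- contiguous alternatives
    (∀ (k : ℕ) (Θ : Set (EuclideanSpace ℝ (Fin k)))
      (P : EuclideanSpace ℝ (Fin k) → Measure (EuclideanSpace ℝ (Fin d)))
      (θ₀ b : EuclideanSpace ℝ (Fin k)),
      IsOpen Θ → θ₀ ∈ Θ →
      (∀ θ ∈ Θ, IsProbabilityMeasure (P θ)) → (∀ θ ∈ Θ, P θ ≪ volume) →
      CvM.IsQMDAt P θ₀ →
      (∀ᶠ ν in atTop, CvM.IsTwoSample (μ ν) (X ν) (Y ν) (P θ₀)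
        (P (θ₀ + (1 / √((m ν + n ν : ℕ) : ℝ)) • b))) →
      CvM.TendstoZeroInProbability μ fun ν ω =>
        CvM.oracleCriticalValue α (CvM.scaledStat (m ν) (n ν))
            (CvM.mixture ϑX ϑY (P θ₀) (P (θ₀ + (1 / √((m ν + n ν : ℕ) : ℝ)) • b)))
          - CvM.permutationCriticalValue α (CvM.scaledStat (m ν) (n ν))
              (CvM.pooled (X ν) (Y ν) ω)) := by
  refine ⟨fun PX PY hPX hPY hcX hcY hXY => ?_, fun k Θ P θ₀ b hΘ hθ₀ hP hac _ hXY => ?_⟩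
  · exact CvM.tendstoZero_criticalValue hα hϑX hϑY m n hm hn hN hX hY μ X Y (fun _ => PX)
      (fun _ => PY)
      (Eventually.of_forall fun _ => ⟨hPX,
        CvM.measure_singleton_eq_zero_of_hasContinuousProjections hd hcX⟩)
      (Eventually.of_forall fun _ => ⟨hPY,
        CvM.measure_singleton_eq_zero_of_hasContinuousProjections hd hcY⟩)
      (Eventually.of_forall hXY)
  · have : Nonempty (Fin d) := ⟨⟨0, hd⟩⟩
    have hatom : ∀ θ ∈ Θ, IsProbabilityMeasure (P θ) ∧ ∀ x, P θ {x} = 0 := fun θ hθ =>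
      ⟨hP θ hθ, fun x => hac θ hθ (measure_singleton x)⟩
    -- As the parameter set is open, the local parameters eventually belong to it; from then on
    -- their laws are probability measures without atoms.
    have hlim : Tendsto (fun ν => θ₀ + (1 / √((m ν + n ν : ℕ) : ℝ)) • b) atTop (𝓝 θ₀) := by
      have h1 : Tendsto (fun ν => 1 / √((m ν + n ν : ℕ) : ℝ)) atTop (𝓝 0) :=
        (Real.tendsto_sqrt_atTop.comp (tendsto_natCast_atTop_atTop.comp hN)).const_div_atTop 1
      simpa using (h1.smul_const b).const_add θ₀
    exact CvM.tendstoZero_criticalValue hα hϑX hϑY m n hm hn hN hX hY μ X Y (fun _ => P θ₀)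
      (fun ν => P (θ₀ + (1 / √((m ν + n ν : ℕ) : ℝ)) • b))
      (Eventually.of_forall fun _ => hatom θ₀ hθ₀)
      ((hlim.eventually (hΘ.mem_nhds hθ₀)).mono fun _ h => hatom _ h) hXY
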